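/- Let $a\in\mathbb{C}^*$, $\theta\in\mathbb{R}$, and let $\widehat f(z)=\sum_{n\ge 0}\widehat f_{0,n}\frac{z^n}{n!}\in\mathbb{C}[[z]]$ be a formal series, independent of $t$. Let $\widehat u(t,z)=\sum_{n\ge 0}\widehat u_{*,n}(t)\frac{z^n}{n!}\in\mathbb{C}[[z]][[t]]$ be the formal solution of $$\bigl(1-a\,\partial_t^{-1}\partial_z^2\bigr)\widehat u=\widehat f(z),$$ where $\partial_t^{-1}$ is the anti-derivative in $t$ vanishing at $t=0$; that is, $\widehat u$ is the formal solution of $\partial_t \widehat u=a\,\partial_z^2\widehat u$, $\widehat u(0,z)=\widehat f(z)$. Define the 2-Laplace transform of $\widehat f$ by $$\mathcal{L}^{[2]}\widehat f(\zeta)=\sum_{n\ge 0}\frac{\widehat f_{0,n}}{n!}\,\frac{n!}{\lfloor n/2\rfloor!}\,\zeta^n .$$ For $k\in\{1,2\}$, a series $\sum_{\ell\ge 0} c_\ell t^\ell\in\mathbb{C}[[t]]$ is called $k$-summable in the direction $\theta$ if there are an open sector $\Sigma$ with vertex $0$, of positive finite radius, bisected by $\theta$ and of opening larger than $\pi/k$,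 and a holomorphic function $v$ on $\Sigma$, such that on every proper subsector $\Sigma'$ (that is, every sector $\Sigma'$ with vertex $0$ whose closure is contained in $\Sigma\cup\{0\}$) one has $\partial_t^\ell v(t)\to \ell!\,c_\ell$ as $t\to 0$ in $\Sigma'$ for all $\ell\ge 0$, and there are constants $C,K>0$ with $$|\partial_t^\ell v(t)|\le C K^\ell\,\Gamma\bigl(1+(1+\tfrac1k)\ell\bigr)\qquad\text{for all }\ell\ge 0,\ t\in\Sigma'.$$ Then the following three assertions are equivalent. (i) $\widehat u_{*,0}(t)$ and $\widehat u_{*,1}(t)$ are 1-summable in the direction $\theta$. (ii) $\mathcal{L}^{[2]}\widehat f$ is 2-summable in the directions $\frac12(\theta+\arg a)$ mod $\pi$. (iii) $\widehat f$ converges near $0$, and for each direction $d\in\frac12(\theta+\arg a)+\pi\mathbb{Z}$ its sum can be continued analytically to an open unbounded sector with vertex $0$ bisected by $d$, with exponential growth of order 2 at infinity there, that is, its absolute value is at most $C\exp(K|z|^2)$ for all $z$ in the sector with $|z|\ge M$, for some constants $C,K,M$. -/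

import Mathlib

open Filter Topology

noncomputable section

namespace HeatSum

/-! Formal series `û(t,z) ∈ ℂ[[z]][[t]]` are elements of `PowerSeries (PowerSeries ℂ)`:
the outer variable is `t`, the inner variable is `z`. -/

/-- The derivation `∂_z` on `ℂ[[z]][[t]]`, acting on each coefficient of `t ^ j`. -/
def dz (u : PowerSeries (PowerSeries ℂ)) : PowerSeries (PowerSeries ℂ) :=
  PowerSeries.mk fun j => PowerSeries.derivative ℂ (PowerSeries.coeff j u)

/-- The anti-derivative `∂_t⁻¹` on `ℂ[[z]][[t]]` vanishing at `t = 0`: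
`t ^ j ↦ t ^ (j + 1) / (j + 1)`. -/
def dtInv (u : PowerSeries (PowerSeries ℂ)) : PowerSeries (PowerSeries ℂ) :=
  PowerSeries.mk fun j =>
    match j with
    | 0 => 0
    | i + 1 => ((i : ℂ) + 1)⁻¹ • PowerSeries.coeff i u

/-- The heat operator `D = 1 - a(z) ∂_t⁻¹ ∂_z²` on `ℂ[[z]][[t]]`. -/
def heatOp (a : PowerSeries ℂ) (u : PowerSeries (PowerSeries ℂ)) :
    PowerSeries (PowerSeries ℂ) :=
  u - PowerSeries.C a * dtInv (dz (dz u))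

/-- The series `û_{*,n}(t) ∈ ℂ[[t]]` in the expansion `û(t,z) = ∑ û_{*,n}(t) z ^ n / n!`. -/
def zPart (n : ℕ) (u : PowerSeries (PowerSeries ℂ)) : PowerSeries ℂ :=
  PowerSeries.mk fun j => (n.factorial : ℂ) * PowerSeries.coeff n (PowerSeries.coeff j u)

/-- The `2`-Laplace transform `z ^ n ↦ (n! / ⌊n/2⌋!) ζ ^ n` of a formal series
(`n / 2` is the integer part). -/
def laplace2 (f : PowerSeries ℂ) : PowerSeries ℂ :=
  PowerSeries.mk fun n =>
    PowerSeries.coeff n f * ((n.factorial : ℂ) / ((n / 2).factorial : ℂ))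

/-- The open unbounded sector with vertex `0`, bisected by the direction `θ`, with opening `α`. -/
def unboundedSector (θ α : ℝ) : Set ℂ :=
  {t | ∃ r φ : ℝ, 0 < r ∧ |φ - θ| < α / 2 ∧ t = (r : ℂ) * Complex.exp ((φ : ℂ) * Complex.I)}

/-- The open sector with vertex `0`, bisected by `θ`, with opening `α` and radius `R`. -/
def sector (θ α R : ℝ) : Set ℂ :=
  unboundedSector θ α ∩ Metric.ball 0 R

/-- `c ∈ ℂ[[t]]` is `k`-summable in the direction `θ` (`k ≥ 1`): some function `u`, holomorphic on
a sector bisected by `θ` of opening larger than `π / k`, has `c` as its Taylor series at `0` and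
is `1/k`-Gevrey there. The last two requirements are made on every proper subsector, that is,
every sector whose closure is contained in the given sector together with `0`. -/
def IsSummable (k : ℕ) (θ : ℝ) (c : PowerSeries ℂ) : Prop :=
  ∃ (α R : ℝ) (u : ℂ → ℂ), Real.pi / k < α ∧ 0 < R ∧
    DifferentiableOn ℂ u (sector θ α R) ∧
    ∀ θ' α' R' : ℝ, closure (sector θ' α' R') ⊆ sector θ α R ∪ {0} →
      (∀ l : ℕ, Tendsto (iteratedDeriv l u) (𝓝[sector θ' α' R'] 0)
        (𝓝 ((l.factorial : ℂ) * PowerSeries.coeff l c))) ∧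
      ∃ C K : ℝ, 0 < C ∧ 0 < K ∧ ∀ l : ℕ, ∀ t ∈ sector θ' α' R',
        ‖iteratedDeriv l u t‖ ≤ C * K ^ l * Real.Gamma (1 + (1 + 1 / (k : ℝ)) * l)

/-- The formal series `f` converges near `0` and its sum continues analytically to an unbounded
sector around the direction `d`, with exponential growth of order `k` at infinity. -/
def ContinuesWithGrowth (k : ℕ) (d : ℝ) (f : PowerSeries ℂ) : Prop :=
  ∃ (r ε : ℝ) (F : ℂ → ℂ), 0 < r ∧ 0 < ε ∧
    DifferentiableOn ℂ F (Metric.ball 0 r ∪ unboundedSector d ε) ∧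
    (∀ z ∈ Metric.ball (0 : ℂ) r, HasSum (fun n => PowerSeries.coeff n f * z ^ n) (F z)) ∧
    ∃ C K M : ℝ, ∀ z ∈ unboundedSector d ε, M ≤ ‖z‖ → ‖F z‖ ≤ C * Real.exp (K * ‖z‖ ^ k)

end HeatSum

end

/-!
The coefficients of the formal solution are `û_{*,s} = ∑ aⁿ (s + 2 n)! / n! f_{s + 2 n} tⁿ`, so that
`û_{*,0}` and `û_{*,1}` carry the even and the odd part of `f`
(`HeatSum.coeff_zPart_of_heatOp_eq`). A rotation normalises all directions to the positive real
axis. There the three assertions become statements about the sequences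
`L_n = n! / ⌊n / 2⌋! F_n` and `F_n`, where `F_n` is the rotated coefficient of `f`.

Summability is equivalent to a Gevrey asymptotic expansion with remainders bounded uniformly on one
sector (`HeatSum.isSummable_iff`): Taylor's formula along the rays from the vertex gives the
remainder bounds from the bounds on the derivatives, and Cauchy's estimates on discs of radius
proportional to `‖t‖` give the converse. In this form, level `2` in the two opposite directions
`d` and `d + π` is level `1` for the even and odd parts in the variable `z ^ 2`
(`HeatSum.hasGevreySum_interleave_iff`), and the same holds for continuation with exponential growth
(`HeatSum.hasContinuation_interleave_iff`). All three assertions thereby reduce to level `1`,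
separately for the two parities `s`.

By the duplication formula, `(s + 2 n)! / n! = 4ⁿ Γ(n + s + 1 / 2) / Γ(s + 1 / 2)`. It remains to see
that `∑ Γ(n + β) gₙ tⁿ`, with `β = s + 1 / 2`, has a Gevrey expansion of order `1` on a sector of
opening larger than `π` if and only if `∑ gₙ zⁿ` converges and continues with exponential growth of
order `1` (`HeatSum.hasGevreySum_iff_hasContinuation`). In one direction the Laplace integral
`∫ exp (-x) x ^ (β - 1) F (t x) dx` is taken along rays that rotate with `arg t`
(`HeatSum.HasContinuation.hasGevreySum`). In the other the Borel transform is a Hankel integral of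
`exp (w p) p ^ (1 - β) v (1 / p) dp / p` (`HeatSum.HasGevreySum.hasContinuation`), whose value on
monomials is Hankel's formula for `1 / Γ` (`HeatSum.hankel_borelKernel`). In logarithmic coordinates
rays are horizontal lines, and all contours are moved by Cauchy's theorem on rectangles.
-/

noncomputable section
namespace HeatSum

/-! ### Sectors -/

lemma mem_unboundedSector_iff {θ α : ℝ} {t : ℂ} : t ∈ unboundedSector θ α ↔
    ∃ ξ : ℂ, |ξ.im - θ| < α / 2 ∧ Complex.exp ξ = t := by
  constructor
  · rintro ⟨r, φ, hr, hφ, rfl⟩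
    refine ⟨(Real.log r : ℂ) + φ * Complex.I, by simpa using hφ, ?_⟩
    rw [Complex.exp_add, ← Complex.ofReal_exp, Real.exp_log hr]
  · rintro ⟨ξ, hξ, rfl⟩
    refine ⟨Real.exp ξ.re, ξ.im, Real.exp_pos _, hξ, ?_⟩
    rw [Complex.ofReal_exp, ← Complex.exp_add, Complex.re_add_im]

lemma isOpen_unboundedSector (θ α : ℝ) : IsOpen (unboundedSector θ α) := by
  have : unboundedSector θ α = Complex.exp '' {ξ : ℂ | |ξ.im - θ| < α / 2} := by
    ext t
    simp only [mem_unboundedSector_iff, Set.mem_image, Set.mem_ofPred_eq]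
  rw [this]
  refine Complex.isOpenMap_exp _ ?_
  exact isOpen_lt (by fun_prop) continuous_const

lemma isOpen_sector (θ α R : ℝ) : IsOpen (sector θ α R) :=
  (isOpen_unboundedSector θ α).inter Metric.isOpen_ball

lemma unboundedSector_mono {θ α α' : ℝ} (h : α' ≤ α) :
    unboundedSector θ α' ⊆ unboundedSector θ α := by
  rintro t ⟨r, φ, hr, hφ, rfl⟩
  exact ⟨r, φ, hr, by linarith, rfl⟩

lemma sector_mono {θ α α' R R' : ℝ} (h : α' ≤ α) (hR : R' ≤ R) :
    sector θ α' R' ⊆ sector θ α R :=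
  Set.inter_subset_inter (unboundedSector_mono h) (Metric.ball_subset_ball hR)

lemma ne_zero_of_mem_unboundedSector {θ α : ℝ} {t : ℂ} (h : t ∈ unboundedSector θ α) : t ≠ 0 := by
  obtain ⟨ξ, -, rfl⟩ := mem_unboundedSector_iff.1 h
  exact Complex.exp_ne_zero _

lemma ofReal_mul_mem_unboundedSector {θ α s : ℝ} {t : ℂ} (hs : 0 < s)
    (h : t ∈ unboundedSector θ α) : (s : ℂ) * t ∈ unboundedSector θ α := by
  obtain ⟨r, φ, hr, hφ, rfl⟩ := h
  exact ⟨s * r, φ, by positivity, hφ, by push_cast; ring⟩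

lemma ofReal_mul_mem_sector {θ α R s : ℝ} {t : ℂ} (hs : 0 < s) (hs1 : s ≤ 1)
    (h : t ∈ sector θ α R) : (s : ℂ) * t ∈ sector θ α R := by
  refine ⟨ofReal_mul_mem_unboundedSector hs h.1, ?_⟩
  have := h.2
  rw [mem_ball_zero_iff] at this ⊢
  rw [norm_mul, Complex.norm_real, Real.norm_of_nonneg hs.le]
  exact (mul_le_of_le_one_left (norm_nonneg _) hs1).trans_lt this

lemma exp_mul_I_mul_mem_unboundedSector {θ α ω : ℝ} {t : ℂ} (h : t ∈ unboundedSector θ α) :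
    Complex.exp (ω * Complex.I) * t ∈ unboundedSector (θ + ω) α := by
  obtain ⟨r, φ, hr, hφ, rfl⟩ := h
  refine ⟨r, φ + ω, hr, by simpa using hφ, ?_⟩
  push_cast
  rw [add_mul, Complex.exp_add]
  ring

lemma exp_mul_I_mul_mem_sector {θ α ω R : ℝ} {t : ℂ} (h : t ∈ sector θ α R) :
    Complex.exp (ω * Complex.I) * t ∈ sector (θ + ω) α R := by
  refine ⟨exp_mul_I_mul_mem_unboundedSector h.1, ?_⟩
  have := h.2
  rw [mem_ball_zero_iff] at this ⊢
  rwa [norm_mul, Complex.norm_exp_ofReal_mul_I, one_mul]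

/-- A strictly narrower and shorter sector is a proper subsector. -/
lemma closure_sector_subset {θ α α' R R' : ℝ} (hα : α' < α) (hR : R' < R) :
    closure (sector θ α' R') ⊆ sector θ α R ∪ {0} := by
  set T : Set ℂ := (fun p : ℝ × ℝ => (p.1 : ℂ) * Complex.exp ((p.2 : ℂ) * Complex.I)) ''
    (Set.Icc 0 R' ×ˢ Set.Icc (θ - α' / 2) (θ + α' / 2))
  have hTc : IsClosed T := by
    refine (IsCompact.image (isCompact_Icc.prod isCompact_Icc) ?_).isClosed
    fun_prop
  have h1 : sector θ α' R' ⊆ T := by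
    rintro _ ⟨⟨r, φ, hr, hφ, rfl⟩, hb⟩
    rw [mem_ball_zero_iff, norm_mul, Complex.norm_exp_ofReal_mul_I, mul_one, Complex.norm_real,
      Real.norm_of_nonneg hr.le] at hb
    rw [abs_lt] at hφ
    exact ⟨(r, φ), ⟨⟨hr.le, hb.le⟩, ⟨by dsimp only; linarith, by dsimp only; linarith⟩⟩, rfl⟩
  refine (closure_minimal h1 hTc).trans ?_
  rintro _ ⟨⟨r, φ⟩, ⟨⟨hr, hrR⟩, ⟨hφ1, hφ2⟩⟩, rfl⟩
  dsimp only at *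
  rcases hr.eq_or_lt with rfl | hr
  · right; simp
  · left
    refine ⟨⟨r, φ, hr, ?_, rfl⟩, ?_⟩
    · rw [abs_lt]; constructor <;> linarith
    · rw [mem_ball_zero_iff, norm_mul, Complex.norm_exp_ofReal_mul_I, mul_one, Complex.norm_real,
        Real.norm_of_nonneg hr.le]
      linarith

/-- Every point `t` of a strictly narrower and shorter sector carries a disc of radius
proportional to `‖t‖` inside the larger sector. -/
lemma exists_closedBall_subset_sector {θ α α' R R' : ℝ} (hα : α' < α) (hR : R' < R) (hR' : 0 < R') :
    ∃ δ : ℝ, 0 < δ ∧ δ ≤ 1 ∧ ∀ t ∈ sector θ α' R',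
      Metric.closedBall t (δ * ‖t‖) ⊆ sector θ α R := by
  have hc : ContinuousAt Complex.arg 1 := Complex.continuousAt_arg (by simp [Complex.slitPlane])
  have h0 : ∀ᶠ z : ℂ in 𝓝 1, |Complex.arg z| < (α - α') / 2 := by
    have := hc.tendsto.abs
    rw [Complex.arg_one, abs_zero] at this
    exact this.eventually_lt_const (by linarith)
  obtain ⟨δ₀, hδ₀, h1⟩ := Metric.eventually_nhds_iff.1 h0
  set q := R / R' - 1 with hq
  have hq0 : 0 < q := by
    rw [hq, sub_pos, lt_div_iff₀ hR']; linarith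
  set δ := min (min (δ₀ / 2) (1 / 2)) (q / 2)
  have hδ0 : 0 < δ := by positivity
  have hδ1 : δ < δ₀ := by
    have : δ ≤ δ₀ / 2 := (min_le_left _ _).trans (min_le_left _ _)
    linarith
  have hδ2 : δ ≤ 1 / 2 := (min_le_left _ _).trans (min_le_right _ _)
  have hδ3 : δ < q := by
    have : δ ≤ q / 2 := min_le_right _ _
    linarith
  refine ⟨δ, hδ0, by linarith, fun t ht z hz => ?_⟩
  have ht0 := ne_zero_of_mem_unboundedSector ht.1
  have htn : 0 < ‖t‖ := norm_pos_iff.2 ht0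
  rw [mem_closedBall_iff_norm] at hz
  have hb := ht.2
  rw [mem_ball_zero_iff] at hb
  have hzt : ‖z / t - 1‖ ≤ δ := by
    rw [div_sub_one ht0, norm_div, div_le_iff₀ htn]; exact hz
  have harg := h1 (y := z / t) (by rw [dist_eq_norm]; linarith)
  have hz0 : z / t ≠ 0 := by
    intro h
    rw [h] at hzt
    norm_num at hzt
    linarith
  obtain ⟨r, φ, hr, hφ, h⟩ := ht.1
  refine ⟨⟨‖z / t‖ * r, φ + Complex.arg (z / t), by positivity, ?_, ?_⟩, ?_⟩
  · rw [show φ + Complex.arg (z / t) - θ = (φ - θ) + Complex.arg (z / t) by ring]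
    refine (abs_add_le _ _).trans_lt ?_
    linarith
  · calc z = (z / t) * t := by field_simp
      _ = (‖z / t‖ * Complex.exp (Complex.arg (z / t) * Complex.I)) * t := by
        rw [Complex.norm_mul_exp_arg_mul_I]
      _ = (‖z / t‖ * Complex.exp (Complex.arg (z / t) * Complex.I)) *
          (r * Complex.exp (φ * Complex.I)) := by rw [← h]
      _ = _ := by
        push_cast
        rw [add_mul, Complex.exp_add]
        ring
  · rw [mem_ball_zero_iff]
    have : ‖z‖ ≤ ‖z - t‖ + ‖t‖ := by simpa using norm_add_le (z - t) t
    have h3 : (δ + 1) * ‖t‖ ≤ (q + 1) * R' := by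
      gcongr
    have h4 : (q + 1) * R' = R := by rw [hq]; field_simp; ring
    have h5 : (δ + 1) * ‖t‖ < (q + 1) * R' := by
      have : (δ + 1) * ‖t‖ ≤ (δ + 1) * R' := by gcongr
      have : (δ + 1) * R' < (q + 1) * R' := by gcongr
      linarith
    linarith

end HeatSum
end

noncomputable section
namespace HeatSum

/-! ### Gevrey asymptotic expansions -/

/-- The sequence `c` is the coefficient sequence of a Gevrey asymptotic expansion of order `1 / k`,
on a sector of opening larger than `π / k` bisected by the positive real axis. The remainder bound
is uniform on the whole sector, and `⌊N / k⌋!` plays the role of `Γ(1 + N / k)`. -/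
def HasGevreySum (k : ℕ) (c : ℕ → ℂ) : Prop :=
  ∃ (α R C K : ℝ) (v : ℂ → ℂ), Real.pi / k < α ∧ 0 < R ∧ 0 < C ∧ 0 < K ∧
    DifferentiableOn ℂ v (sector 0 α R) ∧
    ∀ N : ℕ, ∀ t ∈ sector 0 α R,
      ‖v t - ∑ n ∈ Finset.range N, c n * t ^ n‖ ≤ C * K ^ N * (N / k).factorial * ‖t‖ ^ N

lemma factorial_mul_factorial_le_Gamma (k l : ℕ) :
    (l.factorial : ℝ) * (l / k).factorial ≤ Real.Gamma (1 + (1 + 1 / (k : ℝ)) * l) := by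
  rcases Nat.eq_zero_or_pos l with rfl | hl
  · simp
  have h1 : (l.factorial : ℝ) * (l / k).factorial ≤ ((l + l / k).factorial : ℕ) := by
    exact_mod_cast Nat.le_of_dvd (Nat.factorial_pos _)
      (Nat.factorial_mul_factorial_dvd_factorial_add l (l / k))
  refine h1.trans ?_
  rw [← Real.Gamma_nat_eq_factorial]
  have h2 : ((l / k : ℕ) : ℝ) ≤ (l : ℝ) / k := Nat.cast_div_le
  have h3 : (1 : ℝ) ≤ l := by exact_mod_cast hl
  refine Real.Gamma_strictMonoOn_Ici.monotoneOn ?_ ?_ ?_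
  · simp only [Set.mem_Ici]; push_cast; linarith
  · simp only [Set.mem_Ici]
    have : (1 + 1 / (k : ℝ)) * l = l + l / k := by ring
    rw [this]; linarith
  · have : (1 + 1 / (k : ℝ)) * l = l + l / k := by ring
    rw [this]; push_cast; linarith

lemma Gamma_le_factorial_mul_factorial {k : ℕ} (hk : 1 ≤ k) (l : ℕ) :
    Real.Gamma (1 + (1 + 1 / (k : ℝ)) * l) ≤ 2 * 8 ^ l * (l.factorial * (l / k).factorial) := by
  rcases Nat.eq_zero_or_pos l with rfl | hl
  · simp
  set q := l / k
  have hk' : (0 : ℝ) < k := by exact_mod_cast hk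
  have hql : q ≤ l := Nat.div_le_self _ _
  have h2 : (l : ℝ) / k ≤ q + 1 := by
    rw [div_le_iff₀ hk']
    have : l < (q + 1) * k := by
      rw [mul_comm]; exact Nat.lt_mul_div_succ l hk
    exact_mod_cast this.le
  have h3 : (1 : ℝ) ≤ l := by exact_mod_cast hl
  have h5 : (0 : ℝ) ≤ (l : ℝ) / k := by positivity
  have h6 : Real.Gamma (1 + (1 + 1 / (k : ℝ)) * l) ≤ ((l + (q + 1)).factorial : ℕ) := by
    rw [← Real.Gamma_nat_eq_factorial]
    have : (1 + 1 / (k : ℝ)) * l = l + l / k := by ring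
    rw [this]
    refine Real.Gamma_strictMonoOn_Ici.monotoneOn ?_ ?_ ?_
    · simp only [Set.mem_Ici]; linarith
    · simp only [Set.mem_Ici]; push_cast; linarith
    · push_cast; linarith
  refine h6.trans ?_
  have h7 : (l + (q + 1)).factorial ≤ 2 * 8 ^ l * (l.factorial * q.factorial) := by
    rw [← Nat.add_choose_mul_factorial_mul_factorial l (q + 1)]
    have a1 : (l + (q + 1)).choose (q + 1) ≤ 2 ^ (l + (q + 1)) := Nat.choose_le_two_pow _ _
    have a2 : q + 1 ≤ 2 ^ q := Nat.lt_two_pow_self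
    calc (l + (q + 1)).choose (q + 1) * l.factorial * (q + 1).factorial
        ≤ 2 ^ (l + (q + 1)) * l.factorial * (2 ^ q * q.factorial) := by
          rw [Nat.factorial_succ]; gcongr
      _ = 2 * (2 ^ l * 2 ^ q * 2 ^ q) * (l.factorial * q.factorial) := by ring
      _ ≤ 2 * (2 ^ l * 2 ^ l * 2 ^ l) * (l.factorial * q.factorial) := by
          gcongr <;> norm_num
      _ = _ := by rw [← mul_pow, ← mul_pow]; norm_num
  exact_mod_cast h7

/-- Taylor's formula at the vertex of a sector, for a function all of whose derivatives `v j` are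
bounded and have limits `d j` at the vertex. -/
lemma norm_sub_sum_le_of_hasDerivAt {θ α R : ℝ} {v : ℕ → ℂ → ℂ} {d : ℕ → ℂ} {M : ℕ → ℝ}
    (hv : ∀ j, ∀ t ∈ sector θ α R, HasDerivAt (v j) (v (j + 1) t) t)
    (hlim : ∀ j, Tendsto (v j) (𝓝[sector θ α R] 0) (𝓝 (d j)))
    (hM : ∀ j, ∀ t ∈ sector θ α R, ‖v j t‖ ≤ M j) (N : ℕ) :
    ∀ j, ∀ t ∈ sector θ α R,
      ‖v j t - ∑ n ∈ Finset.range N, d (n + j) / n.factorial * t ^ n‖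
        ≤ M (N + j) * ‖t‖ ^ N / N.factorial := by
  induction N with
  | zero => intro j t ht; simpa using hM j t ht
  | succ N ih =>
    intro j t ht
    set h : ℂ → ℂ := fun t => v j t - ∑ n ∈ Finset.range (N + 1), d (n + j) / n.factorial * t ^ n
     
    have hder : ∀ z ∈ sector θ α R, HasDerivAt h
        (v (j + 1) z - ∑ n ∈ Finset.range N, d (n + (j + 1)) / n.factorial * z ^ n) z := by
      intro z hz
      refine (hv j z hz).sub ?_
      have h1 : HasDerivAt (fun z : ℂ => ∑ n ∈ Finset.range (N + 1), d (n + j) / n.factorial * z ^ n)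
          (∑ n ∈ Finset.range (N + 1), d (n + j) / n.factorial * (n * z ^ (n - 1))) z :=
        HasDerivAt.fun_sum fun n _ => (hasDerivAt_pow n z).const_mul _
      refine h1.congr_deriv ?_
      rw [Finset.sum_range_succ']
      simp only [Nat.cast_zero, zero_mul, mul_zero, add_zero]
      refine Finset.sum_congr rfl fun n _ => ?_
      rw [Nat.factorial_succ, show n + (j + 1) = n + 1 + j by ring]
      have : ((n : ℂ) + 1) ≠ 0 := by exact_mod_cast Nat.succ_ne_zero n
      have : (n.factorial : ℂ) ≠ 0 := by exact_mod_cast n.factorial_ne_zero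
      push_cast
      field_simp
    have hlim0 : Tendsto h (𝓝[sector θ α R] 0) (𝓝 0) := by
      have h1 : Tendsto (fun z : ℂ => ∑ n ∈ Finset.range (N + 1), d (n + j) / n.factorial * z ^ n)
          (𝓝[sector θ α R] 0) (𝓝 (d j)) := by
        have : Continuous
            (fun z : ℂ => ∑ n ∈ Finset.range (N + 1), d (n + j) / n.factorial * z ^ n) := by
          fun_prop
        have h2 := (this.tendsto 0).mono_left (nhdsWithin_le_nhds (s := sector θ α R))
        convert h2 using 2
        rw [Finset.sum_range_succ']
        simp
      simpa using (hlim j).sub h1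
    have hray : Tendsto (fun ε : ℝ => h ((ε : ℂ) * t)) (𝓝[>] 0) (𝓝 0) := by
      refine hlim0.comp (tendsto_nhdsWithin_iff.2 ⟨?_, ?_⟩)
      · have : Continuous fun ε : ℝ => (ε : ℂ) * t := by fun_prop
        simpa using (this.tendsto 0).mono_left (nhdsWithin_le_nhds (s := Set.Ioi 0))
      · filter_upwards [Ioo_mem_nhdsGT (zero_lt_one' ℝ)] with ε hε
        exact ofReal_mul_mem_sector hε.1 hε.2.le ht
    have hmain : ∀ᶠ ε : ℝ in 𝓝[>] 0, ‖h t - h ((ε : ℂ) * t)‖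
        ≤ M (N + 1 + j) * ‖t‖ ^ (N + 1) / (N + 1).factorial := by
      filter_upwards [Ioo_mem_nhdsGT (zero_lt_one' ℝ)] with ε hε
      have hd : ∀ s ∈ Set.Icc ε 1, HasDerivAt (fun s : ℝ => h ((s : ℂ) * t) - h ((ε : ℂ) * t))
          ((v (j + 1) ((s : ℂ) * t) - ∑ n ∈ Finset.range N,
            d (n + (j + 1)) / n.factorial * ((s : ℂ) * t) ^ n) * t) s := by
        intro s hs
        have h1 := hder _ (ofReal_mul_mem_sector (hε.1.trans_le hs.1) hs.2 ht)
        have h2 : HasDerivAt (fun s : ℝ => (s : ℂ) * t) t s := by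
          simpa using (Complex.ofRealCLM.hasDerivAt (x := s)).mul_const t
        exact (h1.comp s h2).sub_const _
      have := image_norm_le_of_norm_deriv_right_le_deriv_boundary
        (f := fun s : ℝ => h ((s : ℂ) * t) - h ((ε : ℂ) * t)) (a := ε) (b := 1)
        (fun s hs => (hd s hs).continuousAt.continuousWithinAt)
        (fun s hs => (hd s ⟨hs.1, hs.2.le⟩).hasDerivWithinAt)
        (B := fun s => M (N + 1 + j) * ‖t‖ ^ (N + 1) / (N + 1).factorial * s ^ (N + 1))
        (B' := fun s => M (N + 1 + j) * ‖t‖ ^ (N + 1) / (N + 1).factorial * ((N + 1 : ℕ) * s ^ N))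
        ?_ (fun s => by simpa using (hasDerivAt_pow (N + 1) s).const_mul _) ?_
        (x := 1) ⟨hε.2.le, le_rfl⟩
      · simpa using this
      · rw [sub_self, norm_zero]
        have : 0 ≤ M (N + 1 + j) := (norm_nonneg _).trans (hM _ t ht)
        have := hε.1
        positivity
      · intro s hs
        have hs0 : 0 < s := hε.1.trans_le hs.1
        have := ih (j + 1) _ (ofReal_mul_mem_sector hs0 hs.2.le ht)
        rw [norm_mul]
        refine (mul_le_mul_of_nonneg_right this (norm_nonneg t)).trans (le_of_eq ?_)
        rw [norm_mul, Complex.norm_real, Real.norm_of_nonneg hs0.le, Nat.factorial_succ,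
          show N + (j + 1) = N + 1 + j by ring]
        have : (N.factorial : ℝ) ≠ 0 := by exact_mod_cast N.factorial_ne_zero
        push_cast
        field_simp
        ring
    have h3 : Tendsto (fun ε : ℝ => ‖h t - h ((ε : ℂ) * t)‖) (𝓝[>] 0) (𝓝 ‖h t‖) := by
      simpa using (tendsto_const_nhds.sub hray).norm
    exact le_of_tendsto h3 hmain

lemma iteratedDeriv_sum_pow (c : ℕ → ℂ) (l N : ℕ) (t : ℂ) :
    iteratedDeriv l (fun t : ℂ => ∑ n ∈ Finset.range N, c n * t ^ n) t =
      ∑ n ∈ Finset.range N, c n * (n.descFactorial l * t ^ (n - l)) := by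
  rw [iteratedDeriv_fun_sum (fun n _ => by fun_prop)]
  refine Finset.sum_congr rfl fun n _ => ?_
  rw [iteratedDeriv_const_mul_field, iteratedDeriv_pow]

/-- Cauchy's estimates for the remainder of an asymptotic expansion. -/
lemma norm_iteratedDeriv_sub_le {θ α α' R R' δ : ℝ} {v : ℂ → ℂ} {c : ℕ → ℂ} {A : ℕ → ℝ}
    (hv : DifferentiableOn ℂ v (sector θ α R))
    (hA : ∀ N : ℕ, ∀ t ∈ sector θ α R,
      ‖v t - ∑ n ∈ Finset.range N, c n * t ^ n‖ ≤ A N * ‖t‖ ^ N)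
    (hδ : 0 < δ) (hδ1 : δ ≤ 1)
    (hball : ∀ t ∈ sector θ α' R', Metric.closedBall t (δ * ‖t‖) ⊆ sector θ α R)
    (l N : ℕ) {t : ℂ} (ht : t ∈ sector θ α' R') :
    ‖iteratedDeriv l v t - ∑ n ∈ Finset.range N, c n * (n.descFactorial l * t ^ (n - l))‖
      ≤ l.factorial * (A N * (2 * ‖t‖) ^ N) / (δ * ‖t‖) ^ l := by
  have ht0 : 0 < ‖t‖ := norm_pos_iff.2 (ne_zero_of_mem_unboundedSector ht.1)
  have hsub := hball t ht
  have htm : t ∈ sector θ α R := hsub (Metric.mem_closedBall_self (by positivity))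
  have hva : AnalyticAt ℂ v t := hv.analyticAt ((isOpen_sector θ α R).mem_nhds htm)
  rw [← iteratedDeriv_sum_pow, ← iteratedDeriv_fun_sub hva.contDiffAt
    (ContDiff.contDiffAt (by fun_prop))]
  refine Complex.norm_iteratedDeriv_le_of_forall_mem_sphere_norm_le l (by positivity) ?_ ?_
  · refine DifferentiableOn.diffContOnCl ?_
    rw [closure_ball _ (by positivity)]
    exact (hv.mono hsub).sub (by fun_prop)
  · intro z hz
    have hz' := hsub (Metric.sphere_subset_closedBall hz)
    refine (hA N z hz').trans ?_
    have h1 : ‖z‖ ≤ 2 * ‖t‖ := by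
      rw [mem_sphere_iff_norm] at hz
      have : ‖z‖ ≤ ‖z - t‖ + ‖t‖ := by simpa using norm_add_le (z - t) t
      nlinarith
    have h2 : 0 ≤ A N := by
      have := (norm_nonneg _).trans (hA N t htm)
      exact nonneg_of_mul_nonneg_left this (by positivity)
    gcongr

lemma hasDerivAt_iteratedDeriv_of_differentiableOn {S : Set ℂ} (hS : IsOpen S) {v : ℂ → ℂ}
    (hv : DifferentiableOn ℂ v S) (j : ℕ) {t : ℂ} (ht : t ∈ S) :
    HasDerivAt (iteratedDeriv j v) (iteratedDeriv (j + 1) v t) t := by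
  rw [iteratedDeriv_succ]
  refine DifferentiableAt.hasDerivAt ?_
  have : AnalyticAt ℂ v t := hv.analyticAt (hS.mem_nhds ht)
  exact (this.iterated_deriv j).differentiableAt.congr_of_eventuallyEq
    (by simp only [iteratedDeriv_eq_iterate]; rfl)

/-- Summability, as defined by bounds on all derivatives on proper subsectors, amounts to a uniform
Gevrey asymptotic expansion. -/
theorem isSummable_iff {k : ℕ} (hk : 1 ≤ k) (θ : ℝ) (c : PowerSeries ℂ) :
    IsSummable k θ c ↔
      HasGevreySum k fun n => PowerSeries.coeff n c * Complex.exp (θ * Complex.I) ^ n := by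
  set e := Complex.exp (θ * Complex.I) with he
  have he1 : ‖e‖ = 1 := Complex.norm_exp_ofReal_mul_I θ
  have he0 : e ≠ 0 := Complex.exp_ne_zero _
  constructor
  · rintro ⟨α, R, u, hα, hR, hu, h⟩
    obtain ⟨α', hα', hαα'⟩ := exists_between hα
    obtain ⟨hl, C, K, hC, hK, hb⟩ := h θ α' (R / 2) (closure_sector_subset hαα' (by linarith))
    have hsub : sector θ α' (R / 2) ⊆ sector θ α R := sector_mono hαα'.le (by linarith)
    have ht := norm_sub_sum_le_of_hasDerivAt (v := fun j => iteratedDeriv j u)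
      (d := fun l => (l.factorial : ℂ) * PowerSeries.coeff l c)
      (fun j t ht => hasDerivAt_iteratedDeriv_of_differentiableOn (isOpen_sector θ α R) hu j
        (hsub ht)) hl hb
    have hmem : ∀ t ∈ sector 0 α' (R / 2), e * t ∈ sector θ α' (R / 2) := fun t ht => by
      simpa using exp_mul_I_mul_mem_sector (ω := θ) ht
    refine ⟨α', R / 2, 2 * C, 8 * K, fun t => u (e * t), hα', by linarith, by linarith,
      by linarith, ?_, ?_⟩
    · exact (hu.mono hsub).comp (by fun_prop) hmem
    · intro N t htm
      have h1 := ht N 0 (e * t) (hmem t htm)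
      rw [norm_mul, he1, one_mul] at h1
      have h2 : ∑ n ∈ Finset.range N, (((n + 0).factorial : ℂ) * PowerSeries.coeff (n + 0) c) /
          n.factorial * (e * t) ^ n =
          ∑ n ∈ Finset.range N, PowerSeries.coeff n c * e ^ n * t ^ n := by
        refine Finset.sum_congr rfl fun n _ => ?_
        have : (n.factorial : ℂ) ≠ 0 := by exact_mod_cast n.factorial_ne_zero
        simp only [add_zero]
        rw [mul_pow]
        field_simp
      rw [h2] at h1
      refine h1.trans ?_
      simp only [add_zero]
      have h3 := Gamma_le_factorial_mul_factorial hk N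
      have h4 : (0 : ℝ) < N.factorial := by exact_mod_cast N.factorial_pos
      rw [div_le_iff₀ h4]
      calc C * K ^ N * Real.Gamma (1 + (1 + 1 / (k : ℝ)) * N) * ‖t‖ ^ N
          ≤ C * K ^ N * (2 * 8 ^ N * (N.factorial * (N / k).factorial)) * ‖t‖ ^ N := by gcongr
        _ = _ := by rw [mul_pow]; ring
  · rintro ⟨α, R, C, K, v, hα, hR, hC, hK, hv, hb⟩
    obtain ⟨α', hα', hαα'⟩ := exists_between hα
    set u : ℂ → ℂ := fun t => v (e⁻¹ * t) with hu
    have hinv : e⁻¹ = Complex.exp ((-θ : ℝ) * Complex.I) := by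
      rw [he, ← Complex.exp_neg]; push_cast; ring_nf
    have hmem : ∀ t ∈ sector θ α R, e⁻¹ * t ∈ sector 0 α R := fun t ht => by
      rw [hinv]
      simpa using exp_mul_I_mul_mem_sector (ω := -θ) ht
    have hud : DifferentiableOn ℂ u (sector θ α R) := hv.comp (by fun_prop) hmem
    have hA : ∀ N : ℕ, ∀ t ∈ sector θ α R,
        ‖u t - ∑ n ∈ Finset.range N, PowerSeries.coeff n c * t ^ n‖
          ≤ (C * K ^ N * (N / k).factorial) * ‖t‖ ^ N := by
      intro N t ht
      have := hb N _ (hmem t ht)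
      rw [norm_mul, norm_inv, he1, inv_one, one_mul] at this
      refine le_trans (le_of_eq ?_) this
      congr 2
      refine Finset.sum_congr rfl fun n _ => ?_
      rw [mul_assoc, ← mul_pow, mul_inv_cancel_left₀ he0]
    obtain ⟨δ, hδ, hδ1, hball⟩ :=
      exists_closedBall_subset_sector (θ := θ) hαα' (half_lt_self hR) (half_pos hR)
    have hest := norm_iteratedDeriv_sub_le hud hA hδ hδ1 hball
    refine ⟨α', R / 2, u, hα', by linarith, hud.mono (sector_mono hαα'.le (by linarith)), ?_⟩
    intro θ'' α'' R'' hsub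
    have hsub' : sector θ'' α'' R'' ⊆ sector θ α' (R / 2) := by
      intro t ht
      rcases hsub (subset_closure ht) with h | h
      · exact h
      · exact absurd h (ne_zero_of_mem_unboundedSector ht.1)
    refine ⟨fun l => ?_, C, K * (2 / δ), hC, by positivity, fun l t ht => ?_⟩
    · set D : ℝ := l.factorial * (C * K ^ (l + 1) * ((l + 1) / k).factorial * 2 ^ (l + 1)) / δ ^ l
      have h1 : ∀ t ∈ sector θ'' α'' R'',
          ‖iteratedDeriv l u t - (l.factorial : ℂ) * PowerSeries.coeff l c‖ ≤ D * ‖t‖ := by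
        intro t ht
        have ht0 : 0 < ‖t‖ := norm_pos_iff.2 (ne_zero_of_mem_unboundedSector ht.1)
        have := hest l (l + 1) (hsub' ht)
        rw [Finset.sum_range_succ, Finset.sum_eq_zero (s := Finset.range l), zero_add,
          Nat.descFactorial_self, Nat.sub_self, pow_zero, mul_one,
          mul_comm (PowerSeries.coeff l c)] at this
        · refine this.trans (le_of_eq ?_)
          simp only [D]
          rw [mul_pow, mul_pow]
          field_simp
          ring
        · intro n hn
          rw [Nat.descFactorial_of_lt (Finset.mem_range.1 hn)]
          simp
      rw [tendsto_iff_norm_sub_tendsto_zero]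
      refine squeeze_zero' (g := fun t : ℂ => D * ‖t‖) (Eventually.of_forall fun _ => norm_nonneg _)
        (eventually_nhdsWithin_of_forall h1) ?_
      have : Continuous fun t : ℂ => D * ‖t‖ := by fun_prop
      simpa using (this.tendsto 0).mono_left (nhdsWithin_le_nhds (s := sector θ'' α'' R''))
    · have ht0 : 0 < ‖t‖ := norm_pos_iff.2 (ne_zero_of_mem_unboundedSector ht.1)
      have := hest l l (hsub' ht)
      rw [Finset.sum_eq_zero, sub_zero] at this
      · refine this.trans ?_
        have h3 := factorial_mul_factorial_le_Gamma k l
        calc (l.factorial : ℝ) * (C * K ^ l * (l / k).factorial * (2 * ‖t‖) ^ l) / (δ * ‖t‖) ^ l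
            = C * (K * (2 / δ)) ^ l * (l.factorial * (l / k).factorial) := by
              rw [mul_pow, mul_pow, mul_pow, div_pow]
              field_simp
          _ ≤ _ := by gcongr
      · intro n hn
        rw [Nat.descFactorial_of_lt (Finset.mem_range.1 hn)]
        simp

end HeatSum
end

noncomputable section
namespace HeatSum

/-! ### Analytic continuation with exponential growth -/

/-- The series `∑ g n z ^ n` converges near `0` and its sum continues analytically to an unbounded
sector bisected by the positive real axis, with exponential growth of order `k` at infinity. -/
def HasContinuation (k : ℕ) (g : ℕ → ℂ) : Prop :=
  ∃ (r ε C K M : ℝ) (F : ℂ → ℂ), 0 < r ∧ 0 < ε ∧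
    DifferentiableOn ℂ F (Metric.ball 0 r ∪ unboundedSector 0 ε) ∧
    (∀ z ∈ Metric.ball (0 : ℂ) r, HasSum (fun n => g n * z ^ n) (F z)) ∧
    ∀ z ∈ unboundedSector 0 ε, M ≤ ‖z‖ → ‖F z‖ ≤ C * Real.exp (K * ‖z‖ ^ k)

theorem continuesWithGrowth_iff (k : ℕ) (d : ℝ) (f : PowerSeries ℂ) :
    ContinuesWithGrowth k d f ↔
      HasContinuation k fun n => PowerSeries.coeff n f * Complex.exp (d * Complex.I) ^ n := by
  set e := Complex.exp (d * Complex.I) with he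
  have he1 : ‖e‖ = 1 := Complex.norm_exp_ofReal_mul_I d
  have he0 : e ≠ 0 := Complex.exp_ne_zero _
  have hinv : e⁻¹ = Complex.exp ((-d : ℝ) * Complex.I) := by
    rw [he, ← Complex.exp_neg]; push_cast; ring_nf
  constructor
  · rintro ⟨r, ε, F, hr, hε, hF, hs, C, K, M, hb⟩
    have hm : ∀ z ∈ unboundedSector 0 ε, e * z ∈ unboundedSector d ε := fun z hz => by
      simpa using exp_mul_I_mul_mem_unboundedSector (ω := d) hz
    have hm' : ∀ z ∈ Metric.ball (0 : ℂ) r, e * z ∈ Metric.ball (0 : ℂ) r := fun z hz => by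
      simpa [he1] using hz
    refine ⟨r, ε, C, K, M, fun z => F (e * z), hr, hε, ?_, ?_, ?_⟩
    · refine hF.comp (by fun_prop) ?_
      rintro z (hz | hz)
      exacts [Or.inl (hm' z hz), Or.inr (hm z hz)]
    · intro z hz
      have := hs _ (hm' z hz)
      simpa only [mul_pow, mul_assoc] using this
    · intro z hz hM
      have := hb _ (hm z hz)
      rw [norm_mul, he1, one_mul] at this
      exact this hM
  · rintro ⟨r, ε, C, K, M, F, hr, hε, hF, hs, hb⟩
    have hm : ∀ z ∈ unboundedSector d ε, e⁻¹ * z ∈ unboundedSector 0 ε := fun z hz => by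
      rw [hinv]
      simpa using exp_mul_I_mul_mem_unboundedSector (ω := -d) hz
    have hm' : ∀ z ∈ Metric.ball (0 : ℂ) r, e⁻¹ * z ∈ Metric.ball (0 : ℂ) r := fun z hz => by
      simpa [he1] using hz
    refine ⟨r, ε, fun z => F (e⁻¹ * z), hr, hε, ?_, ?_, C, K, M, ?_⟩
    · refine hF.comp (by fun_prop) ?_
      rintro z (hz | hz)
      exacts [Or.inl (hm' z hz), Or.inr (hm z hz)]
    · intro z hz
      have := hs _ (hm' z hz)
      simpa only [mul_assoc, ← mul_pow, mul_inv_cancel_left₀ he0] using this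
    · intro z hz hM
      have := hb _ (hm z hz)
      rw [norm_mul, norm_inv, he1, inv_one, one_mul] at this
      exact this hM

lemma differentiableOn_tsum_pow {g : ℕ → ℂ} {r : ℝ}
    (h : ∀ z ∈ Metric.ball (0 : ℂ) r, Summable fun n => g n * z ^ n) :
    DifferentiableOn ℂ (fun z => ∑' n, g n * z ^ n) (Metric.ball 0 r) := by
  intro z hz
  rw [mem_ball_zero_iff] at hz
  obtain ⟨ρ, hρ, hρr⟩ := exists_between hz
  have hρ0 : 0 ≤ ρ := (norm_nonneg z).trans hρ.le
  have hs : Summable fun n => ‖g n * (ρ : ℂ) ^ n‖ := by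
    refine (h ρ ?_).norm
    rwa [mem_ball_zero_iff, Complex.norm_real, Real.norm_of_nonneg hρ0]
  refine ((Complex.differentiableOn_tsum_of_summable_norm (U := Metric.ball 0 ρ) hs
    (fun n => by fun_prop) Metric.isOpen_ball ?_).differentiableAt
    (Metric.isOpen_ball.mem_nhds (by simpa using hρ))).differentiableWithinAt
  intro n w hw
  rw [mem_ball_zero_iff] at hw
  rw [norm_mul, norm_mul, norm_pow, norm_pow, Complex.norm_real, Real.norm_of_nonneg hρ0]
  gcongr

/-- Gluing the sum of a power series near `0` with a function on an unbounded sector. -/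
lemma hasContinuation_of_sector {k : ℕ} {g : ℕ → ℂ} {r ε C K M : ℝ} {S : ℂ → ℂ} (hr : 0 < r)
    (hε : 0 < ε) (hg : ∀ z ∈ Metric.ball (0 : ℂ) r, Summable fun n => g n * z ^ n)
    (hS : DifferentiableOn ℂ S (unboundedSector 0 ε))
    (hgS : ∀ z ∈ unboundedSector 0 ε, ‖z‖ < r → HasSum (fun n => g n * z ^ n) (S z))
    (hb : ∀ z ∈ unboundedSector 0 ε, M ≤ ‖z‖ → ‖S z‖ ≤ C * Real.exp (K * ‖z‖ ^ k)) :
    HasContinuation k g := by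
  classical
  set F : ℂ → ℂ := fun z => if ‖z‖ < r then ∑' n, g n * z ^ n else S z with hF
  have hFS : ∀ z ∈ unboundedSector 0 ε, F z = S z := by
    intro z hz
    simp only [hF]
    split_ifs with h
    · exact (hgS z hz h).tsum_eq
    · rfl
  have hFb : ∀ z ∈ Metric.ball (0 : ℂ) r, F z = ∑' n, g n * z ^ n := by
    intro z hz
    exact if_pos (mem_ball_zero_iff.1 hz)
  refine ⟨r, ε, C, K, M, F, hr, hε, ?_, ?_, ?_⟩
  · rintro z (hz | hz)
    · have h1 := (differentiableOn_tsum_pow hg).differentiableAt (Metric.isOpen_ball.mem_nhds hz)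
      refine (h1.congr_of_eventuallyEq ?_).differentiableWithinAt
      filter_upwards [Metric.isOpen_ball.mem_nhds hz] with w hw using hFb w hw
    · have h1 := hS.differentiableAt ((isOpen_unboundedSector 0 ε).mem_nhds hz)
      refine (h1.congr_of_eventuallyEq ?_).differentiableWithinAt
      filter_upwards [(isOpen_unboundedSector 0 ε).mem_nhds hz] with w hw using hFS w hw
  · intro z hz
    rw [hFb z hz]
    exact (hg z hz).hasSum
  · intro z hz hM
    rw [hFS z hz]
    exact hb z hz hM

/-! ### Rescaling -/

lemma HasGevreySum.const_mul {k : ℕ} {c : ℕ → ℂ} (h : HasGevreySum k c) (κ : ℂ) :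
    HasGevreySum k fun n => κ * c n := by
  obtain ⟨α, R, C, K, v, hα, hR, hC, hK, hv, hb⟩ := h
  refine ⟨α, R, (‖κ‖ + 1) * C, K, fun t => κ * v t, hα, hR, by positivity, hK,
    hv.const_mul κ, fun N t ht => ?_⟩
  have := hb N t ht
  simp only [mul_assoc]
  rw [← Finset.mul_sum, ← mul_sub, norm_mul]
  simp only [mul_assoc] at this
  gcongr
  linarith

lemma ofReal_mul_mem_sector_of_pos {α R l : ℝ} (hl : 0 < l) {t : ℂ} (ht : t ∈ sector 0 α (R / l)) :
    (l : ℂ) * t ∈ sector 0 α R := by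
  refine ⟨ofReal_mul_mem_unboundedSector hl ht.1, ?_⟩
  have := ht.2
  rw [mem_ball_zero_iff] at this ⊢
  rw [norm_mul, Complex.norm_real, Real.norm_of_nonneg hl.le]
  rwa [lt_div_iff₀' hl] at this

lemma HasGevreySum.rescale {k : ℕ} {c : ℕ → ℂ} (h : HasGevreySum k c) {l : ℝ} (hl : 0 < l) :
    HasGevreySum k fun n => (l : ℂ) ^ n * c n := by
  obtain ⟨α, R, C, K, v, hα, hR, hC, hK, hv, hb⟩ := h
  refine ⟨α, R / l, C, K * l, fun t => v (l * t), hα, by positivity, hC, by positivity,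
    hv.comp (by fun_prop) fun t ht => ofReal_mul_mem_sector_of_pos hl ht, fun N t ht => ?_⟩
  have := hb N _ (ofReal_mul_mem_sector_of_pos hl ht)
  rw [norm_mul, Complex.norm_real, Real.norm_of_nonneg hl.le] at this
  simp only [mul_pow] at this ⊢
  refine le_trans (le_of_eq ?_) (this.trans (le_of_eq (by ring)))
  congr 2
  exact Finset.sum_congr rfl fun n _ => by ring

lemma HasContinuation.const_mul {k : ℕ} {g : ℕ → ℂ} (h : HasContinuation k g) (κ : ℂ) :
    HasContinuation k fun n => κ * g n := by
  obtain ⟨r, ε, C, K, M, F, hr, hε, hF, hs, hb⟩ := h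
  refine ⟨r, ε, ‖κ‖ * C, K, M, fun z => κ * F z, hr, hε, hF.const_mul κ, fun z hz => ?_,
    fun z hz hM => ?_⟩
  · simpa only [mul_assoc] using (hs z hz).mul_left κ
  · rw [norm_mul, mul_assoc]
    exact mul_le_mul_of_nonneg_left (hb z hz hM) (norm_nonneg _)

lemma HasContinuation.rescale {k : ℕ} {g : ℕ → ℂ} (h : HasContinuation k g) {l : ℝ} (hl : 0 < l) :
    HasContinuation k fun n => (l : ℂ) ^ n * g n := by
  obtain ⟨r, ε, C, K, M, F, hr, hε, hF, hs, hb⟩ := h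
  have hnorm : ∀ z : ℂ, ‖(l : ℂ) * z‖ = l * ‖z‖ := fun z => by
    rw [norm_mul, Complex.norm_real, Real.norm_of_nonneg hl.le]
  have hm : ∀ z ∈ Metric.ball (0 : ℂ) (r / l), (l : ℂ) * z ∈ Metric.ball (0 : ℂ) r := fun z hz => by
    rw [mem_ball_zero_iff] at hz ⊢
    rwa [hnorm, ← lt_div_iff₀' hl]
  refine ⟨r / l, ε, C, K * l ^ k, M / l, fun z => F (l * z), by positivity, hε,
    hF.comp (by fun_prop) ?_, fun z hz => ?_, fun z hz hM => ?_⟩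
  · rintro z (hz | hz)
    exacts [Or.inl (hm z hz), Or.inr (ofReal_mul_mem_unboundedSector hl hz)]
  · have := hs _ (hm z hz)
    simp only [mul_pow] at this
    exact this.congr_fun fun n => by ring
  · have := hb _ (ofReal_mul_mem_unboundedSector hl hz)
    rw [hnorm, mul_pow, ← mul_assoc] at this
    exact this (by rwa [div_le_iff₀' hl] at hM)

/-! ### Even and odd parts -/

/-- A square root, holomorphic on the slit plane. -/
def halfPow (t : ℂ) : ℂ := Complex.exp (Complex.log t / 2)

lemma halfPow_sq {t : ℂ} (ht : t ≠ 0) : halfPow t ^ 2 = t := by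
  rw [halfPow, ← Complex.exp_nat_mul]
  push_cast
  rw [mul_div_cancel₀ _ two_ne_zero, Complex.exp_log ht]

lemma halfPow_ne_zero (t : ℂ) : halfPow t ≠ 0 := Complex.exp_ne_zero _

lemma norm_halfPow_sq {t : ℂ} (ht : t ≠ 0) : ‖halfPow t‖ ^ 2 = ‖t‖ := by
  rw [← norm_pow, halfPow_sq ht]

lemma log_exp_of_abs_im_lt {ξ : ℂ} {β : ℝ} (h : |ξ.im - 0| < β / 2) (hβ : β ≤ 2 * Real.pi) :
    Complex.log (Complex.exp ξ) = ξ := by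
  rw [sub_zero, abs_lt] at h
  exact Complex.log_exp (by linarith) (by linarith)

lemma mem_slitPlane_of_mem_unboundedSector {β : ℝ} (hβ : β ≤ 2 * Real.pi) {t : ℂ}
    (ht : t ∈ unboundedSector 0 β) : t ∈ Complex.slitPlane := by
  obtain ⟨ξ, hξ, rfl⟩ := mem_unboundedSector_iff.1 ht
  rw [Complex.mem_slitPlane_iff_arg]
  refine ⟨?_, Complex.exp_ne_zero _⟩
  rw [← Complex.log_im, log_exp_of_abs_im_lt hξ hβ]
  rw [sub_zero, abs_lt] at hξ
  linarith

lemma halfPow_mem_unboundedSector {β : ℝ} (hβ : β ≤ 2 * Real.pi) {t : ℂ}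
    (ht : t ∈ unboundedSector 0 β) : halfPow t ∈ unboundedSector 0 (β / 2) := by
  obtain ⟨ξ, hξ, rfl⟩ := mem_unboundedSector_iff.1 ht
  rw [halfPow, log_exp_of_abs_im_lt hξ hβ]
  refine mem_unboundedSector_iff.2 ⟨ξ / 2, ?_, rfl⟩
  rw [sub_zero] at hξ ⊢
  rw [show (ξ / 2).im = ξ.im / 2 by simp, abs_div, abs_two]
  linarith

lemma differentiableOn_halfPow {β : ℝ} (hβ : β ≤ 2 * Real.pi) :
    DifferentiableOn ℂ halfPow (unboundedSector 0 β) := by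
  intro t ht
  have := (Complex.hasDerivAt_log (mem_slitPlane_of_mem_unboundedSector hβ ht)).differentiableAt
  exact (this.div_const 2).cexp.differentiableWithinAt

lemma sq_mem_unboundedSector {β : ℝ} {z : ℂ} (hz : z ∈ unboundedSector 0 (β / 2)) :
    z ^ 2 ∈ unboundedSector 0 β := by
  obtain ⟨ξ, hξ, rfl⟩ := mem_unboundedSector_iff.1 hz
  refine mem_unboundedSector_iff.2 ⟨2 * ξ, ?_, ?_⟩
  · rw [sub_zero] at hξ ⊢
    rw [show (2 * ξ).im = 2 * ξ.im by simp, abs_mul, abs_two]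
    linarith
  · rw [← Complex.exp_nat_mul]; norm_num

lemma sum_range_two_mul {L : ℕ → ℂ} (z : ℂ) (N : ℕ) :
    ∑ n ∈ Finset.range (2 * N), L n * z ^ n =
      ∑ n ∈ Finset.range N, L (2 * n) * (z ^ 2) ^ n +
        z * ∑ n ∈ Finset.range N, L (2 * n + 1) * (z ^ 2) ^ n := by
  induction N with
  | zero => simp
  | succ N ih =>
    rw [show 2 * (N + 1) = 2 * N + 1 + 1 by ring, Finset.sum_range_succ, Finset.sum_range_succ, ih,
      Finset.sum_range_succ, Finset.sum_range_succ]
    ring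

end HeatSum
end

noncomputable section
namespace HeatSum

/-- The parameters of a Gevrey expansion may be weakened. -/
lemma HasGevreySum.exists_bound {k : ℕ} {c : ℕ → ℂ} (h : HasGevreySum k c) :
    ∃ (α R C K : ℝ) (v : ℂ → ℂ), Real.pi / k < α ∧ 0 < R ∧ 0 < C ∧ 0 < K ∧
      ∀ α' ≤ α, ∀ R' ≤ R, ∀ C' ≥ C, ∀ K' ≥ K,
        DifferentiableOn ℂ v (sector 0 α' R') ∧ ∀ N : ℕ, ∀ t ∈ sector 0 α' R',
      ‖v t - ∑ n ∈ Finset.range N, c n * t ^ n‖ ≤ C' * K' ^ N * (N / k).factorial * ‖t‖ ^ N := by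
  obtain ⟨α, R, C, K, v, hα, hR, hC, hK, hv, hb⟩ := h
  refine ⟨α, R, C, K, v, hα, hR, hC, hK, fun α' hα' R' hR' C' hC' K' hK' =>
    ⟨hv.mono (sector_mono hα' hR'), fun N t ht => (hb N t (sector_mono hα' hR' ht)).trans ?_⟩⟩
  have : 0 ≤ C' := hC.le.trans hC'
  gcongr

/-- Even and odd parts `v₀`, `v₁` are assembled into `v₀ (z ^ 2) + z * v₁ (z ^ 2)`. -/
theorem HasGevreySum.interleave {L : ℕ → ℂ} (h0 : HasGevreySum 1 fun n => L (2 * n))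
    (h1 : HasGevreySum 1 fun n => L (2 * n + 1)) : HasGevreySum 2 L := by
  obtain ⟨α₀, R₀, C₀, K₀, v₀, hα₀, hR₀, hC₀, hK₀, h0⟩ := h0.exists_bound
  obtain ⟨α₁, R₁, C₁, K₁, v₁, hα₁, hR₁, hC₁, hK₁, h1⟩ := h1.exists_bound
  rw [Nat.cast_one, div_one] at hα₀ hα₁
  set α := min α₀ α₁
  set R := min (min R₀ R₁) 1
  set C := max C₀ C₁ with hC
  set K := max (max K₀ K₁) 1
  obtain ⟨hv0, hb0⟩ := h0 α (min_le_left _ _) R ((min_le_left _ _).trans (min_le_left _ _))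
    C (le_max_left _ _) K ((le_max_left _ _).trans (le_max_left _ _))
  obtain ⟨hv1, hb1⟩ := h1 α (min_le_right _ _) R ((min_le_left _ _).trans (min_le_right _ _))
    C (le_max_right _ _) K ((le_max_right _ _).trans (le_max_left _ _))
  have hR1 : R ≤ 1 := min_le_right _ _
  have hK1 : 1 ≤ K := le_max_right _ _
  have hR0 : 0 < R := by positivity
  have hC0 : 0 < C := by positivity
  have hm : ∀ z ∈ sector 0 (α / 2) R, z ^ 2 ∈ sector 0 α R := by
    intro z hz
    refine ⟨sq_mem_unboundedSector hz.1, ?_⟩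
    have := hz.2
    rw [mem_ball_zero_iff] at this ⊢
    rw [norm_pow]
    nlinarith [norm_nonneg z]
  refine ⟨α / 2, R, 2 * C, 2 * K, fun z => v₀ (z ^ 2) + z * v₁ (z ^ 2), ?_, hR0, by positivity,
    by positivity, ?_, fun N z hz => ?_⟩
  · have : Real.pi < α := lt_min hα₀ hα₁
    push_cast
    linarith
  · exact (hv0.comp (by fun_prop) hm).add
      (differentiableOn_id.mul (hv1.comp (by fun_prop) hm))
  · have hz1 : ‖z‖ ≤ 1 := by
      have := hz.2
      rw [mem_ball_zero_iff] at this
      linarith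
    have e0 := fun m => hb0 m _ (hm z hz)
    have e1 := fun m => hb1 m _ (hm z hz)
    simp only [Nat.div_one, norm_pow, ← pow_mul] at e0 e1
    obtain ⟨m, rfl | rfl⟩ := N.even_or_odd'
    · rw [sum_range_two_mul, Nat.mul_div_cancel_left _ two_pos]
      calc ‖_‖ = ‖(v₀ (z ^ 2) - ∑ n ∈ Finset.range m, L (2 * n) * (z ^ 2) ^ n) +
            z * (v₁ (z ^ 2) - ∑ n ∈ Finset.range m, L (2 * n + 1) * (z ^ 2) ^ n)‖ := by
              congr 1; ring
        _ ≤ C * K ^ m * m.factorial * ‖z‖ ^ (2 * m) +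
            1 * (C * K ^ m * m.factorial * ‖z‖ ^ (2 * m)) := by
          refine (norm_add_le _ _).trans ?_
          rw [norm_mul]
          simp only [← pow_mul]
          gcongr
          · exact e0 m
          · exact e1 m
        _ = 2 * C * K ^ m * m.factorial * ‖z‖ ^ (2 * m) := by ring
        _ ≤ 2 * C * (2 * K) ^ (2 * m) * m.factorial * ‖z‖ ^ (2 * m) := by
          have : K ^ m ≤ (2 * K) ^ (2 * m) := by
            calc K ^ m ≤ (2 * K) ^ m := by gcongr; linarith
              _ ≤ (2 * K) ^ (2 * m) := pow_le_pow_right₀ (by linarith) (by omega)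
          gcongr
    · rw [Finset.sum_range_succ, sum_range_two_mul,
        show (2 * m + 1) / 2 = m by omega]
      calc ‖_‖ = ‖(v₀ (z ^ 2) - ∑ n ∈ Finset.range (m + 1), L (2 * n) * (z ^ 2) ^ n) +
            z * (v₁ (z ^ 2) - ∑ n ∈ Finset.range m, L (2 * n + 1) * (z ^ 2) ^ n)‖ := by
              rw [Finset.sum_range_succ]; congr 1; ring
        _ ≤ C * K ^ (m + 1) * (m + 1).factorial * ‖z‖ ^ (2 * (m + 1)) +
            ‖z‖ * (C * K ^ m * m.factorial * ‖z‖ ^ (2 * m)) := by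
          refine (norm_add_le _ _).trans ?_
          rw [norm_mul]
          simp only [← pow_mul]
          gcongr
          · exact e0 (m + 1)
          · exact e1 m
        _ ≤ C * (2 * K) ^ (2 * m + 1) * m.factorial * ‖z‖ ^ (2 * m + 1) +
            C * (2 * K) ^ (2 * m + 1) * m.factorial * ‖z‖ ^ (2 * m + 1) := by
          have hm2 : ((m : ℝ) + 1) ≤ 2 ^ m := by exact_mod_cast Nat.lt_two_pow_self (n := m)
          have a1 : K ^ (m + 1) * (m + 1).factorial ≤ (2 * K) ^ (2 * m + 1) * m.factorial := by
            rw [Nat.factorial_succ]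
            push_cast
            rw [← mul_assoc]
            refine mul_le_mul_of_nonneg_right ?_ (by positivity)
            calc K ^ (m + 1) * ((m : ℝ) + 1) ≤ K ^ (2 * m + 1) * 2 ^ (2 * m + 1) := by
                  refine mul_le_mul (pow_le_pow_right₀ hK1 (by omega)) (hm2.trans ?_)
                    (by positivity) (by positivity)
                  exact pow_le_pow_right₀ (by norm_num) (by omega)
              _ = _ := by rw [mul_pow]; ring
          have a2 : K ^ m ≤ (2 * K) ^ (2 * m + 1) := by
            calc K ^ m ≤ (2 * K) ^ m := by gcongr; linarith
              _ ≤ _ := pow_le_pow_right₀ (by linarith) (by omega)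
          have a3 : ‖z‖ ^ (2 * (m + 1)) ≤ ‖z‖ ^ (2 * m + 1) :=
            pow_le_pow_of_le_one (norm_nonneg _) hz1 (by omega)
          have a4 : ‖z‖ * (C * K ^ m * m.factorial * ‖z‖ ^ (2 * m)) =
            C * K ^ m * m.factorial * ‖z‖ ^ (2 * m + 1) := by ring
          have b1 : C * K ^ (m + 1) * (m + 1).factorial * ‖z‖ ^ (2 * (m + 1)) ≤
              C * (2 * K) ^ (2 * m + 1) * m.factorial * ‖z‖ ^ (2 * m + 1) := by
            calc _ = C * (K ^ (m + 1) * (m + 1).factorial) * ‖z‖ ^ (2 * (m + 1)) := by ring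
              _ ≤ C * ((2 * K) ^ (2 * m + 1) * m.factorial) * ‖z‖ ^ (2 * m + 1) := by gcongr
              _ = _ := by ring
          rw [a4]
          gcongr
        _ = _ := by ring

lemma sum_range_even_part {L : ℕ → ℂ} (z : ℂ) (N : ℕ) :
    ∑ n ∈ Finset.range (2 * N), L n * z ^ n +
      ∑ n ∈ Finset.range (2 * N), (-1) ^ n * L n * z ^ n =
      2 * ∑ n ∈ Finset.range N, L (2 * n) * (z ^ 2) ^ n := by
  rw [sum_range_two_mul, sum_range_two_mul (L := fun n => (-1) ^ n * L n)]
  have h0 : ∀ n : ℕ, (-1 : ℂ) ^ (2 * n) = 1 := fun n => by simp [pow_mul]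
  have h1 : ∀ n : ℕ, (-1 : ℂ) ^ (2 * n + 1) = -1 := fun n => by simp [pow_succ, pow_mul]
  simp only [h0, h1, one_mul, neg_mul, Finset.sum_neg_distrib]
  ring

lemma sum_range_odd_part {L : ℕ → ℂ} (z : ℂ) (N : ℕ) :
    ∑ n ∈ Finset.range (2 * N + 1), L n * z ^ n -
      ∑ n ∈ Finset.range (2 * N + 1), (-1) ^ n * L n * z ^ n =
      2 * z * ∑ n ∈ Finset.range N, L (2 * n + 1) * (z ^ 2) ^ n := by
  rw [Finset.sum_range_succ, Finset.sum_range_succ, sum_range_two_mul,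
    sum_range_two_mul (L := fun n => (-1) ^ n * L n)]
  have h0 : ∀ n : ℕ, (-1 : ℂ) ^ (2 * n) = 1 := fun n => by simp [pow_mul]
  have h1 : ∀ n : ℕ, (-1 : ℂ) ^ (2 * n + 1) = -1 := fun n => by simp [pow_succ, pow_mul]
  simp only [h0, h1, one_mul, neg_mul, Finset.sum_neg_distrib]
  ring

/-- The sums in two opposite directions recover the even and the odd part, as functions of `z ^ 2`. -/
theorem HasGevreySum.even_odd {L : ℕ → ℂ} (h0 : HasGevreySum 2 L)
    (h1 : HasGevreySum 2 fun n => (-1) ^ n * L n) :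
    (HasGevreySum 1 fun n => L (2 * n)) ∧ HasGevreySum 1 fun n => L (2 * n + 1) := by
  obtain ⟨α₀, R₀, C₀, K₀, w₀, hα₀, hR₀, hC₀, hK₀, h0⟩ := h0.exists_bound
  obtain ⟨α₁, R₁, C₁, K₁, w₁, hα₁, hR₁, hC₁, hK₁, h1⟩ := h1.exists_bound
  -- the cap at `π` keeps the sector of opening `2 * α` inside the slit plane
  set α := min (min α₀ α₁) Real.pi
  set R := min R₀ R₁
  set C := max C₀ C₁ with hC
  set K := max K₀ K₁
  obtain ⟨hv0, hb0⟩ := h0 α ((min_le_left _ _).trans (min_le_left _ _)) R (min_le_left _ _)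
    C (le_max_left _ _) K (le_max_left _ _)
  obtain ⟨hv1, hb1⟩ := h1 α ((min_le_left _ _).trans (min_le_right _ _)) R (min_le_right _ _)
    C (le_max_right _ _) K (le_max_right _ _)
  have hαpi : 2 * α ≤ 2 * Real.pi := by linarith [min_le_right (min α₀ α₁) Real.pi]
  have hπα : Real.pi / (1 : ℕ) < 2 * α := by
    have : Real.pi / 2 < α := lt_min (lt_min (by exact_mod_cast hα₀) (by exact_mod_cast hα₁))
      (by linarith [Real.pi_pos])
    push_cast
    linarith
  have hR0 : 0 < R := by positivity
  have hC0 : 0 < C := by positivity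
  have hm : ∀ t ∈ sector 0 (2 * α) (R ^ 2), halfPow t ∈ sector 0 α R := by
    intro t ht
    refine ⟨by simpa using halfPow_mem_unboundedSector hαpi ht.1, ?_⟩
    have := ht.2
    rw [mem_ball_zero_iff, ← norm_halfPow_sq (ne_zero_of_mem_unboundedSector ht.1)] at this
    rw [mem_ball_zero_iff]
    exact lt_of_pow_lt_pow_left₀ 2 hR0.le this
  have hd : DifferentiableOn ℂ halfPow (sector 0 (2 * α) (R ^ 2)) :=
    (differentiableOn_halfPow hαpi).mono Set.inter_subset_left
  have hd0 := hv0.comp hd hm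
  have hd1 := hv1.comp hd hm
  constructor
  · refine ⟨2 * α, R ^ 2, C, K ^ 2, fun t => (w₀ (halfPow t) + w₁ (halfPow t)) / 2, hπα,
      by positivity, hC0, by positivity, (hd0.add hd1).div_const 2, fun N t ht => ?_⟩
    have ht0 := ne_zero_of_mem_unboundedSector ht.1
    have e0 := hb0 (2 * N) _ (hm t ht)
    have e1 := hb1 (2 * N) _ (hm t ht)
    rw [Nat.mul_div_cancel_left _ two_pos, pow_mul, pow_mul, norm_halfPow_sq ht0] at e0 e1
    have hs := sum_range_even_part (L := L) (halfPow t) N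
    rw [halfPow_sq ht0] at hs
    rw [Nat.div_one]
    calc ‖_‖ = ‖((w₀ (halfPow t) - ∑ n ∈ Finset.range (2 * N), L n * halfPow t ^ n) +
          (w₁ (halfPow t) - ∑ n ∈ Finset.range (2 * N), (-1) ^ n * L n * halfPow t ^ n)) / 2‖ := by
            congr 1; linear_combination hs / 2
      _ ≤ _ := by
        rw [norm_div, Complex.norm_two, div_le_iff₀ two_pos]
        refine (norm_add_le _ _).trans ((add_le_add e0 e1).trans (le_of_eq ?_))
        ring
  · refine ⟨2 * α, R ^ 2, C * K, K ^ 2,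
      fun t => (w₀ (halfPow t) - w₁ (halfPow t)) / (2 * halfPow t), hπα,
      by positivity, by positivity, by positivity,
      (hd0.sub hd1).div (hd.const_mul 2) fun t _ => mul_ne_zero two_ne_zero (halfPow_ne_zero t),
      fun N t ht => ?_⟩
    have ht0 := ne_zero_of_mem_unboundedSector ht.1
    have hh := halfPow_ne_zero t
    have e0 := hb0 (2 * N + 1) _ (hm t ht)
    have e1 := hb1 (2 * N + 1) _ (hm t ht)
    rw [show (2 * N + 1) / 2 = N by omega, pow_succ, pow_succ, pow_mul, pow_mul,
      norm_halfPow_sq ht0] at e0 e1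
    have hs := sum_range_odd_part (L := L) (halfPow t) N
    rw [halfPow_sq ht0] at hs
    rw [Nat.div_one]
    calc ‖_‖ = ‖((w₀ (halfPow t) - ∑ n ∈ Finset.range (2 * N + 1), L n * halfPow t ^ n) -
          (w₁ (halfPow t) - ∑ n ∈ Finset.range (2 * N + 1), (-1) ^ n * L n * halfPow t ^ n)) /
            (2 * halfPow t)‖ := by
            congr 1; field_simp; linear_combination hs
      _ ≤ _ := by
        rw [norm_div, norm_mul, Complex.norm_two, div_le_iff₀ (by positivity)]
        refine (norm_sub_le _ _).trans ((add_le_add e0 e1).trans (le_of_eq ?_))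
        ring

theorem HasContinuation.interleave {L : ℕ → ℂ} (h0 : HasContinuation 1 fun n => L (2 * n))
    (h1 : HasContinuation 1 fun n => L (2 * n + 1)) : HasContinuation 2 L := by
  obtain ⟨r₀, ε₀, C₀, K₀, M₀, F₀, hr₀, hε₀, hF₀, hs₀, hb₀⟩ := h0
  obtain ⟨r₁, ε₁, C₁, K₁, M₁, F₁, hr₁, hε₁, hF₁, hs₁, hb₁⟩ := h1
  set r := min (min r₀ r₁) 1
  set ε := min ε₀ ε₁
  have hr1 : r ≤ 1 := min_le_right _ _
  have hmb : ∀ z ∈ Metric.ball (0 : ℂ) r, z ^ 2 ∈ Metric.ball (0 : ℂ) r := by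
    intro z hz
    rw [mem_ball_zero_iff] at hz ⊢
    rw [norm_pow]
    nlinarith [norm_nonneg z]
  have hb0 : Metric.ball (0 : ℂ) r ⊆ Metric.ball 0 r₀ :=
    Metric.ball_subset_ball ((min_le_left _ _).trans (min_le_left _ _))
  have hb1 : Metric.ball (0 : ℂ) r ⊆ Metric.ball 0 r₁ :=
    Metric.ball_subset_ball ((min_le_left _ _).trans (min_le_right _ _))
  have hms0 : ∀ z ∈ unboundedSector 0 (ε / 2), z ^ 2 ∈ unboundedSector 0 ε₀ := fun z hz =>
    unboundedSector_mono (min_le_left _ _) (sq_mem_unboundedSector hz)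
  have hms1 : ∀ z ∈ unboundedSector 0 (ε / 2), z ^ 2 ∈ unboundedSector 0 ε₁ := fun z hz =>
    unboundedSector_mono (min_le_right _ _) (sq_mem_unboundedSector hz)
  refine ⟨r, ε / 2, |C₀| + |C₁|, max |K₀| |K₁| + 1, max (max M₀ M₁) 1,
    fun z => F₀ (z ^ 2) + z * F₁ (z ^ 2), by positivity, by positivity, ?_, fun z hz => ?_,
    fun z hz hM => ?_⟩
  · refine (hF₀.comp (by fun_prop) ?_).add (differentiableOn_id.mul (hF₁.comp (by fun_prop) ?_))
    · rintro z (hz | hz)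
      exacts [Or.inl (hb0 (hmb z hz)), Or.inr (hms0 z hz)]
    · rintro z (hz | hz)
      exacts [Or.inl (hb1 (hmb z hz)), Or.inr (hms1 z hz)]
  · refine HasSum.even_add_odd ?_ ?_
    · simpa only [pow_mul] using hs₀ _ (hb0 (hmb z hz))
    · exact ((hs₁ _ (hb1 (hmb z hz))).mul_left z).congr_fun fun n => by rw [pow_succ, pow_mul]; ring
  · have hz1 : 1 ≤ ‖z‖ := (le_max_right _ _).trans hM
    have hz2 : ‖z‖ ≤ ‖z ^ 2‖ := by rw [norm_pow]; nlinarith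
    have e0 := hb₀ _ (hms0 z hz) (((le_max_left _ _).trans (le_max_left _ _)).trans (hM.trans hz2))
    have e1 := hb₁ _ (hms1 z hz) (((le_max_right _ _).trans (le_max_left _ _)).trans (hM.trans hz2))
    rw [norm_pow, pow_one] at e0 e1
    set Q := max |K₀| |K₁|
    have hexp : ‖z‖ ≤ Real.exp (‖z‖ ^ 2) := by
      have := Real.add_one_le_exp (‖z‖ ^ 2)
      nlinarith
    have hexp1 : 1 ≤ Real.exp (‖z‖ ^ 2) := Real.one_le_exp (by positivity)
    have a0 : ‖F₀ (z ^ 2)‖ ≤ |C₀| * Real.exp (Q * ‖z‖ ^ 2) := by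
      refine e0.trans (mul_le_mul (le_abs_self _) (Real.exp_le_exp.2 ?_) (Real.exp_pos _).le
        (abs_nonneg _))
      gcongr
      exact (le_abs_self _).trans (le_max_left _ _)
    have a1 : ‖F₁ (z ^ 2)‖ ≤ |C₁| * Real.exp (Q * ‖z‖ ^ 2) := by
      refine e1.trans (mul_le_mul (le_abs_self _) (Real.exp_le_exp.2 ?_) (Real.exp_pos _).le
        (abs_nonneg _))
      gcongr
      exact (le_abs_self _).trans (le_max_right _ _)
    calc ‖F₀ (z ^ 2) + z * F₁ (z ^ 2)‖ ≤ ‖F₀ (z ^ 2)‖ + ‖z‖ * ‖F₁ (z ^ 2)‖ := by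
          rw [← norm_mul]; exact norm_add_le _ _
      _ ≤ Real.exp (‖z‖ ^ 2) * (|C₀| * Real.exp (Q * ‖z‖ ^ 2)) +
          Real.exp (‖z‖ ^ 2) * (|C₁| * Real.exp (Q * ‖z‖ ^ 2)) := by
          refine add_le_add (a0.trans ?_) (mul_le_mul hexp a1 (norm_nonneg _) (Real.exp_pos _).le)
          exact le_mul_of_one_le_left (by positivity) hexp1
      _ = _ := by rw [add_mul Q, one_mul, Real.exp_add]; ring

theorem HasContinuation.even_odd {L : ℕ → ℂ} (h0 : HasContinuation 2 L)
    (h1 : HasContinuation 2 fun n => (-1) ^ n * L n) :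
    (HasContinuation 1 fun n => L (2 * n)) ∧ HasContinuation 1 fun n => L (2 * n + 1) := by
  obtain ⟨r₀, ε₀, C₀, K₀, M₀, F₀, hr₀, hε₀, hF₀, hs₀, hb₀⟩ := h0
  obtain ⟨r₁, ε₁, C₁, K₁, M₁, F₁, hr₁, hε₁, hF₁, hs₁, hb₁⟩ := h1
  set r := min r₀ r₁
  set ε := min (min ε₀ ε₁) Real.pi with hε
  have hr0 : 0 < r := by positivity
  have hε0 : 0 < 2 * ε := by have := Real.pi_pos; positivity
  have hεpi : 2 * ε ≤ 2 * Real.pi := by linarith [min_le_right (min ε₀ ε₁) Real.pi]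
  have hm0 : ∀ z ∈ unboundedSector 0 (2 * ε), halfPow z ∈ unboundedSector 0 ε₀ := fun z hz =>
    unboundedSector_mono (by simp [hε]) (halfPow_mem_unboundedSector hεpi hz)
  have hm1 : ∀ z ∈ unboundedSector 0 (2 * ε), halfPow z ∈ unboundedSector 0 ε₁ := fun z hz =>
    unboundedSector_mono (by simp [hε]) (halfPow_mem_unboundedSector hεpi hz)
  have hhb : ∀ z : ℂ, z ≠ 0 → ‖z‖ < r ^ 2 → ‖halfPow z‖ < r := by
    intro z hz hzr
    rw [← norm_halfPow_sq hz] at hzr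
    exact lt_of_pow_lt_pow_left₀ 2 hr0.le hzr
  -- every point of the disc is the square of a point where both power series converge
  have hE : ∀ z : ℂ, ‖z‖ < r →
      HasSum (fun n => L (2 * n) * (z ^ 2) ^ n) ((F₀ z + F₁ z) / 2) ∧
      HasSum (fun n => z * (L (2 * n + 1) * (z ^ 2) ^ n)) ((F₀ z - F₁ z) / 2) := by
    intro z hz
    have e0 := hs₀ z (by rw [mem_ball_zero_iff]; exact hz.trans_le (min_le_left _ _))
    have e1 := hs₁ z (by rw [mem_ball_zero_iff]; exact hz.trans_le (min_le_right _ _))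
    have hp := (e0.add e1).div_const 2
    have hn := (e0.sub e1).div_const 2
    have i0 : Function.Injective fun n : ℕ => 2 * n := fun a b h => by simpa using h
    have i1 : Function.Injective fun n : ℕ => 2 * n + 1 := fun a b h => by simpa using h
    constructor
    · have := (i0.hasSum_iff (f := fun n => (L n * z ^ n + (-1) ^ n * L n * z ^ n) / 2) ?_).2 hp
      · refine this.congr_fun fun n => ?_
        simp only [Function.comp, pow_mul]
        norm_num
      · intro n hn
        obtain ⟨m, rfl | rfl⟩ := n.even_or_odd'
        · exact absurd ⟨m, rfl⟩ hn
        · simp [pow_succ, pow_mul]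
    · have := (i1.hasSum_iff (f := fun n => (L n * z ^ n - (-1) ^ n * L n * z ^ n) / 2) ?_).2 hn
      · refine this.congr_fun fun n => ?_
        simp only [Function.comp, pow_mul, pow_succ]
        norm_num
        ring
      · intro n hn
        obtain ⟨m, rfl | rfl⟩ := n.even_or_odd'
        · simp [pow_mul]
        · exact absurd ⟨m, rfl⟩ hn
  have hd := differentiableOn_halfPow hεpi
  have hd0 := hF₀.comp hd fun z hz => Or.inr (hm0 z hz)
  have hd1 := hF₁.comp hd fun z hz => Or.inr (hm1 z hz)
  set Q := max |K₀| |K₁|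
  have hgrow : ∀ z ∈ unboundedSector 0 (2 * ε), max (max M₀ M₁) 1 ^ 2 ≤ ‖z‖ →
      1 ≤ ‖halfPow z‖ ∧ ‖F₀ (halfPow z)‖ + ‖F₁ (halfPow z)‖ ≤
        (|C₀| + |C₁|) * Real.exp (Q * ‖z‖ ^ 1) := by
    intro z hz hM
    have hz0 := ne_zero_of_mem_unboundedSector hz
    have hM' : max (max M₀ M₁) 1 ≤ ‖halfPow z‖ := by
      rw [← norm_halfPow_sq hz0] at hM
      exact le_of_sq_le_sq hM (norm_nonneg _)
    have e0 := hb₀ _ (hm0 z hz) (((le_max_left _ _).trans (le_max_left _ _)).trans hM')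
    have e1 := hb₁ _ (hm1 z hz) (((le_max_right _ _).trans (le_max_left _ _)).trans hM')
    rw [norm_halfPow_sq hz0] at e0 e1
    refine ⟨(le_max_right _ _).trans hM', ?_⟩
    rw [pow_one, add_mul]
    refine add_le_add (e0.trans (mul_le_mul (le_abs_self _) (Real.exp_le_exp.2 ?_)
      (Real.exp_pos _).le (abs_nonneg _))) (e1.trans (mul_le_mul (le_abs_self _)
      (Real.exp_le_exp.2 ?_) (Real.exp_pos _).le (abs_nonneg _)))
    · gcongr; exact (le_abs_self _).trans (le_max_left _ _)
    · gcongr; exact (le_abs_self _).trans (le_max_right _ _)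
  constructor
  · refine hasContinuation_of_sector (r := r ^ 2) (ε := 2 * ε) (C := |C₀| + |C₁|) (K := Q)
      (M := max (max M₀ M₁) 1 ^ 2) (S := fun z => (F₀ (halfPow z) + F₁ (halfPow z)) / 2)
      (by positivity) hε0 ?_ ((hd0.add hd1).div_const 2) ?_ ?_
    · intro z hz
      rcases eq_or_ne z 0 with rfl | hz0
      · simpa using (hE 0 (by simpa using hr0)).1.summable
      · have := (hE _ (hhb z hz0 (mem_ball_zero_iff.1 hz))).1.summable
        rwa [halfPow_sq hz0] at this
    · intro z hz hzr
      have hz0 := ne_zero_of_mem_unboundedSector hz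
      have := (hE _ (hhb z hz0 hzr)).1
      rwa [halfPow_sq hz0] at this
    · intro z hz hM
      refine le_trans ?_ (hgrow z hz hM).2
      rw [norm_div, Complex.norm_two, div_le_iff₀ two_pos]
      refine (norm_add_le _ _).trans ?_
      linarith [norm_nonneg (F₀ (halfPow z)), norm_nonneg (F₁ (halfPow z))]
  · have hodd : ∀ z : ℂ, z ≠ 0 → ‖z‖ < r ^ 2 → HasSum (fun n => L (2 * n + 1) * z ^ n)
        ((F₀ (halfPow z) - F₁ (halfPow z)) / (2 * halfPow z)) := by
      intro z hz0 hzr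
      have := (hE _ (hhb z hz0 hzr)).2.mul_left (halfPow z)⁻¹
      simp only [inv_mul_cancel_left₀ (halfPow_ne_zero z), halfPow_sq hz0] at this
      rwa [← div_eq_inv_mul, div_div] at this
    refine hasContinuation_of_sector (r := r ^ 2) (ε := 2 * ε) (C := |C₀| + |C₁|) (K := Q)
      (M := max (max M₀ M₁) 1 ^ 2)
      (S := fun z => (F₀ (halfPow z) - F₁ (halfPow z)) / (2 * halfPow z))
      (by positivity) hε0 ?_ ((hd0.sub hd1).div (hd.const_mul 2) fun z _ =>
        mul_ne_zero two_ne_zero (halfPow_ne_zero z)) ?_ ?_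
    · intro z hz
      rcases eq_or_ne z 0 with rfl | hz0
      · refine summable_of_ne_finset_zero (s := {0}) fun n hn => ?_
        rw [Finset.mem_singleton] at hn
        simp [hn]
      · exact (hodd z hz0 (mem_ball_zero_iff.1 hz)).summable
    · intro z hz hzr
      exact hodd z (ne_zero_of_mem_unboundedSector hz) hzr
    · intro z hz hM
      obtain ⟨h1, h2⟩ := hgrow z hz hM
      refine le_trans ?_ h2
      rw [norm_div, norm_mul, Complex.norm_two]
      refine (div_le_self (norm_nonneg _) (by linarith)).trans (norm_sub_le _ _)

end HeatSum
end

noncomputable section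
namespace HeatSum

/-! ### Holomorphic integrals and shifts of contours -/

open MeasureTheory in
/-- A dominated integral of functions holomorphic in a parameter is holomorphic. -/
theorem differentiableAt_integral_of_dominated {X : Type*} [MeasurableSpace X] {μ : Measure X}
    {F : ℂ → X → ℂ} {w₀ : ℂ} {δ : ℝ} {bound : X → ℝ} (hδ : 0 < δ)
    (hmeas : ∀ w ∈ Metric.ball w₀ δ, AEStronglyMeasurable (F w) μ)
    (hb : ∀ᵐ a ∂μ, ∀ w ∈ Metric.ball w₀ δ, ‖F w a‖ ≤ bound a) (hbi : Integrable bound μ)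
    (hd : ∀ᵐ a ∂μ, DifferentiableOn ℂ (fun w => F w a) (Metric.ball w₀ δ)) :
    DifferentiableAt ℂ (fun w => ∫ a, F w a ∂μ) w₀ := by
  have hw₀ : w₀ ∈ Metric.ball w₀ δ := Metric.mem_ball_self hδ
  have hder : ∀ᵐ a ∂μ, ∀ w ∈ Metric.ball w₀ δ,
      HasDerivAt (fun w => F w a) (deriv (fun w => F w a) w) w := by
    filter_upwards [hd] with a ha w hw
    exact (ha.differentiableAt (Metric.isOpen_ball.mem_nhds hw)).hasDerivAt
  have hsub : Metric.ball w₀ (δ / 2) ⊆ Metric.ball w₀ δ := Metric.ball_subset_ball (by linarith)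
  refine (hasDerivAt_integral_of_dominated_loc_of_deriv_le
    (F' := fun w a => deriv (fun w => F w a) w) (bound := fun a => bound a / (δ / 4))
    (Metric.ball_mem_nhds w₀ (half_pos hδ)) ?_ ?_ ?_ ?_ (hbi.div_const _) ?_).2.differentiableAt
  · filter_upwards [Metric.ball_mem_nhds w₀ hδ] with w hw using hmeas w hw
  · refine hbi.mono' (hmeas w₀ hw₀) ?_
    filter_upwards [hb] with a ha using ha w₀ hw₀
  · -- the derivative is a pointwise limit of difference quotients
    set h : ℕ → ℂ := fun n => ((δ / 2 / (n + 1) : ℝ) : ℂ) with hh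
    have hpos : ∀ n : ℕ, 0 < δ / 2 / ((n : ℝ) + 1) := fun n => by positivity
    have hmem : ∀ n, w₀ + h n ∈ Metric.ball w₀ δ := by
      intro n
      rw [mem_ball_iff_norm, add_sub_cancel_left, hh, Complex.norm_real,
        Real.norm_of_nonneg (hpos n).le]
      have : δ / 2 / ((n : ℝ) + 1) ≤ δ / 2 :=
        div_le_self (by linarith) (by have : (0 : ℝ) ≤ n := n.cast_nonneg; linarith)
      linarith
    have hlim : Tendsto (fun n => w₀ + h n) atTop (𝓝[≠] w₀) := by
      refine tendsto_nhdsWithin_iff.2 ⟨?_, Eventually.of_forall fun n => ?_⟩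
      · have h1 : Tendsto (fun n : ℕ => δ / 2 / ((n : ℝ) + 1)) atTop (𝓝 0) :=
          tendsto_const_nhds.div_atTop (tendsto_natCast_atTop_atTop.atTop_add tendsto_const_nhds)
        have h2 := (Complex.continuous_ofReal.tendsto 0).comp h1
        simpa [hh, Function.comp_def] using (tendsto_const_nhds (x := w₀)).add h2
      · have : h n ≠ 0 := Complex.ofReal_ne_zero.2 (hpos n).ne'
        simpa using this
    refine aestronglyMeasurable_of_tendsto_ae atTop
      (f := fun n a => slope (fun w => F w a) w₀ (w₀ + h n)) (fun n => ?_) ?_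
    · simp only [slope_def_field, div_eq_mul_inv]
      exact AEStronglyMeasurable.mul_const ((hmeas _ (hmem n)).sub (hmeas _ hw₀)) _
    · filter_upwards [hder] with a ha
      exact (ha w₀ hw₀).tendsto_slope.comp hlim
  · filter_upwards [hb, hd] with a ha hda w hw
    have hs : Metric.closedBall w (δ / 4) ⊆ Metric.ball w₀ δ := by
      intro z hz
      rw [Metric.mem_closedBall] at hz
      rw [Metric.mem_ball] at hw ⊢
      linarith [dist_triangle z w w₀]
    refine Complex.norm_deriv_le_of_forall_mem_sphere_norm_le (by linarith) ?_
      fun z hz => ha z (hs (Metric.sphere_subset_closedBall hz))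
    refine DifferentiableOn.diffContOnCl ?_
    rw [closure_ball _ (by linarith)]
    exact hda.mono hs
  · filter_upwards [hder] with a ha w hw using ha w (hsub hw)

open MeasureTheory in
/-- Cauchy's theorem in a horizontal strip. -/
theorem integral_horizontal_line_eq {h : ℂ → ℂ} {a b : ℝ} {M : ℝ → ℝ} (hab : a ≤ b)
    (hd : DifferentiableOn ℂ h {ξ | ξ.im ∈ Set.Icc a b})
    (hM : ∀ x : ℝ, ∀ y ∈ Set.Icc a b, ‖h (x + y * Complex.I)‖ ≤ M x) (hMi : Integrable M)
    (htop : Tendsto M atTop (𝓝 0)) (hbot : Tendsto M atBot (𝓝 0)) :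
    ∫ x : ℝ, h (x + a * Complex.I) = ∫ x : ℝ, h (x + b * Complex.I) := by
  have hline : ∀ y ∈ Set.Icc a b, Integrable fun x : ℝ => h (x + y * Complex.I) := by
    intro y hy
    refine hMi.mono' ?_ (Eventually.of_forall fun x => hM x y hy)
    refine Continuous.aestronglyMeasurable ?_
    refine hd.continuousOn.comp_continuous (by fun_prop) fun x => ?_
    simpa using hy
  have hrect : ∀ T : ℝ, (∫ x in (-T)..T, h (x + a * Complex.I)) -
      (∫ x in (-T)..T, h (x + b * Complex.I)) =
      Complex.I • (∫ y in a..b, h ((-T : ℝ) + y * Complex.I)) -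
        Complex.I • ∫ y in a..b, h (T + y * Complex.I) := by
    intro T
    have := Complex.integral_boundary_rect_eq_zero_of_differentiableOn h
      ((-T : ℝ) + a * Complex.I) ((T : ℝ) + b * Complex.I) (hd.mono ?_)
    · simp only [Complex.add_re, Complex.ofReal_re, Complex.mul_re, Complex.I_re, mul_zero,
        Complex.ofReal_im, Complex.I_im, mul_one, sub_self, add_zero, Complex.add_im,
        Complex.mul_im, zero_add] at this
      linear_combination this
    · intro ξ hξ
      rw [Complex.mem_reProdIm] at hξ
      simpa [Set.uIcc_of_le hab] using hξ.2
  have hvert : ∀ T : ℝ, ‖∫ y in a..b, h (T + y * Complex.I)‖ ≤ M T * |b - a| := fun T =>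
    intervalIntegral.norm_integral_le_of_norm_le_const fun y hy => hM T y (by
      rw [Set.uIoc_of_le hab] at hy
      exact ⟨hy.1.le, hy.2⟩)
  have hv1 : Tendsto (fun T : ℝ => ∫ y in a..b, h (T + y * Complex.I)) atTop (𝓝 0) :=
    squeeze_zero_norm hvert (by simpa using htop.mul_const |b - a|)
  have hv2 : Tendsto (fun T : ℝ => ∫ y in a..b, h ((-T : ℝ) + y * Complex.I)) atTop (𝓝 0) :=
    squeeze_zero_norm (fun T => hvert (-T))
      (by simpa using (hbot.comp tendsto_neg_atTop_atBot).mul_const |b - a|)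
  have h1 := (intervalIntegral_tendsto_integral (hline a ⟨le_rfl, hab⟩) tendsto_neg_atTop_atBot
    tendsto_id).sub (intervalIntegral_tendsto_integral (hline b ⟨hab, le_rfl⟩)
    tendsto_neg_atTop_atBot tendsto_id)
  have h2 := (hv2.const_smul Complex.I).sub (hv1.const_smul Complex.I)
  rw [smul_zero, sub_zero] at h2
  simp only [id] at h1
  simp only [hrect] at h1
  exact sub_eq_zero.1 (tendsto_nhds_unique h1 h2)

/-! ### The Gamma integral on horizontal lines

With `s = exp ζ`, the integral `∫ exp (-s) s ^ (β - 1) ds` along a ray becomes the integral of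
`exp (-exp ζ + β ζ)` along a horizontal line. -/

lemma exp_neg_mul_exp_add_eq (κ β x : ℝ) :
    Real.exp (-κ * Real.exp x + β * x) =
      |Real.exp x| • (Real.exp x ^ (β - 1) * Real.exp (-κ * Real.exp x ^ (1 : ℝ))) := by
  rw [abs_of_pos (Real.exp_pos x), smul_eq_mul, ← Real.exp_mul, Real.rpow_one, ← Real.exp_add,
    ← Real.exp_add]
  ring_nf

open MeasureTheory in
lemma integrable_exp_neg_mul_exp_add {κ β : ℝ} (hκ : 0 < κ) (hβ : 0 < β) :
    Integrable fun x : ℝ => Real.exp (-κ * Real.exp x + β * x) := by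
  have h1 := integrableOn_rpow_mul_exp_neg_mul_rpow (p := 1) (s := β - 1) (by linarith) one_pos hκ
  rw [← Real.range_exp, ← Set.image_univ, integrableOn_image_iff_integrableOn_abs_deriv_smul
    MeasurableSet.univ (fun x _ => (Real.hasDerivAt_exp x).hasDerivWithinAt)
    Real.exp_injective.injOn, integrableOn_univ] at h1
  simpa only [← exp_neg_mul_exp_add_eq] using h1

open MeasureTheory in
lemma integral_exp_neg_exp_add {β : ℝ} (hβ : 0 < β) :
    ∫ x : ℝ, Real.exp (-1 * Real.exp x + β * x) = Real.Gamma β := by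
  simp only [exp_neg_mul_exp_add_eq]
  rw [Real.Gamma_eq_integral hβ, ← Real.range_exp, ← Set.image_univ,
    integral_image_eq_integral_abs_deriv_smul MeasurableSet.univ
      (fun x _ => (Real.hasDerivAt_exp x).hasDerivWithinAt) Real.exp_injective.injOn,
    Measure.restrict_univ]
  refine integral_congr_ae (Eventually.of_forall fun x => ?_)
  simp only [Real.rpow_one, neg_mul, one_mul]
  rw [mul_comm (Real.exp x ^ (β - 1))]

lemma tendsto_exp_neg_mul_exp_add_atTop {κ : ℝ} (hκ : 0 < κ) (β : ℝ) :
    Tendsto (fun x : ℝ => Real.exp (-κ * Real.exp x + β * x)) atTop (𝓝 0) := by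
  have := (tendsto_rpow_mul_exp_neg_mul_atTop_nhds_zero β κ hκ).comp Real.tendsto_exp_atTop
  refine this.congr fun x => ?_
  simp only [Function.comp]
  rw [← Real.exp_mul, ← Real.exp_add]
  ring_nf

lemma tendsto_exp_neg_mul_exp_add_atBot {κ β : ℝ} (hκ : 0 ≤ κ) (hβ : 0 < β) :
    Tendsto (fun x : ℝ => Real.exp (-κ * Real.exp x + β * x)) atBot (𝓝 0) := by
  refine squeeze_zero (fun _ => (Real.exp_pos _).le) (g := fun x : ℝ => Real.exp (β * x))
    (fun x => Real.exp_le_exp.2 ?_) ?_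
  · have : 0 ≤ κ * Real.exp x := mul_nonneg hκ (Real.exp_pos x).le
    linarith
  · exact Real.tendsto_exp_atBot.comp (tendsto_id.const_mul_atBot hβ)

/-- The kernel of the Laplace transform in logarithmic coordinates. -/
def gammaKernel (β : ℝ) (ζ : ℂ) : ℂ := Complex.exp (-Complex.exp ζ + β * ζ)

lemma norm_gammaKernel (β x y : ℝ) : ‖gammaKernel β (x + y * Complex.I)‖ =
    Real.exp (-Real.cos y * Real.exp x + β * x) := by
  rw [gammaKernel, Complex.norm_exp]
  congr 1
  simp [Complex.exp_re]
  ring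

lemma norm_gammaKernel_le {β x y κ : ℝ} (h : κ ≤ Real.cos y) :
    ‖gammaKernel β (x + y * Complex.I)‖ ≤ Real.exp (-κ * Real.exp x + β * x) := by
  rw [norm_gammaKernel]
  gcongr

lemma cos_le_cos_of_abs_le {y ψ : ℝ} (h : |y| ≤ |ψ|) (hψ : |ψ| ≤ Real.pi) :
    Real.cos ψ ≤ Real.cos y := by
  rw [← Real.cos_abs y, ← Real.cos_abs ψ]
  exact Real.cos_le_cos_of_nonneg_of_le_pi (abs_nonneg _) hψ h

lemma differentiable_gammaKernel (β : ℝ) : Differentiable ℂ (gammaKernel β) := by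
  unfold gammaKernel
  fun_prop

theorem integral_gammaKernel {β ψ : ℝ} (hβ : 0 < β) (hψ : |ψ| < Real.pi / 2) :
    ∫ x : ℝ, gammaKernel β (x + ψ * Complex.I) = Real.Gamma β := by
  have h0 : ∫ x : ℝ, gammaKernel β (x + (0 : ℝ) * Complex.I) = Real.Gamma β := by
    rw [← integral_exp_neg_exp_add hβ, ← integral_complex_ofReal]
    congr 1
    ext x
    simp [gammaKernel]
  have hc : 0 < Real.cos ψ := Real.cos_pos_of_mem_Ioo (abs_lt.1 hψ)
  have key : ∀ a b : ℝ, a ≤ b → (∀ y ∈ Set.Icc a b, |y| ≤ |ψ|) →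
      ∫ x : ℝ, gammaKernel β (x + a * Complex.I) = ∫ x : ℝ, gammaKernel β (x + b * Complex.I) := by
    intro a b hab hy
    refine integral_horizontal_line_eq hab (differentiable_gammaKernel β).differentiableOn
      (fun x y hy' => norm_gammaKernel_le
        (cos_le_cos_of_abs_le (hy y hy') (by linarith [Real.pi_pos])))
      (integrable_exp_neg_mul_exp_add hc hβ) (tendsto_exp_neg_mul_exp_add_atTop hc β)
      (tendsto_exp_neg_mul_exp_add_atBot hc.le hβ)
  rw [← h0]
  rcases le_total 0 ψ with h | h
  · refine (key 0 ψ h fun y hy => ?_).symm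
    rw [abs_of_nonneg hy.1, abs_of_nonneg h]
    exact hy.2
  · refine key ψ 0 h fun y hy => ?_
    rw [abs_of_nonpos hy.2, abs_of_nonpos h]
    linarith [hy.1]

end HeatSum
end

noncomputable section
namespace HeatSum

/-! ### The Laplace transform: from continuation to Gevrey expansions -/

lemma sum_range_pow_le {X : ℝ} (hX : 2 ≤ X) (N : ℕ) : ∑ n ∈ Finset.range N, X ^ n ≤ X ^ N := by
  have h := geom_sum_mul X N
  have h0 : 0 ≤ ∑ n ∈ Finset.range N, X ^ n := Finset.sum_nonneg fun n _ => by positivity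
  nlinarith

/-- Growth at infinity and convergence at `0` combine into bounds for all Taylor remainders on a
narrower sector. -/
lemma HasContinuation.exists_remainder_bound {g : ℕ → ℂ} (h : HasContinuation 1 g) :
    ∃ (ε A K : ℝ) (F : ℂ → ℂ), 0 < ε ∧ ε < Real.pi ∧ 0 < A ∧ 0 < K ∧
      DifferentiableOn ℂ F (unboundedSector 0 ε) ∧ ∀ N : ℕ, ∀ z ∈ unboundedSector 0 ε,
        ‖F z - ∑ n ∈ Finset.range N, g n * z ^ n‖ ≤ A * (K * ‖z‖) ^ N * Real.exp (K * ‖z‖) := by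
  obtain ⟨r, ε₀, C, K₀, M, F, hr, hε₀, hF, hs, hb⟩ := h
  have hpi := Real.pi_pos
  set ε := min ε₀ Real.pi / 2 with hε
  have hεpos : 0 < ε := by positivity
  have hε1 : ε < ε₀ := by
    have := min_le_left ε₀ Real.pi
    linarith
  have hε2 : ε < Real.pi := by
    have := min_le_right ε₀ Real.pi
    linarith
  set ρ := r / 2 with hρ
  have hρ0 : 0 < ρ := by positivity
  obtain ⟨A₂, hA₂⟩ : ∃ A₂ : ℝ, ∀ n, ‖g n‖ * ρ ^ n ≤ A₂ := by
    have hsum : Summable fun n => ‖g n * (ρ : ℂ) ^ n‖ := by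
      refine (hs ρ ?_).summable.norm
      rw [mem_ball_zero_iff, Complex.norm_real, Real.norm_of_nonneg hρ0.le]
      linarith
    refine ⟨∑' n, ‖g n * (ρ : ℂ) ^ n‖, fun n => ?_⟩
    have := hsum.le_tsum n fun _ _ => norm_nonneg _
    simpa [Real.norm_of_nonneg hρ0.le, abs_of_pos hρ0] using this
  have hA₂0 : 0 ≤ A₂ := le_trans (by positivity) (hA₂ 0)
  have hgn : ∀ n, ∀ z : ℂ, ‖g n * z ^ n‖ ≤ A₂ * (‖z‖ / ρ) ^ n := by
    intro n z
    rw [norm_mul, norm_pow, div_pow, mul_div_assoc', le_div_iff₀ (by positivity)]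
    calc ‖g n‖ * ‖z‖ ^ n * ρ ^ n = (‖g n‖ * ρ ^ n) * ‖z‖ ^ n := by ring
      _ ≤ _ := by gcongr; exact hA₂ n
  obtain ⟨A₁, hA₁⟩ : ∃ A₁ : ℝ, ∀ z ∈ unboundedSector 0 ε, ρ / 2 ≤ ‖z‖ → ‖z‖ ≤ M → ‖F z‖ ≤ A₁ := by
    set T : Set ℂ := (fun p : ℝ × ℝ => (p.1 : ℂ) * Complex.exp ((p.2 : ℂ) * Complex.I)) ''
      (Set.Icc (ρ / 2) M ×ˢ Set.Icc (-(ε / 2)) (ε / 2))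
    have hTc : IsCompact T := (isCompact_Icc.prod isCompact_Icc).image (by fun_prop)
    have hTs : T ⊆ Metric.ball 0 r ∪ unboundedSector 0 ε₀ := by
      rintro _ ⟨⟨s, φ⟩, ⟨⟨hs1, hs2⟩, ⟨hφ1, hφ2⟩⟩, rfl⟩
      dsimp only at *
      refine Or.inr ⟨s, φ, by linarith, ?_, rfl⟩
      rw [sub_zero, abs_lt]
      constructor <;> linarith
    obtain ⟨A₁, hA₁⟩ := hTc.exists_bound_of_continuousOn (hF.mono hTs).continuousOn
    refine ⟨A₁, fun z hz h1 h2 => hA₁ z ?_⟩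
    obtain ⟨s, φ, hs, hφ, rfl⟩ := hz
    rw [norm_mul, Complex.norm_exp_ofReal_mul_I, mul_one, Complex.norm_real,
      Real.norm_of_nonneg hs.le] at h1 h2
    rw [sub_zero, abs_lt] at hφ
    exact ⟨(s, φ), ⟨⟨h1, h2⟩, ⟨by dsimp only; linarith, hφ.2.le⟩⟩, rfl⟩
  set K := max |K₀| (4 / ρ)
  have hK4 : 4 / ρ ≤ K := le_max_right _ _
  have hK0 : 0 < K := lt_of_lt_of_le (by positivity) hK4
  have hFb : ∀ z ∈ unboundedSector 0 ε, ρ / 2 ≤ ‖z‖ →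
      ‖F z‖ ≤ (|A₁| + |C|) * Real.exp (K * ‖z‖) := by
    intro z hz hz1
    rcases le_total ‖z‖ M with hM | hM
    · calc ‖F z‖ ≤ |A₁| := (hA₁ z hz hz1 hM).trans (le_abs_self _)
        _ ≤ (|A₁| + |C|) * 1 := by linarith [abs_nonneg C]
        _ ≤ _ := by gcongr; exact Real.one_le_exp (by positivity)
    · refine (hb z (unboundedSector_mono hε1.le hz) hM).trans ?_
      rw [pow_one]
      refine mul_le_mul ((le_abs_self _).trans (le_add_of_nonneg_left (abs_nonneg _)))
        (Real.exp_le_exp.2 ?_) (Real.exp_pos _).le (by positivity)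
      gcongr
      exact (le_abs_self _).trans (le_max_left _ _)
  refine ⟨ε, |A₁| + |C| + 2 * A₂ + 1, K, F, hεpos, hε2, by positivity, hK0,
    hF.mono fun z hz => Or.inr (unboundedSector_mono hε1.le hz), fun N z hz => ?_⟩
  have he1 : 1 ≤ Real.exp (K * ‖z‖) := Real.one_le_exp (by positivity)
  have hzK : ‖z‖ / ρ * 4 ≤ K * ‖z‖ := by
    calc ‖z‖ / ρ * 4 = 4 / ρ * ‖z‖ := by ring
      _ ≤ _ := by gcongr
  have hzρ : 0 ≤ ‖z‖ / ρ := by positivity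
  rcases le_total ‖z‖ (ρ / 2) with hz1 | hz1
  · have hzb : z ∈ Metric.ball (0 : ℂ) r := by
      rw [mem_ball_zero_iff]; linarith
    have h1 := (hasSum_nat_add_iff' N).2 (hs z hzb)
    have hq : ‖z‖ / ρ ≤ 1 / 2 := by rw [div_le_iff₀ hρ0]; linarith
    have h2 : HasSum (fun n : ℕ => A₂ * (‖z‖ / ρ) ^ N * (1 / 2) ^ n)
        (A₂ * (‖z‖ / ρ) ^ N * (1 - 1 / 2)⁻¹) :=
      (hasSum_geometric_of_lt_one (by norm_num) (by norm_num)).mul_left _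
    have h3 := HasSum.norm_le_of_bounded h1 h2 fun n => by
      refine (hgn (n + N) z).trans ?_
      rw [pow_add, mul_assoc A₂, mul_comm ((‖z‖ / ρ) ^ n)]
      gcongr
    refine h3.trans ?_
    calc A₂ * (‖z‖ / ρ) ^ N * (1 - 1 / 2)⁻¹ = 2 * A₂ * (‖z‖ / ρ) ^ N * 1 := by norm_num; ring
      _ ≤ (|A₁| + |C| + 2 * A₂ + 1) * (K * ‖z‖) ^ N * Real.exp (K * ‖z‖) := by
        gcongr
        · linarith [abs_nonneg A₁, abs_nonneg C]
        · linarith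
  · have hX : 2 ≤ K * ‖z‖ := by
      refine le_trans ?_ hzK
      have : 1 / 2 ≤ ‖z‖ / ρ := by rw [le_div_iff₀ hρ0]; linarith
      linarith
    have h1 : ‖∑ n ∈ Finset.range N, g n * z ^ n‖ ≤ A₂ * (K * ‖z‖) ^ N := by
      refine (norm_sum_le _ _).trans ?_
      calc ∑ n ∈ Finset.range N, ‖g n * z ^ n‖
          ≤ ∑ n ∈ Finset.range N, A₂ * (K * ‖z‖) ^ n := by
            refine Finset.sum_le_sum fun n _ => (hgn n z).trans ?_
            gcongr
            linarith
        _ = A₂ * ∑ n ∈ Finset.range N, (K * ‖z‖) ^ n := by rw [Finset.mul_sum]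
        _ ≤ _ := by gcongr; exact sum_range_pow_le hX N
    have hp1 : 1 ≤ (K * ‖z‖) ^ N := one_le_pow₀ (by linarith)
    calc ‖F z - ∑ n ∈ Finset.range N, g n * z ^ n‖
        ≤ (|A₁| + |C|) * 1 * Real.exp (K * ‖z‖) + A₂ * (K * ‖z‖) ^ N * 1 := by
          refine (norm_sub_le _ _).trans (add_le_add ?_ ?_)
          · simpa using hFb z hz hz1
          · simpa using h1
      _ ≤ (|A₁| + |C|) * (K * ‖z‖) ^ N * Real.exp (K * ‖z‖) +
          A₂ * (K * ‖z‖) ^ N * Real.exp (K * ‖z‖) := by gcongr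
      _ = (|A₁| + |C| + A₂) * ((K * ‖z‖) ^ N * Real.exp (K * ‖z‖)) := by ring
      _ ≤ (|A₁| + |C| + 2 * A₂ + 1) * ((K * ‖z‖) ^ N * Real.exp (K * ‖z‖)) := by
          refine mul_le_mul_of_nonneg_right ?_ (by positivity)
          linarith
      _ = _ := by ring

lemma mul_exp_mem_unboundedSector {ε x y : ℝ} {t : ℂ} (ht : t ≠ 0)
    (h : |Complex.arg t + y| < ε / 2) :
    t * Complex.exp (x + y * Complex.I) ∈ unboundedSector 0 ε := by
  refine mem_unboundedSector_iff.2 ⟨Complex.log t + (x + y * Complex.I), ?_, ?_⟩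
  · simpa [Complex.log_im] using h
  · rw [Complex.exp_add, Complex.exp_log ht]

lemma abs_arg_lt_of_mem_unboundedSector {α : ℝ} (hα : α ≤ 2 * Real.pi) {t : ℂ}
    (ht : t ∈ unboundedSector 0 α) : |Complex.arg t| < α / 2 := by
  obtain ⟨ξ, hξ, rfl⟩ := mem_unboundedSector_iff.1 ht
  rw [← Complex.log_im, log_exp_of_abs_im_lt hξ hα]
  simpa using hξ

lemma norm_mul_exp_add_mul_I (t : ℂ) (x y : ℝ) :
    ‖t * Complex.exp (x + y * Complex.I)‖ = ‖t‖ * Real.exp x := by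
  rw [norm_mul, Complex.norm_exp]
  simp

/-- The Laplace integral `∫ exp (-s) s ^ (β - 1) F (t s) ds` along the ray of direction `ψ`, in
the coordinate `ζ = log s`. -/
def laplaceLine (β : ℝ) (F : ℂ → ℂ) (ψ : ℝ) (t : ℂ) : ℂ :=
  ∫ x : ℝ, gammaKernel β (x + ψ * Complex.I) * F (t * Complex.exp (x + ψ * Complex.I))

section Laplace

variable {β ε A K κ : ℝ} {F : ℂ → ℂ}

lemma norm_gammaKernel_mul_le (hA : 0 ≤ A) (hFb : ∀ z ∈ unboundedSector 0 ε,
    ‖F z‖ ≤ A * Real.exp (K * ‖z‖)) {t : ℂ} (ht : t ≠ 0) (htK : K * ‖t‖ ≤ κ / 2) {x y : ℝ}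
    (hy : |Complex.arg t + y| < ε / 2) (hκ : κ ≤ Real.cos y) :
    ‖gammaKernel β (x + y * Complex.I) * F (t * Complex.exp (x + y * Complex.I))‖ ≤
      A * Real.exp (-(κ / 2) * Real.exp x + β * x) := by
  have h1 := hFb _ (mul_exp_mem_unboundedSector (x := x) ht hy)
  rw [norm_mul_exp_add_mul_I] at h1
  rw [norm_mul]
  calc _ ≤ Real.exp (-κ * Real.exp x + β * x) * (A * Real.exp (κ / 2 * Real.exp x)) := by
        refine mul_le_mul (norm_gammaKernel_le hκ) (h1.trans ?_) (norm_nonneg _)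
          (Real.exp_pos _).le
        rw [← mul_assoc]
        gcongr
    _ = A * (Real.exp (-κ * Real.exp x + β * x) * Real.exp (κ / 2 * Real.exp x)) := by ring
    _ = _ := by rw [← Real.exp_add]; ring_nf

lemma continuous_gammaKernel_mul (hF : ContinuousOn F (unboundedSector 0 ε)) {t : ℂ} (ht : t ≠ 0)
    {y : ℝ} (hy : |Complex.arg t + y| < ε / 2) :
    Continuous fun x : ℝ => gammaKernel β (x + y * Complex.I) *
      F (t * Complex.exp (x + y * Complex.I)) := by
  refine ((differentiable_gammaKernel β).continuous.comp (by fun_prop)).mul ?_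
  exact hF.comp_continuous (by fun_prop) fun x => mul_exp_mem_unboundedSector ht hy

/-- The Laplace integral does not depend on the ray. -/
lemma laplaceLine_eq (hβ : 0 < β) (hA : 0 ≤ A) (hκ0 : 0 < κ)
    (hF : DifferentiableOn ℂ F (unboundedSector 0 ε))
    (hFb : ∀ z ∈ unboundedSector 0 ε, ‖F z‖ ≤ A * Real.exp (K * ‖z‖)) {t : ℂ} (ht : t ≠ 0)
    (htK : K * ‖t‖ ≤ κ / 2) {ψ₁ ψ₂ : ℝ} (h12 : ψ₁ ≤ ψ₂)
    (h1 : |Complex.arg t + ψ₁| < ε / 2) (h2 : |Complex.arg t + ψ₂| < ε / 2)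
    (hκ : ∀ y ∈ Set.Icc ψ₁ ψ₂, κ ≤ Real.cos y) :
    laplaceLine β F ψ₁ t = laplaceLine β F ψ₂ t := by
  have hmem : ∀ y ∈ Set.Icc ψ₁ ψ₂, |Complex.arg t + y| < ε / 2 := by
    rintro y ⟨hy1, hy2⟩
    rw [abs_lt] at *
    constructor <;> linarith
  refine integral_horizontal_line_eq
    (h := fun ζ => gammaKernel β ζ * F (t * Complex.exp ζ)) h12 ?_
    (fun x y hy => norm_gammaKernel_mul_le hA hFb ht htK (hmem y hy) (hκ y hy))
    ((integrable_exp_neg_mul_exp_add (half_pos hκ0) hβ).const_mul A) ?_ ?_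
  · refine (differentiable_gammaKernel β).differentiableOn.mul (hF.comp (by fun_prop) ?_)
    intro ζ hζ
    have := mul_exp_mem_unboundedSector (x := ζ.re) ht (hmem _ hζ)
    rwa [Complex.re_add_im] at this
  · simpa using (tendsto_exp_neg_mul_exp_add_atTop (half_pos hκ0) β).const_mul A
  · simpa using (tendsto_exp_neg_mul_exp_add_atBot (half_pos hκ0).le hβ).const_mul A

open MeasureTheory in
lemma differentiableAt_laplaceLine (hβ : 0 < β) (hA : 0 ≤ A) (hκ0 : 0 < κ)
    (hF : DifferentiableOn ℂ F (unboundedSector 0 ε))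
    (hFb : ∀ z ∈ unboundedSector 0 ε, ‖F z‖ ≤ A * Real.exp (K * ‖z‖)) {t₀ : ℂ} {ψ : ℝ}
    (hψ : κ ≤ Real.cos ψ)
    (hnear : ∀ᶠ t in 𝓝 t₀, t ≠ 0 ∧ K * ‖t‖ ≤ κ / 2 ∧ |Complex.arg t + ψ| < ε / 2) :
    DifferentiableAt ℂ (laplaceLine β F ψ) t₀ := by
  obtain ⟨δ, hδ, hball⟩ := Metric.eventually_nhds_iff_ball.1 hnear
  refine differentiableAt_integral_of_dominated hδ
    (bound := fun x => A * Real.exp (-(κ / 2) * Real.exp x + β * x)) (fun t ht => ?_)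
    (Eventually.of_forall fun x t ht => ?_)
    ((integrable_exp_neg_mul_exp_add (half_pos hκ0) hβ).const_mul A)
    (Eventually.of_forall fun x => ?_)
  · obtain ⟨h0, h1, h2⟩ := hball t ht
    exact (continuous_gammaKernel_mul hF.continuousOn h0 h2).aestronglyMeasurable
  · obtain ⟨h0, h1, h2⟩ := hball t ht
    exact norm_gammaKernel_mul_le hA hFb h0 h1 h2 hψ
  · refine (hF.comp (by fun_prop) fun t ht => ?_).const_mul _
    obtain ⟨h0, h1, h2⟩ := hball t ht
    exact mul_exp_mem_unboundedSector h0 h2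

lemma gammaKernel_mul_exp_pow (ζ : ℂ) (n : ℕ) :
    gammaKernel β ζ * Complex.exp ζ ^ n = gammaKernel (n + β) ζ := by
  rw [gammaKernel, gammaKernel, ← Complex.exp_nat_mul, ← Complex.exp_add]
  push_cast
  ring_nf

open MeasureTheory in
lemma integrable_gammaKernel {y : ℝ} (hβ : 0 < β) (hκ0 : 0 < κ) (hκ : κ ≤ Real.cos y) :
    Integrable fun x : ℝ => gammaKernel β (x + y * Complex.I) :=
  (integrable_exp_neg_mul_exp_add hκ0 hβ).mono'
    ((differentiable_gammaKernel β).continuous.comp (by fun_prop)).aestronglyMeasurable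
    (Eventually.of_forall fun _ => norm_gammaKernel_le hκ)

open MeasureTheory in
/-- The Gevrey remainder bound. The factorial comes from
`(κ / 4 * exp x) ^ N ≤ N! * exp (κ / 4 * exp x)`. -/
lemma norm_laplaceLine_sub_le {g : ℕ → ℂ} (hβ : 0 < β) (hA : 0 ≤ A) (hK : 0 ≤ K) (hκ0 : 0 < κ)
    (hF : DifferentiableOn ℂ F (unboundedSector 0 ε))
    (hFb : ∀ N : ℕ, ∀ z ∈ unboundedSector 0 ε,
        ‖F z - ∑ n ∈ Finset.range N, g n * z ^ n‖ ≤ A * (K * ‖z‖) ^ N * Real.exp (K * ‖z‖))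
    {t : ℂ} (ht : t ≠ 0) (htK : K * ‖t‖ ≤ κ / 2) {ψ : ℝ} (hψ : |ψ| < Real.pi / 2)
    (hψt : |Complex.arg t + ψ| < ε / 2) (hκ : κ ≤ Real.cos ψ) (N : ℕ) :
    ‖laplaceLine β F ψ t - ∑ n ∈ Finset.range N, g n * Real.Gamma (n + β) * t ^ n‖ ≤
      (A * ∫ x : ℝ, Real.exp (-(κ / 4) * Real.exp x + β * x)) * (4 / κ * K) ^ N * N.factorial *
        ‖t‖ ^ N := by
  have hFb0 : ∀ z ∈ unboundedSector 0 ε, ‖F z‖ ≤ A * Real.exp (K * ‖z‖) := fun z hz => by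
    simpa using hFb 0 z hz
  have hint : Integrable fun x : ℝ => gammaKernel β (x + ψ * Complex.I) *
      F (t * Complex.exp (x + ψ * Complex.I)) :=
    ((integrable_exp_neg_mul_exp_add (half_pos hκ0) hβ).const_mul A).mono'
      (continuous_gammaKernel_mul hF.continuousOn ht hψt).aestronglyMeasurable
      (Eventually.of_forall fun x => norm_gammaKernel_mul_le hA hFb0 ht htK hψt hκ)
  have hmono : ∀ n : ℕ, ∀ x : ℝ, gammaKernel β (x + ψ * Complex.I) *
      (g n * (t * Complex.exp (x + ψ * Complex.I)) ^ n) =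
      g n * t ^ n * gammaKernel (n + β) (x + ψ * Complex.I) := by
    intro n x
    rw [← gammaKernel_mul_exp_pow, mul_pow]
    ring
  have hnβ : ∀ n : ℕ, 0 < (n : ℝ) + β := fun n => by positivity
  have hsumint : ∫ x : ℝ, ∑ n ∈ Finset.range N, gammaKernel β (x + ψ * Complex.I) *
      (g n * (t * Complex.exp (x + ψ * Complex.I)) ^ n) =
      ∑ n ∈ Finset.range N, g n * Real.Gamma (n + β) * t ^ n := by
    simp only [hmono]
    rw [integral_finsetSum _ fun n _ => (integrable_gammaKernel (hnβ n) hκ0 hκ).const_mul _]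
    refine Finset.sum_congr rfl fun n _ => ?_
    rw [integral_const_mul, integral_gammaKernel (hnβ n) hψ]
    ring
  have hsumI : Integrable fun x : ℝ => ∑ n ∈ Finset.range N, gammaKernel β (x + ψ * Complex.I) *
      (g n * (t * Complex.exp (x + ψ * Complex.I)) ^ n) := by
    simp only [hmono]
    exact integrable_finsetSum _ fun n _ => (integrable_gammaKernel (hnβ n) hκ0 hκ).const_mul _
  rw [← hsumint, laplaceLine, ← integral_sub hint hsumI]
  have hbd : ∀ x : ℝ, ‖gammaKernel β (x + ψ * Complex.I) * F (t * Complex.exp (x + ψ * Complex.I)) -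
      ∑ n ∈ Finset.range N, gammaKernel β (x + ψ * Complex.I) *
      (g n * (t * Complex.exp (x + ψ * Complex.I)) ^ n)‖ ≤
      A * (4 / κ * K) ^ N * N.factorial * ‖t‖ ^ N *
        Real.exp (-(κ / 4) * Real.exp x + β * x) := by
    intro x
    have h1 := hFb N _ (mul_exp_mem_unboundedSector (x := x) ht hψt)
    rw [norm_mul_exp_add_mul_I] at h1
    have h2 := Real.pow_div_factorial_le_exp (κ / 4 * Real.exp x) (by positivity) N
    rw [div_le_iff₀ (by positivity)] at h2
    rw [← Finset.mul_sum, ← mul_sub, norm_mul]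
    calc _ ≤ Real.exp (-κ * Real.exp x + β * x) *
          (A * (K * (‖t‖ * Real.exp x)) ^ N * Real.exp (κ / 2 * Real.exp x)) := by
          refine mul_le_mul (norm_gammaKernel_le hκ) (h1.trans ?_) (norm_nonneg _)
            (Real.exp_pos _).le
          rw [← mul_assoc K ‖t‖]
          gcongr
      _ = A * (4 / κ * K) ^ N * ‖t‖ ^ N * (κ / 4 * Real.exp x) ^ N *
          (Real.exp (-κ * Real.exp x + β * x) * Real.exp (κ / 2 * Real.exp x)) := by
          simp only [mul_pow, div_pow]
          field_simp
      _ ≤ A * (4 / κ * K) ^ N * ‖t‖ ^ N * (Real.exp (κ / 4 * Real.exp x) * N.factorial) *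
          (Real.exp (-κ * Real.exp x + β * x) * Real.exp (κ / 2 * Real.exp x)) := by gcongr
      _ = A * (4 / κ * K) ^ N * N.factorial * ‖t‖ ^ N * (Real.exp (-κ * Real.exp x + β * x) *
          Real.exp (κ / 2 * Real.exp x) * Real.exp (κ / 4 * Real.exp x)) := by ring
      _ = _ := by rw [← Real.exp_add, ← Real.exp_add]; ring_nf
  refine (norm_integral_le_of_norm_le ((integrable_exp_neg_mul_exp_add (κ := κ / 4) (by linarith)
    hβ).const_mul _) (Eventually.of_forall hbd)).trans (le_of_eq ?_)
  rw [integral_const_mul]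
  ring

end Laplace

open MeasureTheory in
/-- The Laplace transform with weights `Γ(n + β)`. The direction of the ray of integration varies
with `arg t`, which gives a sector of opening larger than `π`. -/
theorem HasContinuation.hasGevreySum {g : ℕ → ℂ} (h : HasContinuation 1 g) {β : ℝ} (hβ : 0 < β) :
    HasGevreySum 1 fun n => g n * Real.Gamma (n + β) := by
  obtain ⟨ε, A, K, F, hε, hεπ, hA, hK, hF, hFb⟩ := h.exists_remainder_bound
  have hFb0 : ∀ z ∈ unboundedSector 0 ε, ‖F z‖ ≤ A * Real.exp (K * ‖z‖) := fun z hz => by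
    simpa using hFb 0 z hz
  have hpi := Real.pi_pos
  -- the rays have angles at most `ψm < π / 2`, and `arg t + ψ` stays within `3 ε / 8`
  set α := Real.pi + ε / 2 with hα
  have hα2 : α ≤ 2 * Real.pi := by linarith
  have hα0 : 0 < α / 2 := by positivity
  set l := 1 - (3 * ε / 8) / (α / 2) with hl
  have hlα : l * (α / 2) = Real.pi / 2 - ε / 8 := by
    rw [hl, sub_mul, div_mul_cancel₀ _ hα0.ne', hα]; ring
  have hl0 : 0 ≤ l := by
    by_contra hneg
    have : l * (α / 2) < 0 := mul_neg_of_neg_of_pos (not_le.1 hneg) hα0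
    linarith
  set ψm := Real.pi / 2 - ε / 8 with hψm
  have hψm0 : 0 ≤ ψm := by linarith
  set κ := Real.cos ψm
  have hκ0 : 0 < κ := Real.cos_pos_of_mem_Ioo ⟨by linarith, by linarith⟩
  have hcos : ∀ y : ℝ, |y| ≤ ψm → κ ≤ Real.cos y := fun y hy =>
    cos_le_cos_of_abs_le (by rwa [abs_of_nonneg hψm0]) (by rw [abs_of_nonneg hψm0]; linarith)
  set R := κ / 2 / K with hR
  have hRK : ∀ t ∈ sector 0 α R, K * ‖t‖ ≤ κ / 2 := by
    intro t ht
    have := ht.2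
    rw [mem_ball_zero_iff, hR, lt_div_iff₀' hK] at this
    exact this.le
  have hψ : ∀ t ∈ sector 0 α R, |(-(l * Complex.arg t))| ≤ ψm := by
    intro t ht
    have := abs_arg_lt_of_mem_unboundedSector hα2 ht.1
    rw [abs_neg, abs_mul, abs_of_nonneg hl0, ← hlα]
    gcongr
  have hψt : ∀ t ∈ sector 0 α R, |Complex.arg t + (-(l * Complex.arg t))| < ε / 2 := by
    intro t ht
    have := abs_arg_lt_of_mem_unboundedSector hα2 ht.1
    have h1 : Complex.arg t + (-(l * Complex.arg t)) =
        (3 * ε / 8) / (α / 2) * Complex.arg t := by rw [hl]; ring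
    rw [h1, abs_mul, abs_of_nonneg (by positivity)]
    calc _ ≤ (3 * ε / 8) / (α / 2) * (α / 2) := by gcongr
      _ < ε / 2 := by rw [div_mul_cancel₀ _ hα0.ne']; linarith
  refine ⟨α, R, A * (∫ x : ℝ, Real.exp (-(κ / 4) * Real.exp x + β * x)) + 1, 4 / κ * K,
    fun t => laplaceLine β F (-(l * Complex.arg t)) t, by push_cast; linarith, by positivity, ?_,
    by positivity, ?_, fun N t ht => ?_⟩
  · have : 0 ≤ ∫ x : ℝ, Real.exp (-(κ / 4) * Real.exp x + β * x) :=
      integral_nonneg fun x => (Real.exp_pos _).le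
    positivity
  · intro t₀ ht₀
    set ψ₀ := -(l * Complex.arg t₀)
    have hnear : ∀ᶠ t in 𝓝 t₀, t ∈ sector 0 α R ∧ |Complex.arg t + ψ₀| < ε / 2 := by
      have hmem : ∀ᶠ t in 𝓝 t₀, t ∈ sector 0 α R := (isOpen_sector 0 α R).mem_nhds ht₀
      refine hmem.and ?_
      have hc : ContinuousAt (fun t : ℂ => |Complex.arg t + ψ₀|) t₀ :=
        ((Complex.continuousAt_arg (mem_slitPlane_of_mem_unboundedSector hα2 ht₀.1)).add
          continuousAt_const).abs
      exact hc.eventually_lt continuousAt_const (hψt t₀ ht₀)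
    have hd : DifferentiableAt ℂ (laplaceLine β F ψ₀) t₀ := by
      refine differentiableAt_laplaceLine hβ hA.le hκ0 hF hFb0 (hcos _ (hψ t₀ ht₀)) ?_
      filter_upwards [hnear] with t ht
      exact ⟨ne_zero_of_mem_unboundedSector ht.1.1, hRK t ht.1, ht.2⟩
    refine (hd.congr_of_eventuallyEq ?_).differentiableWithinAt
    filter_upwards [hnear] with t ht
    have ht0 := ne_zero_of_mem_unboundedSector ht.1.1
    have hb1 := abs_le.1 (hψ t ht.1)
    have hb2 := abs_le.1 (hψ t₀ ht₀)
    rcases le_total (-(l * Complex.arg t)) ψ₀ with hle | hle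
    · refine laplaceLine_eq hβ hA.le hκ0 hF hFb0 ht0 (hRK t ht.1) hle (hψt t ht.1) ht.2
        fun y hy => hcos y (abs_le.2 ⟨hb1.1.trans hy.1, hy.2.trans hb2.2⟩)
    · refine (laplaceLine_eq hβ hA.le hκ0 hF hFb0 ht0 (hRK t ht.1) hle ht.2 (hψt t ht.1)
        fun y hy => hcos y (abs_le.2 ⟨hb2.1.trans hy.1, hy.2.trans hb1.2⟩)).symm
  · rw [Nat.div_one]
    refine (norm_laplaceLine_sub_le hβ hA.le hK.le hκ0 hF hFb
      (ne_zero_of_mem_unboundedSector ht.1) (hRK t ht) ((hψ t ht).trans_lt (by linarith))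
      (hψt t ht) (hcos _ (hψ t ht)) N).trans ?_
    gcongr
    linarith

end HeatSum
end

noncomputable section
namespace HeatSum

/-! ### Hankel contours -/

open MeasureTheory

lemma integrableOn_Ioi_exp_neg_mul_exp_add {κ : ℝ} (hκ : 0 < κ) (γ x₀ : ℝ) :
    IntegrableOn (fun x : ℝ => Real.exp (-κ * Real.exp x + γ * x)) (Set.Ioi x₀) := by
  set c := |γ| + 1
  have h0 : 0 < γ + c := by
    have := neg_abs_le γ
    linarith
  have h1 := ((integrable_exp_neg_mul_exp_add hκ h0).mul_const
    (Real.exp (-c * x₀))).integrableOn (s := Set.Ioi x₀)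
  refine h1.mono' (by fun_prop) ?_
  refine (ae_restrict_iff' measurableSet_Ioi).2 (Eventually.of_forall fun x hx => ?_)
  rw [Real.norm_of_nonneg (Real.exp_pos _).le, ← Real.exp_add]
  refine Real.exp_le_exp.2 ?_
  have : c * x₀ ≤ c * x := mul_le_mul_of_nonneg_left (le_of_lt hx) (by positivity)
  linarith

/-- The integral of `h` over the contour consisting of the half-line of height `-η` coming from
`+∞`, the vertical segment of abscissa `x₀`, and the half-line of height `η` going to `+∞`. In the
coordinate `p = exp ξ` it is a Hankel contour around the negative real axis. -/
def hankel (η : ℝ) (h : ℂ → ℂ) (x₀ : ℝ) : ℂ :=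
  Complex.I * (∫ y in (-η)..η, h (x₀ + y * Complex.I)) +
    ((∫ x in Set.Ioi x₀, h (x + η * Complex.I)) -
      ∫ x in Set.Ioi x₀, h (x + (-η : ℝ) * Complex.I))

/-- Integrability along the three pieces of a Hankel contour. -/
structure HankelIntegrable (η : ℝ) (h : ℂ → ℂ) (x₀ : ℝ) : Prop where
  arc : IntervalIntegrable (fun y : ℝ => h (x₀ + y * Complex.I)) volume (-η) η
  upper : IntegrableOn (fun x : ℝ => h (x + η * Complex.I)) (Set.Ioi x₀)
  lower : IntegrableOn (fun x : ℝ => h (x + (-η : ℝ) * Complex.I)) (Set.Ioi x₀)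

section

variable {η x₀ x₁ : ℝ} {h h₁ h₂ : ℂ → ℂ}

lemma HankelIntegrable.sub (H₁ : HankelIntegrable η h₁ x₀) (H₂ : HankelIntegrable η h₂ x₀) :
    HankelIntegrable η (fun ξ => h₁ ξ - h₂ ξ) x₀ :=
  ⟨H₁.arc.sub H₂.arc, H₁.upper.sub H₂.upper, H₁.lower.sub H₂.lower⟩

lemma HankelIntegrable.const_mul (H : HankelIntegrable η h x₀) (c : ℂ) :
    HankelIntegrable η (fun ξ => c * h ξ) x₀ :=
  ⟨H.arc.const_mul c, H.upper.const_mul c, H.lower.const_mul c⟩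

lemma HankelIntegrable.add (H₁ : HankelIntegrable η h₁ x₀) (H₂ : HankelIntegrable η h₂ x₀) :
    HankelIntegrable η (fun ξ => h₁ ξ + h₂ ξ) x₀ :=
  ⟨H₁.arc.add H₂.arc, H₁.upper.add H₂.upper, H₁.lower.add H₂.lower⟩

lemma hankel_const_mul (c : ℂ) : hankel η (fun ξ => c * h ξ) x₀ = c * hankel η h x₀ := by
  simp only [hankel, intervalIntegral.integral_const_mul, integral_const_mul]
  ring

lemma hankel_add (H₁ : HankelIntegrable η h₁ x₀) (H₂ : HankelIntegrable η h₂ x₀) :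
    hankel η (fun ξ => h₁ ξ + h₂ ξ) x₀ = hankel η h₁ x₀ + hankel η h₂ x₀ := by
  simp only [hankel]
  rw [intervalIntegral.integral_add H₁.arc H₂.arc, integral_add H₁.upper H₂.upper,
    integral_add H₁.lower H₂.lower]
  ring

lemma hankel_sub (H₁ : HankelIntegrable η h₁ x₀) (H₂ : HankelIntegrable η h₂ x₀) :
    hankel η (fun ξ => h₁ ξ - h₂ ξ) x₀ = hankel η h₁ x₀ - hankel η h₂ x₀ := by
  simp only [hankel]
  rw [intervalIntegral.integral_sub H₁.arc H₂.arc, integral_sub H₁.upper H₂.upper,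
    integral_sub H₁.lower H₂.lower]
  ring

lemma hankelIntegrable_sum {H : ℕ → ℂ → ℂ} (hH : ∀ n, HankelIntegrable η (H n) x₀) (N : ℕ) :
    HankelIntegrable η (fun ξ => ∑ n ∈ Finset.range N, H n ξ) x₀ ∧
      hankel η (fun ξ => ∑ n ∈ Finset.range N, H n ξ) x₀ =
        ∑ n ∈ Finset.range N, hankel η (H n) x₀ := by
  induction N with
  | zero =>
    simp only [Finset.range_zero, Finset.sum_empty]
    exact ⟨⟨by simp, by simp, by simp⟩, by simp [hankel]⟩
  | succ N ih =>
    simp only [Finset.sum_range_succ]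
    exact ⟨ih.1.add (hH N), by rw [hankel_add ih.1 (hH N), ih.2]⟩

/-- The abscissa of the vertical segment of a Hankel contour may be changed. -/
lemma hankel_eq_of_le (hη : 0 ≤ η) (h01 : x₀ ≤ x₁)
    (hd : DifferentiableOn ℂ h {ξ | x₀ ≤ ξ.re ∧ |ξ.im| ≤ η})
    (hu : IntegrableOn (fun x : ℝ => h (x + η * Complex.I)) (Set.Ioi x₀))
    (hl : IntegrableOn (fun x : ℝ => h (x + (-η : ℝ) * Complex.I)) (Set.Ioi x₀)) :
    hankel η h x₀ = hankel η h x₁ := by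
  have hsub : Set.Ioi x₁ ⊆ Set.Ioi x₀ := Set.Ioi_subset_Ioi h01
  have e1 := intervalIntegral.integral_interval_add_Ioi hu (hu.mono_set hsub)
  have e2 := intervalIntegral.integral_interval_add_Ioi hl (hl.mono_set hsub)
  have hrect := Complex.integral_boundary_rect_eq_zero_of_differentiableOn h
    ((x₀ : ℝ) + (-η : ℝ) * Complex.I) ((x₁ : ℝ) + η * Complex.I) (hd.mono ?_)
  · simp only [Complex.add_re, Complex.ofReal_re, Complex.mul_re, Complex.I_re, mul_zero,
      Complex.ofReal_im, Complex.I_im, mul_one, sub_self, add_zero, Complex.add_im,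
      Complex.mul_im, zero_add, smul_eq_mul] at hrect
    rw [hankel, hankel, ← e1, ← e2]
    linear_combination -hrect
  · intro ξ hξ
    rw [Complex.mem_reProdIm] at hξ
    simp only [Complex.add_re, Complex.ofReal_re, Complex.mul_re, Complex.I_re, mul_zero,
      Complex.ofReal_im, Complex.I_im, mul_one, sub_self, add_zero, Complex.add_im,
      Complex.mul_im, zero_add, Set.uIcc_of_le h01, Set.uIcc_of_le (neg_le_self hη)] at hξ
    exact ⟨hξ.1.1, abs_le.2 hξ.2⟩

lemma norm_hankel_le (hη : 0 ≤ η) {A : ℝ} {M : ℝ → ℝ}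
    (harc : ∀ y : ℝ, |y| ≤ η → ‖h (x₀ + y * Complex.I)‖ ≤ A)
    (hu : ∀ x : ℝ, x₀ < x → ‖h (x + η * Complex.I)‖ ≤ M x)
    (hl : ∀ x : ℝ, x₀ < x → ‖h (x + (-η : ℝ) * Complex.I)‖ ≤ M x)
    (hM : IntegrableOn M (Set.Ioi x₀)) :
    ‖hankel η h x₀‖ ≤ 2 * η * A + 2 * ∫ x in Set.Ioi x₀, M x := by
  have h1 : ‖∫ y in (-η)..η, h (x₀ + y * Complex.I)‖ ≤ A * |η - (-η)| := by
    refine intervalIntegral.norm_integral_le_of_norm_le_const fun y hy => harc y ?_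
    rw [Set.uIoc_of_le (neg_le_self hη)] at hy
    exact abs_le.2 ⟨hy.1.le, hy.2⟩
  rw [show η - -η = 2 * η by ring, abs_of_nonneg (by positivity)] at h1
  have h2 := norm_integral_le_of_norm_le hM
    ((ae_restrict_iff' measurableSet_Ioi).2 (Eventually.of_forall hu))
  have h3 := norm_integral_le_of_norm_le hM
    ((ae_restrict_iff' measurableSet_Ioi).2 (Eventually.of_forall hl))
  refine (norm_add_le _ _).trans ?_
  rw [norm_mul, Complex.norm_I, one_mul]
  have h4 := norm_sub_le (∫ x in Set.Ioi x₀, h (x + η * Complex.I))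
    (∫ x in Set.Ioi x₀, h (x + (-η : ℝ) * Complex.I))
  linarith

/-- The integral of a derivative over a Hankel contour vanishes. -/
lemma hankel_deriv_eq_zero {Φ : ℂ → ℂ} (hΦ : ∀ ξ, HasDerivAt Φ (h ξ) ξ)
    (H : HankelIntegrable η h x₀)
    (hu : Tendsto (fun x : ℝ => Φ (x + η * Complex.I)) atTop (𝓝 0))
    (hl : Tendsto (fun x : ℝ => Φ (x + (-η : ℝ) * Complex.I)) atTop (𝓝 0)) :
    hankel η h x₀ = 0 := by
  have hx : ∀ y x : ℝ, HasDerivAt (fun x : ℝ => Φ (x + y * Complex.I)) (h (x + y * Complex.I)) x := by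
    intro y x
    have h1 : HasDerivAt (fun x : ℝ => (x : ℂ) + y * Complex.I) 1 x :=
      (Complex.ofRealCLM.hasDerivAt (x := x)).add_const _
    exact ((hΦ _).comp x h1).congr_deriv (mul_one _)
  have hy : ∀ y : ℝ, HasDerivAt (fun y : ℝ => Φ (x₀ + y * Complex.I))
      (Complex.I * h (x₀ + y * Complex.I)) y := by
    intro y
    have h1 : HasDerivAt (fun y : ℝ => (x₀ : ℂ) + y * Complex.I) Complex.I y := by
      simpa using ((Complex.ofRealCLM.hasDerivAt (x := y)).mul_const Complex.I).const_add (x₀ : ℂ)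
    exact ((hΦ _).comp y h1).congr_deriv (mul_comm _ _)
  have e1 := intervalIntegral.integral_eq_sub_of_hasDerivAt (fun y _ => hy y)
    (H.arc.const_mul Complex.I)
  rw [intervalIntegral.integral_const_mul] at e1
  have e2 := integral_Ioi_of_hasDerivAt_of_tendsto' (fun x _ => hx η x) H.upper hu
  have e3 := integral_Ioi_of_hasDerivAt_of_tendsto' (fun x _ => hx (-η) x) H.lower hl
  rw [hankel, e1, e2, e3]
  ring

end

/-! ### The Hankel integral of monomials -/

/-- The kernel `exp (w p) p ^ γ` of the Borel transform, in the coordinate `p = exp ξ`. -/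
def borelKernel (w : ℂ) (γ : ℝ) (ξ : ℂ) : ℂ := Complex.exp (w * Complex.exp ξ + γ * ξ)

lemma differentiable_borelKernel (w : ℂ) (γ : ℝ) : Differentiable ℂ (borelKernel w γ) := by
  unfold borelKernel
  fun_prop

lemma norm_borelKernel_le (w : ℂ) (γ x y : ℝ) :
    ‖borelKernel w γ (x + y * Complex.I)‖ ≤ Real.exp (‖w‖ * Real.exp x + γ * x) := by
  rw [borelKernel, Complex.norm_exp]
  refine Real.exp_le_exp.2 ?_
  have h1 : (w * Complex.exp (x + y * Complex.I)).re ≤ ‖w‖ * Real.exp x := by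
    refine (Complex.re_le_norm _).trans (le_of_eq ?_)
    rw [norm_mul_exp_add_mul_I]
  simpa using h1

section Rays

variable {δ : ℝ}

lemma cos_le_neg_sin {u : ℝ} (hδ : 0 < δ) (hδ4 : δ ≤ Real.pi / 4) (hu : |u| < δ / 2) :
    Real.cos (u + (Real.pi / 2 + δ)) ≤ -Real.sin (δ / 2) ∧
      Real.cos (u + -(Real.pi / 2 + δ)) ≤ -Real.sin (δ / 2) := by
  have hpi := Real.pi_pos
  rw [abs_lt] at hu
  constructor
  · rw [show u + (Real.pi / 2 + δ) = (u + δ) + Real.pi / 2 by ring, Real.cos_add_pi_div_two,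
      neg_le_neg_iff]
    exact Real.sin_le_sin_of_le_of_le_pi_div_two (by linarith) (by linarith) (by linarith)
  · rw [show u + -(Real.pi / 2 + δ) = -((-u + δ) + Real.pi / 2) by ring, Real.cos_neg,
      Real.cos_add_pi_div_two, neg_le_neg_iff]
    exact Real.sin_le_sin_of_le_of_le_pi_div_two (by linarith) (by linarith) (by linarith)

/-- Decay of the kernel on the two half-lines of the contour. -/
lemma norm_borelKernel_ray_le (hδ : 0 < δ) (hδ4 : δ ≤ Real.pi / 4) {w : ℂ}
    (hw : w ∈ unboundedSector 0 δ) (γ x : ℝ) :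
    ‖borelKernel w γ (x + (Real.pi / 2 + δ : ℝ) * Complex.I)‖ ≤
        Real.exp (-(Real.sin (δ / 2) * ‖w‖) * Real.exp x + γ * x) ∧
      ‖borelKernel w γ (x + (-(Real.pi / 2 + δ) : ℝ) * Complex.I)‖ ≤
        Real.exp (-(Real.sin (δ / 2) * ‖w‖) * Real.exp x + γ * x) := by
  obtain ⟨ω, hω, rfl⟩ := mem_unboundedSector_iff.1 hw
  rw [sub_zero] at hω
  obtain ⟨h1, h2⟩ := cos_le_neg_sin hδ hδ4 hω
  have key : ∀ y : ℝ, Real.cos (ω.im + y) ≤ -Real.sin (δ / 2) →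
      ‖borelKernel (Complex.exp ω) γ (x + y * Complex.I)‖ ≤
        Real.exp (-(Real.sin (δ / 2) * ‖Complex.exp ω‖) * Real.exp x + γ * x) := by
    intro y hy
    rw [borelKernel, Complex.norm_exp, ← Complex.exp_add, Complex.norm_exp]
    refine Real.exp_le_exp.2 ?_
    have e1 : (Complex.exp (ω + (x + y * Complex.I)) + γ * (x + y * Complex.I)).re =
        Real.exp ω.re * Real.exp x * Real.cos (ω.im + y) + γ * x := by
      rw [Complex.add_re, Complex.exp_re, ← Real.exp_add]
      simp
    rw [e1]
    have := mul_le_mul_of_nonneg_left hy (by positivity : 0 ≤ Real.exp ω.re * Real.exp x)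
    linarith
  exact ⟨key _ h1, key _ h2⟩

lemma sin_half_mul_norm_pos (hδ : 0 < δ) (hδ4 : δ ≤ Real.pi / 4) {w : ℂ}
    (hw : w ∈ unboundedSector 0 δ) : 0 < Real.sin (δ / 2) * ‖w‖ :=
  mul_pos (Real.sin_pos_of_pos_of_lt_pi (by linarith) (by linarith [Real.pi_pos]))
    (norm_pos_iff.2 (ne_zero_of_mem_unboundedSector hw))

lemma hankelIntegrable_borelKernel (hδ : 0 < δ) (hδ4 : δ ≤ Real.pi / 4) {w : ℂ}
    (hw : w ∈ unboundedSector 0 δ) (γ x₀ : ℝ) :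
    HankelIntegrable (Real.pi / 2 + δ) (borelKernel w γ) x₀ := by
  have hc := (differentiable_borelKernel w γ).continuous
  have hI := integrableOn_Ioi_exp_neg_mul_exp_add (sin_half_mul_norm_pos hδ hδ4 hw) γ x₀
  refine ⟨(hc.comp (by fun_prop)).intervalIntegrable _ _,
    hI.mono' (hc.comp (by fun_prop)).aestronglyMeasurable ?_,
    hI.mono' (hc.comp (by fun_prop)).aestronglyMeasurable ?_⟩
  · exact Eventually.of_forall fun x => (norm_borelKernel_ray_le hδ hδ4 hw γ x).1
  · exact Eventually.of_forall fun x => (norm_borelKernel_ray_le hδ hδ4 hw γ x).2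

lemma integral_borelKernel_half {ω : ℂ} {y ψ c : ℝ} (hψ : |ψ| < Real.pi / 2)
    (hy : ω.im + y = ψ + c) (hc : Complex.exp (c * Complex.I) = -1) :
    ∫ x : ℝ, borelKernel (Complex.exp ω) (1 / 2) (x + y * Complex.I) =
      Complex.exp (-ω / 2) * Complex.exp (c * Complex.I / 2) * Real.Gamma (1 / 2) := by
  have h1 : ∀ x : ℝ, borelKernel (Complex.exp ω) (1 / 2) (x + y * Complex.I) =
      Complex.exp (-ω / 2) * Complex.exp (c * Complex.I / 2) *
        gammaKernel (1 / 2) (((x + ω.re : ℝ) : ℂ) + ψ * Complex.I) := by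
    intro x
    have hω : ω = ω.re + ω.im * Complex.I := (Complex.re_add_im ω).symm
    have hyc : (ω.im : ℂ) + y = ψ + c := by exact_mod_cast hy
    have e1 : ω + (x + y * Complex.I) = (((x + ω.re : ℝ) : ℂ) + ψ * Complex.I) + c * Complex.I := by
      push_cast
      linear_combination hω + Complex.I * hyc
    have e2 : Complex.exp ω * Complex.exp (x + y * Complex.I) =
        -Complex.exp (((x + ω.re : ℝ) : ℂ) + ψ * Complex.I) := by
      rw [← Complex.exp_add, e1, Complex.exp_add, hc, mul_neg_one]
    rw [borelKernel, gammaKernel, e2, ← Complex.exp_add, ← Complex.exp_add]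
    congr 1
    push_cast
    push_cast at e1
    linear_combination e1 / 2
  simp only [h1]
  rw [integral_const_mul, integral_add_right_eq_self
    (fun x : ℝ => gammaKernel (1 / 2) ((x : ℂ) + ψ * Complex.I)),
    integral_gammaKernel one_half_pos hψ]

/-- Hankel's formula for `p ^ (-1 / 2)`: the vertical segment is pushed to `-∞`. -/
lemma hankel_borelKernel_half (hδ : 0 < δ) (hδ4 : δ ≤ Real.pi / 4) {w : ℂ}
    (hw : w ∈ unboundedSector 0 δ) (x₀ : ℝ) :
    hankel (Real.pi / 2 + δ) (borelKernel w (1 / 2)) x₀ =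
      2 * Real.pi * Complex.I / Real.Gamma (1 / 2) * Complex.exp (-Complex.log w / 2) := by
  have hpi := Real.pi_pos
  set η := Real.pi / 2 + δ with hη
  have hc := (differentiable_borelKernel w (1 / 2)).continuous
  have hconst : ∀ x : ℝ, hankel η (borelKernel w (1 / 2)) x = hankel η (borelKernel w (1 / 2)) x₀ := by
    have key : ∀ a b : ℝ, a ≤ b →
        hankel η (borelKernel w (1 / 2)) a = hankel η (borelKernel w (1 / 2)) b := fun a b hab =>
      hankel_eq_of_le (by linarith) hab (differentiable_borelKernel w _).differentiableOn
        (hankelIntegrable_borelKernel hδ hδ4 hw _ _).upper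
        (hankelIntegrable_borelKernel hδ hδ4 hw _ _).lower
    intro x
    rcases le_total x x₀ with h | h
    exacts [key _ _ h, (key _ _ h).symm]
  have hI := integrable_exp_neg_mul_exp_add (sin_half_mul_norm_pos hδ hδ4 hw) one_half_pos
  have hu : Integrable fun x : ℝ => borelKernel w (1 / 2) (x + η * Complex.I) :=
    hI.mono' (hc.comp (by fun_prop)).aestronglyMeasurable
      (Eventually.of_forall fun x => (norm_borelKernel_ray_le hδ hδ4 hw _ x).1)
  have hl : Integrable fun x : ℝ => borelKernel w (1 / 2) (x + (-η : ℝ) * Complex.I) :=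
    hI.mono' (hc.comp (by fun_prop)).aestronglyMeasurable
      (Eventually.of_forall fun x => (norm_borelKernel_ray_le hδ hδ4 hw _ x).2)
  have hcover : AECover volume atBot fun x : ℝ => Set.Ioi x := aecover_Ioi tendsto_id
  have hlim : Tendsto (fun x : ℝ => hankel η (borelKernel w (1 / 2)) x) atBot
      (𝓝 (Complex.I * 0 + ((∫ x : ℝ, borelKernel w (1 / 2) (x + η * Complex.I)) -
        ∫ x : ℝ, borelKernel w (1 / 2) (x + (-η : ℝ) * Complex.I)))) := by
    refine Tendsto.add (Tendsto.const_mul _ ?_)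
      ((hcover.integral_tendsto_of_countably_generated hu).sub
        (hcover.integral_tendsto_of_countably_generated hl))
    refine squeeze_zero_norm (a := fun x : ℝ =>
      Real.exp (‖w‖ * Real.exp x + 1 / 2 * x) * |η - -η|) (fun x =>
        intervalIntegral.norm_integral_le_of_norm_le_const fun y _ =>
          norm_borelKernel_le w (1 / 2) x y) ?_
    have h1 : Tendsto (fun x : ℝ => Real.exp (‖w‖ * Real.exp x) * Real.exp (1 / 2 * x)) atBot
        (𝓝 (Real.exp (‖w‖ * 0) * 0)) :=
      ((Real.continuous_exp.tendsto _).comp (Real.tendsto_exp_atBot.const_mul _)).mul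
        (Real.tendsto_exp_atBot.comp (tendsto_id.const_mul_atBot one_half_pos))
    simp only [← Real.exp_add, mul_zero] at h1
    simpa using h1.mul_const |η - -η|
  simp only [hconst] at hlim
  have heq := tendsto_nhds_unique hlim tendsto_const_nhds
  have hw0 := ne_zero_of_mem_unboundedSector hw
  have harg : |(Complex.log w).im| < δ / 2 := by
    rw [Complex.log_im]
    exact abs_arg_lt_of_mem_unboundedSector (by linarith) hw
  rw [abs_lt] at harg
  have e1 := integral_borelKernel_half (ω := Complex.log w) (y := η)
    (ψ := (Complex.log w).im + η - Real.pi) (c := Real.pi)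
    (by rw [abs_lt, hη]; constructor <;> linarith) (by ring) (by exact Complex.exp_pi_mul_I)
  have e2 := integral_borelKernel_half (ω := Complex.log w) (y := -η)
    (ψ := (Complex.log w).im - η + Real.pi) (c := -Real.pi)
    (by rw [abs_lt, hη]; constructor <;> linarith) (by ring)
    (by push_cast; rw [neg_mul, Complex.exp_neg, Complex.exp_pi_mul_I]; norm_num)
  rw [Complex.exp_log hw0] at e1 e2
  have i1 : Complex.exp ((Real.pi : ℂ) * Complex.I / 2) = Complex.I := by
    rw [show (Real.pi : ℂ) * Complex.I / 2 = Real.pi / 2 * Complex.I by ring,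
      Complex.exp_pi_div_two_mul_I]
  have i2 : Complex.exp (((-Real.pi : ℝ) : ℂ) * Complex.I / 2) = -Complex.I := by
    rw [show ((-Real.pi : ℝ) : ℂ) * Complex.I / 2 = -(Real.pi * Complex.I / 2) by push_cast; ring,
      Complex.exp_neg, i1, Complex.inv_I]
  rw [← heq, e1, e2, i1, i2]
  have hG : (Real.Gamma (1 / 2) : ℂ) ^ 2 = Real.pi := by
    rw [Real.Gamma_one_half_eq, ← Complex.ofReal_pow, Real.sq_sqrt hpi.le]
  have hG0 : (Real.Gamma (1 / 2) : ℂ) ≠ 0 :=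
    Complex.ofReal_ne_zero.2 (Real.Gamma_pos_of_pos one_half_pos).ne'
  field_simp
  linear_combination (2 * Complex.exp (-(Complex.log w / 2))) * hG

/-- Hankel's formula for `1 / Γ (m + 1 / 2)`. -/
theorem hankel_borelKernel (hδ : 0 < δ) (hδ4 : δ ≤ Real.pi / 4) {w : ℂ}
    (hw : w ∈ unboundedSector 0 δ) (m : ℕ) (x₀ : ℝ) :
    hankel (Real.pi / 2 + δ) (borelKernel w (1 / 2 - m)) x₀ =
      2 * Real.pi * Complex.I / Real.Gamma (m + 1 / 2) *
        Complex.exp ((m - 1 / 2) * Complex.log w) := by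
  have hw0 := ne_zero_of_mem_unboundedSector hw
  induction m with
  | zero =>
    have := hankel_borelKernel_half hδ hδ4 hw x₀
    simp only [Nat.cast_zero, sub_zero, zero_add, zero_sub]
    rw [this]
    ring_nf
  | succ m ih =>
    have hder : ∀ ξ, HasDerivAt (borelKernel w (1 / 2 - (m + 1 : ℕ)))
        (w * borelKernel w (1 / 2 - m) ξ + -(m + 1 / 2) * borelKernel w (1 / 2 - (m + 1 : ℕ)) ξ)
        ξ := by
      intro ξ
      have h1 : HasDerivAt (fun ξ : ℂ => w * Complex.exp ξ + ((1 / 2 - (m + 1 : ℕ) : ℝ) : ℂ) * ξ)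
          (w * Complex.exp ξ + ((1 / 2 - (m + 1 : ℕ) : ℝ) : ℂ) * 1) ξ :=
        ((Complex.hasDerivAt_exp ξ).const_mul w).add ((hasDerivAt_id ξ).const_mul _)
      refine h1.cexp.congr_deriv ?_
      have h2 : borelKernel w (1 / 2 - m) ξ =
          Complex.exp ξ * borelKernel w (1 / 2 - (m + 1 : ℕ)) ξ := by
        rw [borelKernel, borelKernel, ← Complex.exp_add]
        push_cast
        ring_nf
      rw [h2, borelKernel]
      push_cast
      ring
    have hI := fun γ => hankelIntegrable_borelKernel hδ hδ4 hw γ x₀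
    have hdec := tendsto_exp_neg_mul_exp_add_atTop (sin_half_mul_norm_pos hδ hδ4 hw)
      (1 / 2 - (m + 1 : ℕ))
    have hzero := hankel_deriv_eq_zero hder
      (((hI (1 / 2 - m)).const_mul w).add ((hI (1 / 2 - (m + 1 : ℕ))).const_mul _))
      (squeeze_zero_norm (fun x => (norm_borelKernel_ray_le hδ hδ4 hw _ x).1) hdec)
      (squeeze_zero_norm (fun x => (norm_borelKernel_ray_le hδ hδ4 hw _ x).2) hdec)
    rw [hankel_add ((hI (1 / 2 - m)).const_mul w) ((hI (1 / 2 - (m + 1 : ℕ))).const_mul _),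
      hankel_const_mul, hankel_const_mul, ih] at hzero
    have hm : (m : ℝ) + 1 / 2 ≠ 0 := by positivity
    have hmC : (m : ℂ) + 1 / 2 ≠ 0 := by
      have := Complex.ofReal_ne_zero.2 hm
      push_cast at this
      exact this
    have hG : Real.Gamma ((m + 1 : ℕ) + 1 / 2) = (m + 1 / 2) * Real.Gamma (m + 1 / 2) := by
      rw [← Real.Gamma_add_one hm]
      push_cast
      ring_nf
    have hG0 : (Real.Gamma (m + 1 / 2) : ℂ) ≠ 0 :=
      Complex.ofReal_ne_zero.2 (Real.Gamma_pos_of_pos (by positivity)).ne'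
    have hE : Complex.exp ((((m + 1 : ℕ) : ℂ) - 1 / 2) * Complex.log w) =
        w * Complex.exp ((m - 1 / 2) * Complex.log w) := by
      rw [show (((m + 1 : ℕ) : ℂ) - 1 / 2) * Complex.log w =
        Complex.log w + (m - 1 / 2) * Complex.log w by push_cast; ring, Complex.exp_add,
        Complex.exp_log hw0]
    refine mul_left_cancel₀ hmC (Eq.trans ?_ (b := w * (2 * Real.pi * Complex.I /
      Real.Gamma (m + 1 / 2) * Complex.exp ((m - 1 / 2) * Complex.log w))) ?_)
    · linear_combination -hzero
    · rw [hE, hG, Complex.ofReal_mul,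
        show ((m + 1 / 2 : ℝ) : ℂ) = (m : ℂ) + 1 / 2 by push_cast; rfl]
      generalize (m : ℂ) + 1 / 2 = q at *
      generalize (Real.Gamma (m + 1 / 2) : ℂ) = G at *
      field_simp

end Rays

end HeatSum
end

noncomputable section
namespace HeatSum

/-! ### The Borel transform: from Gevrey expansions to continuation -/

open MeasureTheory

section Borel

variable {δ γ x₀ D : ℝ} {T : ℂ → ℂ}

lemma norm_borelKernel_mul_ray_le (hδ : 0 < δ) (hδ4 : δ ≤ Real.pi / 4)
    (hTb : ∀ ξ : ℂ, x₀ ≤ ξ.re → |ξ.im| ≤ Real.pi / 2 + δ → ‖T ξ‖ ≤ D) {w : ℂ}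
    (hw : w ∈ unboundedSector 0 δ) {x : ℝ} (hx : x₀ < x) :
    ‖borelKernel w γ (x + (Real.pi / 2 + δ : ℝ) * Complex.I) *
        T (x + (Real.pi / 2 + δ : ℝ) * Complex.I)‖ ≤
        Real.exp (-(Real.sin (δ / 2) * ‖w‖) * Real.exp x + γ * x) * D ∧
      ‖borelKernel w γ (x + (-(Real.pi / 2 + δ) : ℝ) * Complex.I) *
        T (x + (-(Real.pi / 2 + δ) : ℝ) * Complex.I)‖ ≤
        Real.exp (-(Real.sin (δ / 2) * ‖w‖) * Real.exp x + γ * x) * D := by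
  have hη : 0 ≤ Real.pi / 2 + δ := by linarith [Real.pi_pos]
  obtain ⟨h1, h2⟩ := norm_borelKernel_ray_le hδ hδ4 hw γ x
  rw [norm_mul, norm_mul]
  refine ⟨mul_le_mul h1 (hTb _ ?_ ?_) (norm_nonneg _) (Real.exp_pos _).le,
    mul_le_mul h2 (hTb _ ?_ ?_) (norm_nonneg _) (Real.exp_pos _).le⟩
  · simpa using hx.le
  · simp [abs_of_nonneg hη]
  · simpa using hx.le
  · rw [show ((x : ℂ) + (-(Real.pi / 2 + δ) : ℝ) * Complex.I).im = -(Real.pi / 2 + δ) by simp,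
      abs_neg, abs_of_nonneg hη]

lemma norm_borelKernel_mul_arc_le
    (hTb : ∀ ξ : ℂ, x₀ ≤ ξ.re → |ξ.im| ≤ Real.pi / 2 + δ → ‖T ξ‖ ≤ D) (w : ℂ) {y : ℝ}
    (hy : |y| ≤ Real.pi / 2 + δ) :
    ‖borelKernel w γ (x₀ + y * Complex.I) * T (x₀ + y * Complex.I)‖ ≤
      Real.exp (‖w‖ * Real.exp x₀ + γ * x₀) * D := by
  rw [norm_mul]
  exact mul_le_mul (norm_borelKernel_le _ _ _ _) (hTb _ (by simp) (by simpa using hy))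
    (norm_nonneg _) (Real.exp_pos _).le

lemma continuousOn_borelKernel_mul
    (hT : ContinuousOn T {ξ | x₀ ≤ ξ.re ∧ |ξ.im| ≤ Real.pi / 2 + δ}) (hδ : 0 < δ) (w : ℂ) :
    ContinuousOn (fun y : ℝ => borelKernel w γ (x₀ + y * Complex.I) * T (x₀ + y * Complex.I))
        (Set.Icc (-(Real.pi / 2 + δ)) (Real.pi / 2 + δ)) ∧
      ContinuousOn (fun x : ℝ => borelKernel w γ (x + (Real.pi / 2 + δ : ℝ) * Complex.I) *
        T (x + (Real.pi / 2 + δ : ℝ) * Complex.I)) (Set.Ioi x₀) ∧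
      ContinuousOn (fun x : ℝ => borelKernel w γ (x + (-(Real.pi / 2 + δ) : ℝ) * Complex.I) *
        T (x + (-(Real.pi / 2 + δ) : ℝ) * Complex.I)) (Set.Ioi x₀) := by
  have hη : 0 ≤ Real.pi / 2 + δ := by linarith [Real.pi_pos]
  have hc := ((differentiable_borelKernel w γ).continuous.continuousOn).mul hT
  refine ⟨hc.comp (by fun_prop) fun y hy => ?_, hc.comp (by fun_prop) fun x hx => ?_,
    hc.comp (by fun_prop) fun x hx => ?_⟩
  · exact ⟨by simp, by simpa using abs_le.2 hy⟩
  · exact ⟨by simpa using le_of_lt hx, by simp [abs_of_nonneg hη]⟩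
  · refine ⟨by simpa using le_of_lt hx, ?_⟩
    rw [show ((x : ℂ) + (-(Real.pi / 2 + δ) : ℝ) * Complex.I).im = -(Real.pi / 2 + δ) by simp,
      abs_neg, abs_of_nonneg hη]

lemma hankelIntegrable_borelKernel_mul (hδ : 0 < δ) (hδ4 : δ ≤ Real.pi / 4)
    (hT : ContinuousOn T {ξ | x₀ ≤ ξ.re ∧ |ξ.im| ≤ Real.pi / 2 + δ})
    (hTb : ∀ ξ : ℂ, x₀ ≤ ξ.re → |ξ.im| ≤ Real.pi / 2 + δ → ‖T ξ‖ ≤ D) {w : ℂ}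
    (hw : w ∈ unboundedSector 0 δ) :
    HankelIntegrable (Real.pi / 2 + δ) (fun ξ => borelKernel w γ ξ * T ξ) x₀ := by
  have hη : 0 ≤ Real.pi / 2 + δ := by linarith [Real.pi_pos]
  obtain ⟨c1, c2, c3⟩ := continuousOn_borelKernel_mul (γ := γ) hT hδ w
  have hI := (integrableOn_Ioi_exp_neg_mul_exp_add (sin_half_mul_norm_pos hδ hδ4 hw) γ x₀).mul_const
    D
  refine ⟨ContinuousOn.intervalIntegrable_of_Icc (neg_le_self hη) c1,
    hI.mono' (c2.aestronglyMeasurable measurableSet_Ioi) ?_,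
    hI.mono' (c3.aestronglyMeasurable measurableSet_Ioi) ?_⟩
  · exact (ae_restrict_iff' measurableSet_Ioi).2 (Eventually.of_forall fun x hx =>
      (norm_borelKernel_mul_ray_le hδ hδ4 hTb hw hx).1)
  · exact (ae_restrict_iff' measurableSet_Ioi).2 (Eventually.of_forall fun x hx =>
      (norm_borelKernel_mul_ray_le hδ hδ4 hTb hw hx).2)

lemma norm_hankel_borelKernel_mul_le (hδ : 0 < δ) (hδ4 : δ ≤ Real.pi / 4)
    (hTb : ∀ ξ : ℂ, x₀ ≤ ξ.re → |ξ.im| ≤ Real.pi / 2 + δ → ‖T ξ‖ ≤ D) {w : ℂ}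
    (hw : w ∈ unboundedSector 0 δ) :
    ‖hankel (Real.pi / 2 + δ) (fun ξ => borelKernel w γ ξ * T ξ) x₀‖ ≤
      2 * (Real.pi / 2 + δ) * (Real.exp (‖w‖ * Real.exp x₀ + γ * x₀) * D) +
        2 * ((∫ x in Set.Ioi x₀,
          Real.exp (-(Real.sin (δ / 2) * ‖w‖) * Real.exp x + γ * x)) * D) := by
  rw [← integral_mul_const]
  exact norm_hankel_le (by linarith [Real.pi_pos])
    (fun y hy => norm_borelKernel_mul_arc_le hTb w hy)
    (fun x hx => (norm_borelKernel_mul_ray_le hδ hδ4 hTb hw hx).1)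
    (fun x hx => (norm_borelKernel_mul_ray_le hδ hδ4 hTb hw hx).2)
    ((integrableOn_Ioi_exp_neg_mul_exp_add (sin_half_mul_norm_pos hδ hδ4 hw) γ x₀).mul_const D)

lemma differentiable_borelKernel_left (γ : ℝ) (ξ : ℂ) :
    Differentiable ℂ fun w => borelKernel w γ ξ := by
  unfold borelKernel
  fun_prop

lemma differentiableOn_hankel_borelKernel_mul (hδ : 0 < δ) (hδ4 : δ ≤ Real.pi / 4)
    (hT : ContinuousOn T {ξ | x₀ ≤ ξ.re ∧ |ξ.im| ≤ Real.pi / 2 + δ})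
    (hTb : ∀ ξ : ℂ, x₀ ≤ ξ.re → |ξ.im| ≤ Real.pi / 2 + δ → ‖T ξ‖ ≤ D) :
    DifferentiableOn ℂ (fun w => hankel (Real.pi / 2 + δ) (fun ξ => borelKernel w γ ξ * T ξ) x₀)
      (unboundedSector 0 δ) := by
  intro w₀ hw₀
  have hη : 0 ≤ Real.pi / 2 + δ := by linarith [Real.pi_pos]
  have hw₀0 : 0 < ‖w₀‖ := norm_pos_iff.2 (ne_zero_of_mem_unboundedSector hw₀)
  have hsin : 0 < Real.sin (δ / 2) :=
    Real.sin_pos_of_pos_of_lt_pi (by linarith) (by linarith [Real.pi_pos])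
  have hD : 0 ≤ D := (norm_nonneg _).trans (hTb x₀ (by simp) (by simpa using hη))
  have hnear : ∀ᶠ w in 𝓝 w₀, w ∈ unboundedSector 0 δ ∧ ‖w₀‖ / 2 ≤ ‖w‖ ∧ ‖w‖ ≤ 2 * ‖w₀‖ := by
    have h1 : ∀ᶠ w in 𝓝 w₀, w ∈ unboundedSector 0 δ := (isOpen_unboundedSector 0 δ).mem_nhds hw₀
    have h2 : ∀ᶠ w in 𝓝 w₀, ‖w₀‖ / 2 ≤ ‖w‖ :=
      (continuous_norm.continuousAt.eventually_const_lt (half_lt_self hw₀0)).mono fun _ h => h.le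
    have h3 : ∀ᶠ w in 𝓝 w₀, ‖w‖ ≤ 2 * ‖w₀‖ :=
      (continuous_norm.continuousAt.eventually_lt_const (by linarith : ‖w₀‖ < 2 * ‖w₀‖)).mono
        fun _ h => h.le
    exact h1.and (h2.and h3)
  obtain ⟨ρ, hρ, hball⟩ := Metric.eventually_nhds_iff_ball.1 hnear
  have hI := (integrableOn_Ioi_exp_neg_mul_exp_add
    (mul_pos hsin (half_pos hw₀0)) γ x₀).mul_const D
  have hray : ∀ w ∈ Metric.ball w₀ ρ, ∀ x : ℝ,
      Real.exp (-(Real.sin (δ / 2) * ‖w‖) * Real.exp x + γ * x) * D ≤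
        Real.exp (-(Real.sin (δ / 2) * (‖w₀‖ / 2)) * Real.exp x + γ * x) * D := by
    intro w hw x
    have := (hball w hw).2.1
    gcongr
  refine DifferentiableAt.differentiableWithinAt ?_
  simp only [hankel, intervalIntegral.integral_of_le (neg_le_self hη)]
  refine ((DifferentiableAt.const_mul ?_ _).add (DifferentiableAt.sub ?_ ?_))
  · refine differentiableAt_integral_of_dominated hρ
      (bound := fun _ => Real.exp (2 * ‖w₀‖ * Real.exp x₀ + γ * x₀) * D)
      (fun w hw => ((continuousOn_borelKernel_mul hT hδ w).1.mono
        Set.Ioc_subset_Icc_self).aestronglyMeasurable measurableSet_Ioc)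
      ?_ (integrable_const _) (Eventually.of_forall fun y =>
        ((differentiable_borelKernel_left γ _).mul_const _).differentiableOn)
    refine (ae_restrict_iff' measurableSet_Ioc).2 (Eventually.of_forall fun y hy w hw => ?_)
    refine (norm_borelKernel_mul_arc_le hTb w (abs_le.2 ⟨hy.1.le, hy.2⟩)).trans ?_
    have := (hball w hw).2.2
    gcongr
  · refine differentiableAt_integral_of_dominated hρ
      (fun w hw => (continuousOn_borelKernel_mul hT hδ w).2.1.aestronglyMeasurable
        measurableSet_Ioi) ?_ hI (Eventually.of_forall fun y =>
        ((differentiable_borelKernel_left γ _).mul_const _).differentiableOn)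
    exact (ae_restrict_iff' measurableSet_Ioi).2 (Eventually.of_forall fun x hx w hw =>
      (norm_borelKernel_mul_ray_le hδ hδ4 hTb (hball w hw).1 hx).1.trans (hray w hw x))
  · refine differentiableAt_integral_of_dominated hρ
      (fun w hw => (continuousOn_borelKernel_mul hT hδ w).2.2.aestronglyMeasurable
        measurableSet_Ioi) ?_ hI (Eventually.of_forall fun y =>
        ((differentiable_borelKernel_left γ _).mul_const _).differentiableOn)
    exact (ae_restrict_iff' measurableSet_Ioi).2 (Eventually.of_forall fun x hx w hw =>
      (norm_borelKernel_mul_ray_le hδ hδ4 hTb (hball w hw).1 hx).2.trans (hray w hw x))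

end Borel

/-- A power series whose partial sums converge at one point `ρ > 0` is summable on the disc. -/
lemma summable_of_tendsto_sum {c : ℕ → ℂ} {ρ : ℝ} (hρ : 0 < ρ) {l : ℂ}
    (h : Tendsto (fun N => ∑ n ∈ Finset.range N, c n * (ρ : ℂ) ^ n) atTop (𝓝 l)) {z : ℂ}
    (hz : ‖z‖ < ρ) : Summable fun n => c n * z ^ n := by
  have h0 : Tendsto (fun n => c n * (ρ : ℂ) ^ n) atTop (𝓝 0) := by
    have := (h.comp (tendsto_add_atTop_nat 1)).sub h
    rw [sub_self] at this
    refine this.congr fun n => ?_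
    simp [Finset.sum_range_succ]
  obtain ⟨A, hA⟩ := h0.norm.bddAbove_range
  have hq : ‖z‖ / ρ < 1 := (div_lt_one hρ).2 hz
  refine Summable.of_norm_bounded
    ((summable_geometric_of_lt_one (by positivity) hq).mul_left A) fun n => ?_
  have h1 : ‖c n * (ρ : ℂ) ^ n‖ ≤ A := hA ⟨n, rfl⟩
  rw [norm_mul, norm_pow, Complex.norm_real, Real.norm_of_nonneg hρ.le] at h1
  rw [norm_mul, norm_pow, div_pow, mul_div_assoc', le_div_iff₀ (by positivity)]
  calc ‖c n‖ * ‖z‖ ^ n * ρ ^ n = (‖c n‖ * ρ ^ n) * ‖z‖ ^ n := by ring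
    _ ≤ _ := by gcongr

/-- The Borel transform with weights `1 / Γ(n + s + 1 / 2)`. The continuation is
`w ^ (1 / 2 - s) / (2 π i)` times the Hankel integral of `v (1 / p)` against
`exp (w p) p ^ (1 / 2 - s)`. For the `N`-th Taylor remainder of `v` in place of `v`, it is the
remainder of the Borel series, and a contour of radius `N / ‖w‖` shows that this tends to `0` for
small `w`. -/
theorem HasGevreySum.hasContinuation {b : ℕ → ℂ} (h : HasGevreySum 1 b) (s : ℕ) :
    HasContinuation 1 fun n => b n / Real.Gamma (n + s + 1 / 2) := by
  obtain ⟨α, R, C, K, v, hα, hR, hC, hK, hv, hb⟩ := h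
  rw [Nat.cast_one, div_one] at hα
  have hpi := Real.pi_pos
  set δ := min ((α - Real.pi) / 4) (Real.pi / 4)
  have hδ : 0 < δ := lt_min (by linarith) (by linarith)
  have hδ4 : δ ≤ Real.pi / 4 := min_le_right _ _
  have hδα : δ ≤ (α - Real.pi) / 4 := min_le_left _ _
  set η := Real.pi / 2 + δ with hη
  have hη0 : 0 ≤ η := by linarith
  have hηα : η < α / 2 := by linarith
  -- the contour stays in the region `‖t‖ ≤ R / e` of the sector, where `t = exp (-ξ)`
  set x₀ := 1 - Real.log R
  set γ : ℝ := 1 / 2 - s with hγ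
  have hmem : ∀ ξ : ℂ, x₀ ≤ ξ.re → |ξ.im| ≤ η → Complex.exp (-ξ) ∈ sector 0 α R := by
    intro ξ h1 h2
    refine ⟨mem_unboundedSector_iff.2 ⟨-ξ, ?_, rfl⟩, ?_⟩
    · rw [sub_zero, Complex.neg_im, abs_neg]
      linarith
    · rw [mem_ball_zero_iff, Complex.norm_exp, Complex.neg_re, ← Real.lt_log_iff_exp_lt hR]
      linarith
  -- the Taylor remainders of `v`, in the coordinate `ξ = log (1 / t)`
  set T : ℕ → ℂ → ℂ := fun N ξ =>
    v (Complex.exp (-ξ)) - ∑ n ∈ Finset.range N, b n * Complex.exp (-ξ) ^ n with hT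
  have hTd : ∀ N, DifferentiableOn ℂ (T N) {ξ | x₀ ≤ ξ.re ∧ |ξ.im| ≤ η} := by
    intro N
    refine DifferentiableOn.sub (hv.comp (by fun_prop) fun ξ hξ => hmem ξ hξ.1 hξ.2) ?_
    fun_prop
  have hTb : ∀ N (x₁ : ℝ), x₀ ≤ x₁ → ∀ ξ : ℂ, x₁ ≤ ξ.re → |ξ.im| ≤ η →
      ‖T N ξ‖ ≤ C * K ^ N * N.factorial * Real.exp (-x₁) ^ N := by
    intro N x₁ h01 ξ h1 h2
    have := hb N _ (hmem ξ (h01.trans h1) h2)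
    rw [Nat.div_one, Complex.norm_exp, Complex.neg_re] at this
    refine this.trans ?_
    gcongr
  set c : ℕ → ℂ := fun n => b n / Real.Gamma (n + s + 1 / 2) with hc
  set B : ℂ → ℂ := fun w => Complex.exp (γ * Complex.log w) / (2 * Real.pi * Complex.I) *
    hankel η (fun ξ => borelKernel w γ ξ * T 0 ξ) x₀ with hB
  have hT0b := hTb 0 x₀ le_rfl
  simp only [pow_zero, mul_one, Nat.factorial_zero, Nat.cast_one] at hT0b
  have hδ2 : δ ≤ 2 * Real.pi := by linarith
  have hnorme : ∀ w : ℂ, ‖Complex.exp (γ * Complex.log w)‖ = Real.exp (γ * Real.log ‖w‖) := by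
    intro w
    rw [Complex.norm_exp]
    simp [Complex.log_re]
  have hnormpi : ‖(2 * Real.pi * Complex.I : ℂ)‖ = 2 * Real.pi := by
    simp [abs_of_pos hpi]
  -- subtracting a Taylor polynomial under the integral subtracts the Borel polynomial
  have hdiff : ∀ w ∈ unboundedSector 0 δ, ∀ N, B w - ∑ n ∈ Finset.range N, c n * w ^ n =
      Complex.exp (γ * Complex.log w) / (2 * Real.pi * Complex.I) *
        hankel η (fun ξ => borelKernel w γ ξ * T N ξ) x₀ := by
    intro w hw N
    have hw0 := ne_zero_of_mem_unboundedSector hw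
    have hterm : ∀ n : ℕ, HankelIntegrable η
        (fun ξ => b n * borelKernel w (1 / 2 - ((n + s : ℕ) : ℝ)) ξ) x₀ := fun n =>
      (hankelIntegrable_borelKernel hδ hδ4 hw _ x₀).const_mul _
    obtain ⟨i1, i2⟩ := hankelIntegrable_sum hterm N
    have i0 : HankelIntegrable η (fun ξ => borelKernel w γ ξ * T 0 ξ) x₀ :=
      hankelIntegrable_borelKernel_mul hδ hδ4 (hTd 0).continuousOn hT0b hw
    have hsplit : (fun ξ => borelKernel w γ ξ * T N ξ) = fun ξ => borelKernel w γ ξ * T 0 ξ -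
        ∑ n ∈ Finset.range N, b n * borelKernel w (1 / 2 - ((n + s : ℕ) : ℝ)) ξ := by
      ext ξ
      simp only [hT, Finset.range_zero, Finset.sum_empty, sub_zero, mul_sub, Finset.mul_sum]
      congr 1
      refine Finset.sum_congr rfl fun n _ => ?_
      rw [borelKernel, borelKernel, mul_left_comm, ← Complex.exp_nat_mul, ← Complex.exp_add, hγ]
      push_cast
      ring_nf
    rw [hsplit, hankel_sub i0 i1, i2, mul_sub, Finset.mul_sum]
    simp only [hB]
    congr 1
    refine Finset.sum_congr rfl fun n _ => ?_
    rw [hankel_const_mul, hankel_borelKernel hδ hδ4 hw]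
    have e1 : w ^ n = Complex.exp (γ * Complex.log w) *
        Complex.exp ((((n + s : ℕ) : ℂ) - 1 / 2) * Complex.log w) := by
      rw [← Complex.exp_add]
      conv_lhs => rw [← Complex.exp_log hw0]
      rw [← Complex.exp_nat_mul, hγ]
      push_cast
      ring_nf
    rw [e1]
    simp only [hc]
    push_cast
    generalize Complex.exp (((n : ℂ) + s - 1 / 2) * Complex.log w) = E₁
    generalize Complex.exp (γ * Complex.log w) = E₂
    generalize (Real.Gamma (n + s + 1 / 2) : ℂ) = G
    field_simp
  have hlim : ∀ w ∈ unboundedSector 0 δ, ‖w‖ ≤ Real.exp (-x₀) → Real.exp 1 * K * ‖w‖ < 1 →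
      Tendsto (fun N => ∑ n ∈ Finset.range N, c n * w ^ n) atTop (𝓝 (B w)) := by
    intro w hw hw1 hw2
    have hw0 : 0 < ‖w‖ := norm_pos_iff.2 (ne_zero_of_mem_unboundedSector hw)
    set q := Real.exp 1 * K * ‖w‖ with hq
    have hq0 : 0 ≤ q := by positivity
    set J := ∫ x in Set.Ioi x₀, Real.exp (-(Real.sin (δ / 2) * ‖w‖) * Real.exp x + γ * x) with hJ
    have hJI := integrableOn_Ioi_exp_neg_mul_exp_add (sin_half_mul_norm_pos hδ hδ4 hw) γ x₀
    have hJ0 : 0 ≤ J := integral_nonneg fun x => (Real.exp_pos _).le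
    set L := Real.exp (-s * x₀)
    set P := ‖Complex.exp (γ * Complex.log w) / (2 * Real.pi * Complex.I)‖
    have hbound : ∀ N : ℕ, 1 ≤ N → ‖B w - ∑ n ∈ Finset.range N, c n * w ^ n‖ ≤
        P * ((2 * η * C * L + 2 * C * J) * q ^ N + 2 * η * C * L / ‖w‖ * (N * q ^ N)) := by
      intro N hN
      have hN0 : (0 : ℝ) < N := by exact_mod_cast hN
      -- the saddle point of `exp (w p) p ^ (-N)` has modulus `N / ‖w‖`
      set x₁ := Real.log (N / ‖w‖) with hx₁
      have hex₁ : Real.exp x₁ = N / ‖w‖ := Real.exp_log (by positivity)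
      have h01 : x₀ ≤ x₁ := by
        rw [hx₁, Real.le_log_iff_exp_le (by positivity), le_div_iff₀ hw0]
        calc Real.exp x₀ * ‖w‖ ≤ Real.exp x₀ * Real.exp (-x₀) := by gcongr
          _ = 1 := by rw [← Real.exp_add, add_neg_cancel, Real.exp_zero]
          _ ≤ N := by exact_mod_cast hN
      have hint := hankelIntegrable_borelKernel_mul (γ := γ) hδ hδ4 (hTd N).continuousOn
        (hTb N x₀ le_rfl) hw
      rw [hdiff w hw N, norm_mul,
        hankel_eq_of_le (h := fun ξ => borelKernel w γ ξ * T N ξ) hη0 h01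
        ((differentiable_borelKernel w γ).differentiableOn.mul (hTd N)) hint.upper hint.lower]
      refine mul_le_mul_of_nonneg_left ?_ (norm_nonneg _)
      refine (norm_hankel_borelKernel_mul_le hδ hδ4 (hTb N x₁ h01) hw).trans ?_
      set D := C * K ^ N * N.factorial * Real.exp (-x₁) ^ N with hD
      have hD0 : 0 ≤ D := by positivity
      have hDle : D ≤ C * (K * ‖w‖) ^ N := by
        have hf : (N.factorial : ℝ) ≤ (N : ℝ) ^ N := by exact_mod_cast Nat.factorial_le_pow N
        calc D ≤ C * K ^ N * (N : ℝ) ^ N * (N / ‖w‖)⁻¹ ^ N := by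
              rw [hD, Real.exp_neg, hex₁]
              gcongr
          _ = C * (K * ‖w‖) ^ N := by
              rw [inv_div, div_pow, mul_pow]
              field_simp
      have hqN : Real.exp N * (K * ‖w‖) ^ N = q ^ N := by
        rw [hq, mul_assoc, mul_pow (Real.exp 1), ← Real.exp_nat_mul, mul_one]
      have hDq : D ≤ C * q ^ N := by
        refine hDle.trans ?_
        gcongr
        rw [hq, mul_assoc]
        exact le_mul_of_one_le_left (by positivity) (Real.one_le_exp zero_le_one)
      have harc : Real.exp (‖w‖ * Real.exp x₁ + γ * x₁) * D ≤
          C * L * (1 + N / ‖w‖) * q ^ N := by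
        have e1 : Real.exp (‖w‖ * Real.exp x₁ + γ * x₁) =
            Real.exp N * Real.exp (x₁ / 2) * Real.exp (-s * x₁) := by
          rw [← Real.exp_add, ← Real.exp_add, hex₁, mul_div_cancel₀ _ hw0.ne', hγ]
          ring_nf
        have e2 : Real.exp (x₁ / 2) ≤ 1 + N / ‖w‖ := by
          have : Real.exp (x₁ / 2) ^ 2 = N / ‖w‖ := by
            rw [← Real.exp_nat_mul, ← hex₁]
            push_cast
            ring_nf
          nlinarith [sq_nonneg (Real.exp (x₁ / 2) - 1)]
        have e3 : Real.exp (-s * x₁) ≤ L := by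
          refine Real.exp_le_exp.2 ?_
          rw [neg_mul, neg_mul, neg_le_neg_iff]
          gcongr
        calc _ ≤ Real.exp N * (1 + N / ‖w‖) * L * (C * (K * ‖w‖) ^ N) := by
              rw [e1]; gcongr
          _ = C * L * (1 + N / ‖w‖) * (Real.exp N * (K * ‖w‖) ^ N) := by ring
          _ = _ := by rw [hqN]
      have hJle : (∫ x in Set.Ioi x₁,
          Real.exp (-(Real.sin (δ / 2) * ‖w‖) * Real.exp x + γ * x)) ≤ J :=
        setIntegral_mono_set hJI (Eventually.of_forall fun x => (Real.exp_pos _).le)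
          (Set.Ioi_subset_Ioi h01).eventuallyLE
      calc _ ≤ 2 * η * (C * L * (1 + N / ‖w‖) * q ^ N) + 2 * (J * (C * q ^ N)) := by gcongr
        _ = _ := by ring
    have hz : Tendsto (fun N : ℕ => P * ((2 * η * C * L + 2 * C * J) * q ^ N +
        2 * η * C * L / ‖w‖ * (N * q ^ N))) atTop (𝓝 0) := by
      have t1 := tendsto_pow_atTop_nhds_zero_of_lt_one hq0 hw2
      have t2 := tendsto_self_mul_const_pow_of_lt_one hq0 hw2
      simpa using ((t1.const_mul (2 * η * C * L + 2 * C * J)).add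
        (t2.const_mul (2 * η * C * L / ‖w‖))).const_mul P
    have hz' : Tendsto (fun N => B w - ∑ n ∈ Finset.range N, c n * w ^ n) atTop (𝓝 0) := by
      refine squeeze_zero_norm' ?_ hz
      filter_upwards [eventually_ge_atTop 1] with N hN using hbound N hN
    simpa using (tendsto_const_nhds (x := B w)).sub hz'
  set ρ := min (Real.exp (-x₀)) (1 / (2 * Real.exp 1 * K))
  have hρ0 : 0 < ρ := by positivity
  have hρlim : ∀ w ∈ unboundedSector 0 δ, ‖w‖ ≤ ρ →
      Tendsto (fun N => ∑ n ∈ Finset.range N, c n * w ^ n) atTop (𝓝 (B w)) := by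
    intro w hw hwρ
    refine hlim w hw (hwρ.trans (min_le_left _ _)) ?_
    have h1 := hwρ.trans (min_le_right _ _)
    rw [le_div_iff₀ (by positivity)] at h1
    linarith
  have hsummable : ∀ z ∈ Metric.ball (0 : ℂ) ρ, Summable fun n => c n * z ^ n := by
    intro z hz
    have hmemρ : (ρ : ℂ) ∈ unboundedSector 0 δ := ⟨ρ, 0, hρ0, by simpa using hδ, by simp⟩
    refine summable_of_tendsto_sum hρ0 (hρlim ρ hmemρ ?_) (mem_ball_zero_iff.1 hz)
    rw [Complex.norm_real, Real.norm_of_nonneg hρ0.le]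
  set J := ∫ x in Set.Ioi x₀, Real.exp (-(Real.sin (δ / 2) * 1) * Real.exp x + γ * x) with hJ
  have hsin : 0 < Real.sin (δ / 2) :=
    Real.sin_pos_of_pos_of_lt_pi (by linarith) (by linarith)
  have hJ0 : 0 ≤ J := integral_nonneg fun x => (Real.exp_pos _).le
  refine hasContinuation_of_sector (r := ρ) (ε := δ) (M := 1) (S := B)
    (C := 1 / (2 * Real.pi) * (2 * η * (Real.exp (γ * x₀) * C) + 2 * (J * C)))
    (K := 1 + Real.exp x₀) hρ0 hδ hsummable ?_ ?_ ?_
  · refine DifferentiableOn.mul (DifferentiableOn.div_const ?_ _)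
      (differentiableOn_hankel_borelKernel_mul hδ hδ4 (hTd 0).continuousOn hT0b)
    intro w hw
    exact (((Complex.hasDerivAt_log
      (mem_slitPlane_of_mem_unboundedSector hδ2 hw)).differentiableAt.const_mul
      _).cexp).differentiableWithinAt
  · intro z hz hzρ
    have h1 := hsummable z (by simpa using hzρ)
    have h2 := tendsto_nhds_unique h1.hasSum.tendsto_sum_nat (hρlim z hz hzρ.le)
    rw [← h2]
    exact h1.hasSum
  · intro w hw hw1
    rw [pow_one]
    have hlog : Real.exp (γ * Real.log ‖w‖) ≤ Real.exp ‖w‖ := by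
      refine Real.exp_le_exp.2 ?_
      have l0 := Real.log_nonneg hw1
      have l1 := Real.log_le_sub_one_of_pos (by linarith : 0 < ‖w‖)
      have l2 : γ ≤ 1 := by
        have : (0 : ℝ) ≤ s := s.cast_nonneg
        rw [hγ]; linarith
      nlinarith
    have hJw : (∫ x in Set.Ioi x₀,
        Real.exp (-(Real.sin (δ / 2) * ‖w‖) * Real.exp x + γ * x)) ≤ J := by
      refine setIntegral_mono_on
        (integrableOn_Ioi_exp_neg_mul_exp_add (sin_half_mul_norm_pos hδ hδ4 hw) γ x₀)
        (integrableOn_Ioi_exp_neg_mul_exp_add (by linarith) γ x₀) measurableSet_Ioi fun x _ => ?_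
      gcongr
    have hn := norm_hankel_borelKernel_mul_le (γ := γ) hδ hδ4 hT0b hw
    have hE1 : 1 ≤ Real.exp (‖w‖ * Real.exp x₀) := Real.one_le_exp (by positivity)
    calc ‖B w‖ = Real.exp (γ * Real.log ‖w‖) / (2 * Real.pi) *
          ‖hankel η (fun ξ => borelKernel w γ ξ * T 0 ξ) x₀‖ := by
          rw [hB, norm_mul, norm_div, hnorme, hnormpi]
      _ ≤ Real.exp ‖w‖ / (2 * Real.pi) *
          (2 * η * (Real.exp (‖w‖ * Real.exp x₀) * (Real.exp (γ * x₀) * C)) +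
            Real.exp (‖w‖ * Real.exp x₀) * (2 * (J * C))) := by
          gcongr
          refine hn.trans (add_le_add ?_ ?_)
          · rw [Real.exp_add, mul_assoc (Real.exp _)]
          · refine le_trans ?_ (le_mul_of_one_le_left (by positivity) hE1)
            gcongr
      _ = 1 / (2 * Real.pi) * (2 * η * (Real.exp (γ * x₀) * C) + 2 * (J * C)) *
          (Real.exp ‖w‖ * Real.exp (‖w‖ * Real.exp x₀)) := by ring
      _ = _ := by rw [← Real.exp_add]; ring_nf

end HeatSum
end

noncomputable section
namespace HeatSum

/-! ### The heat equation and the equivalences -/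

/-- The heat equation determines the formal solution. -/
lemma coeff_coeff_of_heatOp_eq {a : ℂ} {f : PowerSeries ℂ} {u : PowerSeries (PowerSeries ℂ)}
    (hu : heatOp (PowerSeries.C a) u = PowerSeries.C f) (j : ℕ) : ∀ n : ℕ,
    PowerSeries.coeff n (PowerSeries.coeff j u) =
      a ^ j / j.factorial * ((n + 2 * j).factorial / n.factorial) *
        PowerSeries.coeff (n + 2 * j) f := by
  have hcoeff : ∀ j, PowerSeries.coeff j u =
      PowerSeries.C a * PowerSeries.coeff j (dtInv (dz (dz u))) +
        PowerSeries.coeff j (PowerSeries.C f) := by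
    intro j
    have := congrArg (PowerSeries.coeff j) hu
    rw [heatOp, map_sub, PowerSeries.coeff_C_mul] at this
    rw [← this]
    ring
  induction j with
  | zero =>
    intro n
    have hn : (n.factorial : ℂ) ≠ 0 := by exact_mod_cast n.factorial_ne_zero
    rw [hcoeff 0]
    simp [dtInv, hn]
  | succ j ih =>
    intro n
    have h1 : PowerSeries.coeff (j + 1) (PowerSeries.C f : PowerSeries (PowerSeries ℂ)) = 0 := by
      simp
    have hn : (n.factorial : ℂ) ≠ 0 := by exact_mod_cast n.factorial_ne_zero
    have hj1 : (j : ℂ) + 1 ≠ 0 := by exact_mod_cast j.succ_ne_zero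
    have hn2 : (n : ℂ) + 1 + 1 ≠ 0 := by exact_mod_cast (n + 1).succ_ne_zero
    rw [hcoeff (j + 1), h1, add_zero, PowerSeries.coeff_C_mul]
    simp only [dtInv, dz, PowerSeries.coeff_mk, PowerSeries.coeff_smul, PowerSeries.coeff_derivative,
      smul_eq_mul]
    rw [ih (n + 1 + 1), show n + 1 + 1 + 2 * j = n + 2 * (j + 1) by ring, Nat.factorial_succ (n + 1),
      Nat.factorial_succ n, Nat.factorial_succ j]
    push_cast
    field_simp
    ring

lemma coeff_zPart_of_heatOp_eq {a : ℂ} {f : PowerSeries ℂ} {u : PowerSeries (PowerSeries ℂ)}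
    (hu : heatOp (PowerSeries.C a) u = PowerSeries.C f) (n j : ℕ) :
    PowerSeries.coeff j (zPart n u) =
      a ^ j * ((n + 2 * j).factorial / j.factorial) * PowerSeries.coeff (n + 2 * j) f := by
  have hn : (n.factorial : ℂ) ≠ 0 := by exact_mod_cast n.factorial_ne_zero
  rw [zPart, PowerSeries.coeff_mk, coeff_coeff_of_heatOp_eq hu]
  field_simp

theorem hasGevreySum_interleave_iff (L : ℕ → ℂ) :
    (HasGevreySum 2 L ∧ HasGevreySum 2 fun n => (-1) ^ n * L n) ↔
      (HasGevreySum 1 fun n => L (2 * n)) ∧ HasGevreySum 1 fun n => L (2 * n + 1) := by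
  refine ⟨fun h => h.1.even_odd h.2, fun h => ⟨h.1.interleave h.2,
    HasGevreySum.interleave ?_ ?_⟩⟩
  · simpa [pow_mul] using h.1
  · simpa [pow_succ, pow_mul] using h.2.const_mul (-1)

theorem hasContinuation_interleave_iff (L : ℕ → ℂ) :
    (HasContinuation 2 L ∧ HasContinuation 2 fun n => (-1) ^ n * L n) ↔
      (HasContinuation 1 fun n => L (2 * n)) ∧ HasContinuation 1 fun n => L (2 * n + 1) := by
  refine ⟨fun h => h.1.even_odd h.2, fun h => ⟨h.1.interleave h.2,
    HasContinuation.interleave ?_ ?_⟩⟩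
  · simpa [pow_mul] using h.1
  · simpa [pow_succ, pow_mul] using h.2.const_mul (-1)

lemma hasGevreySum_rescale_iff (k : ℕ) (c : ℕ → ℂ) {l : ℝ} (hl : 0 < l) {κ : ℂ} (hκ : κ ≠ 0) :
    (HasGevreySum k fun n => κ * ((l : ℂ) ^ n * c n)) ↔ HasGevreySum k c := by
  refine ⟨fun h => ?_, fun h => (h.rescale hl).const_mul κ⟩
  have := (h.const_mul κ⁻¹).rescale (inv_pos.2 hl)
  convert this using 2 with n
  have hl' : (l : ℂ) ≠ 0 := Complex.ofReal_ne_zero.2 hl.ne'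
  push_cast
  rw [inv_mul_cancel_left₀ hκ, ← mul_assoc, ← mul_pow, inv_mul_cancel₀ hl', one_pow, one_mul]

/-- The Borel and Laplace transforms are inverse to each other. -/
theorem hasGevreySum_iff_hasContinuation (s : ℕ) (g : ℕ → ℂ) :
    (HasGevreySum 1 fun n => g n * Real.Gamma (n + s + 1 / 2)) ↔ HasContinuation 1 g := by
  constructor
  · intro h
    have := h.hasContinuation s
    convert this using 2 with n
    have hG : (Real.Gamma (n + s + 1 / 2) : ℂ) ≠ 0 :=
      Complex.ofReal_ne_zero.2 (Real.Gamma_pos_of_pos (by positivity)).ne'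
    rw [mul_div_cancel_right₀ _ hG]
  · intro h
    have := h.hasGevreySum (β := s + 1 / 2) (by positivity)
    simpa only [add_assoc] using this

/-- Legendre's duplication formula, for the two parities. -/
lemma factorial_two_mul_add {s : ℕ} (hs : s ≤ 1) (n : ℕ) :
    ((s + 2 * n).factorial : ℝ) =
      (Real.Gamma (s + 1 / 2))⁻¹ * 4 ^ n * Real.Gamma (n + s + 1 / 2) * n.factorial := by
  have hG : Real.Gamma (s + 1 / 2) ≠ 0 := (Real.Gamma_pos_of_pos (by positivity)).ne'
  induction n with
  | zero =>
    interval_cases s <;> simp at hG ⊢ <;> field_simp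
  | succ n ih =>
    have h1 : Real.Gamma ((n + 1 : ℕ) + s + 1 / 2) =
        (n + s + 1 / 2) * Real.Gamma (n + s + 1 / 2) := by
      rw [← Real.Gamma_add_one (by positivity)]
      push_cast
      ring_nf
    rw [show s + 2 * (n + 1) = s + 2 * n + 1 + 1 by ring, Nat.factorial_succ, Nat.factorial_succ, h1,
      Nat.factorial_succ]
    push_cast
    rw [ih]
    interval_cases s <;> (push_cast; ring)

/-- By the duplication formula the weights `(s + 2 n)! / n!` are those of the Borel–Laplace pair, up to
a constant and a rescaling by `4`. -/
theorem hasGevreySum_factorial_iff {s : ℕ} (hs : s ≤ 1) (g : ℕ → ℂ) :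
    (HasGevreySum 1 fun n => ((s + 2 * n).factorial / n.factorial : ℂ) * g n) ↔
      HasContinuation 1 g := by
  have hG : ((Real.Gamma (s + 1 / 2))⁻¹ : ℂ) ≠ 0 :=
    inv_ne_zero (Complex.ofReal_ne_zero.2 (Real.Gamma_pos_of_pos (by positivity)).ne')
  rw [← hasGevreySum_iff_hasContinuation s g,
    ← hasGevreySum_rescale_iff 1 (fun n => g n * (Real.Gamma (n + s + 1 / 2) : ℂ)) (l := 4)
      (by norm_num) hG]
  refine iff_of_eq (congrArg _ (funext fun n => ?_))
  have hn : (n.factorial : ℂ) ≠ 0 := by exact_mod_cast n.factorial_ne_zero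
  have h := congrArg (Complex.ofReal) (factorial_two_mul_add hs n)
  push_cast at h ⊢
  rw [h]
  field_simp

/-- Directions modulo `π` amount to the two signs of `exp (d * I)`. -/
lemma forall_int_exp_iff (P : (ℕ → ℂ) → Prop) (x : ℕ → ℂ) (d : ℝ) :
    (∀ m : ℤ, P fun n => x n * Complex.exp ((d + m * Real.pi : ℝ) * Complex.I) ^ n) ↔
      (P fun n => x n * Complex.exp (d * Complex.I) ^ n) ∧
        P fun n => (-1) ^ n * (x n * Complex.exp (d * Complex.I) ^ n) := by
  have heven : ∀ k : ℤ, Complex.exp ((d + (2 * k : ℤ) * Real.pi : ℝ) * Complex.I) =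
      Complex.exp (d * Complex.I) := by
    intro k
    rw [show ((d + (2 * k : ℤ) * Real.pi : ℝ) : ℂ) * Complex.I =
      d * Complex.I + k * (2 * Real.pi * Complex.I) by push_cast; ring, Complex.exp_add,
      Complex.exp_int_mul_two_pi_mul_I, mul_one]
  have hodd : ∀ k : ℤ, Complex.exp ((d + (2 * k + 1 : ℤ) * Real.pi : ℝ) * Complex.I) =
      -Complex.exp (d * Complex.I) := by
    intro k
    rw [show ((d + (2 * k + 1 : ℤ) * Real.pi : ℝ) : ℂ) * Complex.I =
      d * Complex.I + k * (2 * Real.pi * Complex.I) + Real.pi * Complex.I by push_cast; ring,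
      Complex.exp_add, Complex.exp_add, Complex.exp_int_mul_two_pi_mul_I, Complex.exp_pi_mul_I]
    ring
  have hneg : ∀ n : ℕ, x n * (-Complex.exp (d * Complex.I)) ^ n =
      (-1) ^ n * (x n * Complex.exp (d * Complex.I) ^ n) := by
    intro n
    rw [neg_pow]
    ring
  constructor
  · intro h
    have h0 := h (2 * 0)
    have h1 := h (2 * 0 + 1)
    simp only [heven] at h0
    simp only [hodd, hneg] at h1
    exact ⟨h0, h1⟩
  · rintro ⟨h0, h1⟩ m
    obtain ⟨k, rfl | rfl⟩ := m.even_or_odd'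
    · simpa only [heven] using h0
    · simpa only [hodd, hneg] using h1

end HeatSum
end

theorem mainTheorem3 (a : ℂ) (ha : a ≠ 0) (θ : ℝ) (f : PowerSeries ℂ)
    (u : PowerSeries (PowerSeries ℂ))
    (hu : HeatSum.heatOp (PowerSeries.C a) u = PowerSeries.C f) :
    List.TFAE [
      HeatSum.IsSummable 1 θ (HeatSum.zPart 0 u) ∧ HeatSum.IsSummable 1 θ (HeatSum.zPart 1 u),
      ∀ m : ℤ, HeatSum.IsSummable 2 ((θ + Complex.arg a) / 2 + m * Real.pi) (HeatSum.laplace2 f),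
      ∀ m : ℤ, HeatSum.ContinuesWithGrowth 2 ((θ + Complex.arg a) / 2 + m * Real.pi) f] := by
  set d : ℝ := (θ + Complex.arg a) / 2 with hd
  set e : ℂ := Complex.exp (d * Complex.I) with he
  have he0 : e ≠ 0 := Complex.exp_ne_zero _
  have ha0 : 0 < ‖a‖ := norm_pos_iff.2 ha
  -- `F` and `L` are the coefficients of `f` and of its Laplace transform in the direction `d`
  set F : ℕ → ℂ := fun n => PowerSeries.coeff n f * e ^ n with hF
  set L : ℕ → ℂ := fun n => PowerSeries.coeff n (HeatSum.laplace2 f) * e ^ n with hL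
  -- multiplication by `a` in the direction `θ` is a squared rotation by `d`, up to a positive factor
  have hae : a * Complex.exp (θ * Complex.I) = ‖a‖ * e ^ 2 := by
    conv_lhs => rw [← Complex.norm_mul_exp_arg_mul_I a]
    rw [he, ← Complex.exp_nat_mul, mul_assoc, ← Complex.exp_add, hd]
    push_cast
    ring_nf
  have hz : ∀ s n : ℕ, s ≤ 1 → PowerSeries.coeff n (HeatSum.zPart s u) *
      Complex.exp (θ * Complex.I) ^ n = (e ^ s)⁻¹ * ((‖a‖ : ℂ) ^ n * L (s + 2 * n)) := by
    intro s n hs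
    rw [HeatSum.coeff_zPart_of_heatOp_eq hu]
    simp only [hL, HeatSum.laplace2, PowerSeries.coeff_mk]
    rw [show (s + 2 * n) / 2 = n by omega, pow_add, pow_mul]
    have h1 : a ^ n * Complex.exp (θ * Complex.I) ^ n = (‖a‖ : ℂ) ^ n * (e ^ 2) ^ n := by
      rw [← mul_pow, hae, mul_pow]
    have h2 : e ^ s ≠ 0 := pow_ne_zero _ he0
    have hn : (n.factorial : ℂ) ≠ 0 := by exact_mod_cast n.factorial_ne_zero
    field_simp
    linear_combination (PowerSeries.coeff (s + 2 * n) f * (s + 2 * n).factorial) * h1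
  have hLF : ∀ s n : ℕ, s ≤ 1 →
      L (s + 2 * n) = ((s + 2 * n).factorial / n.factorial : ℂ) * F (s + 2 * n) := by
    intro s n hs
    simp only [hL, hF, HeatSum.laplace2, PowerSeries.coeff_mk]
    rw [show (s + 2 * n) / 2 = n by omega]
    ring
  have h1 : ∀ s : ℕ, s ≤ 1 → (HeatSum.IsSummable 1 θ (HeatSum.zPart s u) ↔
      HeatSum.HasGevreySum 1 fun n => L (s + 2 * n)) := by
    intro s hs
    rw [HeatSum.isSummable_iff le_rfl]
    simp only [fun n => hz s n hs]
    exact HeatSum.hasGevreySum_rescale_iff 1 _ ha0 (inv_ne_zero (pow_ne_zero _ he0))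
  have h2 : ∀ s : ℕ, s ≤ 1 → ((HeatSum.HasGevreySum 1 fun n => L (s + 2 * n)) ↔
      HeatSum.HasContinuation 1 fun n => F (s + 2 * n)) := by
    intro s hs
    simp only [fun n => hLF s n hs]
    exact HeatSum.hasGevreySum_factorial_iff hs fun n => F (s + 2 * n)
  have h3 : (∀ m : ℤ, HeatSum.IsSummable 2 (d + m * Real.pi) (HeatSum.laplace2 f)) ↔
      (HeatSum.HasGevreySum 1 fun n => L (0 + 2 * n)) ∧
        HeatSum.HasGevreySum 1 fun n => L (1 + 2 * n) := by
    simp only [HeatSum.isSummable_iff one_le_two]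
    rw [HeatSum.forall_int_exp_iff (HeatSum.HasGevreySum 2), ← he,
      HeatSum.hasGevreySum_interleave_iff L]
    simp only [zero_add, add_comm 1]
  have h4 : (∀ m : ℤ, HeatSum.ContinuesWithGrowth 2 (d + m * Real.pi) f) ↔
      (HeatSum.HasContinuation 1 fun n => F (0 + 2 * n)) ∧
        HeatSum.HasContinuation 1 fun n => F (1 + 2 * n) := by
    simp only [HeatSum.continuesWithGrowth_iff]
    rw [HeatSum.forall_int_exp_iff (HeatSum.HasContinuation 2), ← he,
      HeatSum.hasContinuation_interleave_iff F]
    simp only [zero_add, add_comm 1]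
  rw [h1 0 zero_le_one, h1 1 le_rfl, h3, h4, ← h2 0 zero_le_one, ← h2 1 le_rfl]
  tfae_have 1 ↔ 2 := Iff.rfl
  tfae_have 1 ↔ 3 := Iff.rfl
  tfae_finish
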